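/- An algorithm is a program over finite data built from integers written in binary, and its running time is counted in bit operations; it is polynomial-time if its running time is bounded by a polynomial in the bit length of the input. A finite commutative ring $R$ (with identity) is specified by a finite system of generators $e_1,\dots,e_n$ of its additive group, a finite set of relations in $\mathbb{Z}^n$ generating the kernel of $\mathbb{Z}^n\to R$, $v\mapsto\sum_i v_ie_i$, and integers $a_{ijk}$ with $e_ie_j=\sum_k a_{ijk}e_k$. Elements of $R$ are given as integer linear combinations of the $e_i$, and an ideal $I\subset R$ is given by a finite system of generators. An ideal $I$ is nilpotent if $I^n=0$ for some $n>0$; then $1+I$ is a subgroup of the unit group $R^*$. If $S$ is a finite system of generators of an abelian group $G$, a set of defining relations for $S$ is a system of generators for the kernel of $\mathbb{Z}^S\to G$, $(m_s)_{s\in S}\mapsto\prod_{s\in S}s^{m_s}$. **Theorem.** (1) There is a deterministic polynomial-time algorithm that, given a finite commutative ring $R$ and a nilpotent ideal $I\subset R$, produces a finite system $S$ of generators of the subgroup $1+I\subset R^*$, as well as a finite set of defining relations for $S$. (2) There is a deterministic polynomial-time algorithm that, given $R$ and $I$ as before, as well as a finite system $T$ of elements of $1+I$ and an element $\zeta\in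 R$, decides whether $\zeta$ belongs to the subgroup $\langle T\rangle\subset 1+I$ generated by $T$, and if so finds $(m_t)_{t\in T}\in\mathbb{Z}^T$ with $\zeta=\prod_{t\in T}t^{m_t}$. -/

import Mathlib

universe u

namespace NilUnits

/-! ## A model of computation with bit cost

Programs act on binary trees with integer leaves. The size of such a tree is its bit length: one for
every node, plus the binary length of every integer. Every elementary operation costs the size of
its operands plus the size of its result, so arithmetic is never free on large integers, and copying
data is paid for. Each elementary operation is carried out by a Turing machine in time polynomial in
its cost, so the functions that can be computed in polynomial time are the usual ones. -/

/-- Data: binary trees with integer leaves. -/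
inductive Data : Type
  | int (z : ℤ) : Data
  | pair (a b : Data) : Data

/-- The bit length of a datum; integers are written in binary. -/
def Data.size : Data → ℕ
  | .int z => z.natAbs.size + 1
  | .pair a b => a.size + b.size + 1

/-- The integer at a leaf (and `0` for a pair). -/
def Data.toInt : Data → ℤ
  | .int z => z
  | .pair _ _ => 0

/-- The first component of a pair (and `0` for a leaf). -/
def Data.fst : Data → Data
  | .int _ => .int 0
  | .pair a _ => a

/-- The second component of a pair (and `0` for a leaf). -/
def Data.snd : Data → Data
  | .int _ => .int 0
  | .pair _ b => b

/-- Elementary operations. The binary ones expect a pair of integers. -/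
inductive Op : Type
  | const (z : ℤ) : Op
  | id : Op
  | fst : Op
  | snd : Op
  | isPair : Op
  | le : Op
  | add : Op
  | sub : Op
  | mul : Op
  | div : Op

/-- The result of an elementary operation; truth values are `1` and `0`, and `div` is integer
division with nonnegative remainder (with `a / 0 = 0`). -/
def Op.eval : Op → Data → Data
  | .const z, _ => .int z
  | .id, x => x
  | .fst, x => x.fst
  | .snd, x => x.snd
  | .isPair, .int _ => .int 0
  | .isPair, .pair _ _ => .int 1
  | .le, x => .int (if x.fst.toInt ≤ x.snd.toInt then 1 else 0)
  | .add, x => .int (x.fst.toInt + x.snd.toInt)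
  | .sub, x => .int (x.fst.toInt - x.snd.toInt)
  | .mul, x => .int (x.fst.toInt * x.snd.toInt)
  | .div, x => .int (x.fst.toInt / x.snd.toInt)

/-- Programs: elementary operations, sequential composition, running two programs on the same
input and pairing the results, branching, and while loops. -/
inductive Prog : Type
  | op (o : Op) : Prog
  | seq (p q : Prog) : Prog
  | pair (p q : Prog) : Prog
  | ite (c p q : Prog) : Prog
  | loop (c p : Prog) : Prog

/-- `Runs p x y t`: on input `x` the program `p` halts with output `y` after time `t`. A test
succeeds if it yields a nonzero integer. -/
inductive Runs : Prog → Data → Data → ℕ → Prop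
  | op (o : Op) (x : Data) :
      Runs (.op o) x (o.eval x) (x.size + (o.eval x).size + 1)
  | seq {p q : Prog} {x y z : Data} {s t : ℕ} :
      Runs p x y s → Runs q y z t → Runs (.seq p q) x z (s + t + 1)
  | pair {p q : Prog} {x y z : Data} {s t : ℕ} :
      Runs p x y s → Runs q x z t → Runs (.pair p q) x (.pair y z) (s + t + 1)
  | ite_true {c p q : Prog} {x b y : Data} {s t : ℕ} :
      Runs c x b s → b.toInt ≠ 0 → Runs p x y t → Runs (.ite c p q) x y (s + t + 1)
  | ite_false {c p q : Prog} {x b y : Data} {s t : ℕ} :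
      Runs c x b s → b.toInt = 0 → Runs q x y t → Runs (.ite c p q) x y (s + t + 1)
  | loop_stop {c p : Prog} {x b : Data} {s : ℕ} :
      Runs c x b s → b.toInt = 0 → Runs (.loop c p) x x (s + x.size + 1)
  | loop_step {c p : Prog} {x b y z : Data} {s t r : ℕ} :
      Runs c x b s → b.toInt ≠ 0 → Runs p x y t → Runs (.loop c p) y z r →
        Runs (.loop c p) x z (s + t + r + 1)

/-- Programs are deterministic: output and running time are determined by the input. -/
theorem Runs.deterministic {p : Prog} {x y y' : Data} {t t' : ℕ}
    (h : Runs p x y t) (h' : Runs p x y' t') : y = y' ∧ t = t' := by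
  induction h generalizing y' t' with
  | op o x => cases h'; exact ⟨rfl, rfl⟩
  | seq _ _ ih₁ ih₂ =>
    cases h' with
    | seq a b =>
      obtain ⟨rfl, rfl⟩ := ih₁ a
      obtain ⟨rfl, rfl⟩ := ih₂ b
      exact ⟨rfl, rfl⟩
  | pair _ _ ih₁ ih₂ =>
    cases h' with
    | pair a b =>
      obtain ⟨rfl, rfl⟩ := ih₁ a
      obtain ⟨rfl, rfl⟩ := ih₂ b
      exact ⟨rfl, rfl⟩
  | ite_true _ hb _ ih₁ ih₂ =>
    cases h' with
    | ite_true a _ b =>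
      obtain ⟨rfl, rfl⟩ := ih₁ a
      obtain ⟨rfl, rfl⟩ := ih₂ b
      exact ⟨rfl, rfl⟩
    | ite_false a hb' _ =>
      obtain ⟨rfl, rfl⟩ := ih₁ a
      exact absurd hb' hb
  | ite_false _ hb _ ih₁ ih₂ =>
    cases h' with
    | ite_true a hb' _ =>
      obtain ⟨rfl, rfl⟩ := ih₁ a
      exact absurd hb hb'
    | ite_false a _ b =>
      obtain ⟨rfl, rfl⟩ := ih₁ a
      obtain ⟨rfl, rfl⟩ := ih₂ b
      exact ⟨rfl, rfl⟩
  | loop_stop _ hb ih₁ =>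
    cases h' with
    | loop_stop a _ =>
      obtain ⟨rfl, rfl⟩ := ih₁ a
      exact ⟨rfl, rfl⟩
    | loop_step a hb' _ _ =>
      obtain ⟨rfl, rfl⟩ := ih₁ a
      exact absurd hb hb'
  | loop_step _ hb _ _ ih₁ ih₂ ih₃ =>
    cases h' with
    | loop_stop a hb' =>
      obtain ⟨rfl, rfl⟩ := ih₁ a
      exact absurd hb' hb
    | loop_step a _ b c =>
      obtain ⟨rfl, rfl⟩ := ih₁ a
      obtain ⟨rfl, rfl⟩ := ih₂ b
      obtain ⟨rfl, rfl⟩ := ih₃ c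
      exact ⟨rfl, rfl⟩

/-- Reading the input and writing the output are both paid for. -/
theorem Runs.size_le_time {p : Prog} {x y : Data} {t : ℕ} (h : Runs p x y t) :
    x.size ≤ t ∧ y.size ≤ t := by
  induction h with
  | pair _ _ ih₁ ih₂ => simp only [Data.size]; omega
  | _ => omega

/-- On input `x` the program `p` halts with output `y` within time `B (size of x)`. -/
def RunsInTime (p : Prog) (B : Polynomial ℕ) (x y : Data) : Prop :=
  ∃ t : ℕ, Runs p x y t ∧ t ≤ B.eval x.size

/-! ## Encodings -/

/-- A list of data as a datum. -/
def encList : List Data → Data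
  | [] => .int 0
  | d :: l => .pair d (encList l)

/-- An integer vector as a datum. -/
def encVec {n : ℕ} (v : Fin n → ℤ) : Data :=
  encList (List.ofFn fun i => .int (v i))

/-- A list of integer vectors as a datum. -/
def encVecs {n : ℕ} (l : List (Fin n → ℤ)) : Data :=
  encList (l.map encVec)

/-- `none` as `0`, and a vector as a pair containing it. -/
def encOption {n : ℕ} : Option (Fin n → ℤ) → Data
  | none => .int 0
  | some v => .pair (.int 1) (encVec v)

/-! ## Rings given by generators, relations and structure constants -/

/-- The finite data specifying a ring: the number `n` of generators of the additive group, a finite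
list of relations among them, and for every two generators the coefficients of their product. -/
structure RingSpec : Type where
  n : ℕ
  rels : List (Fin n → ℤ)
  mul : Fin n → Fin n → Fin n → ℤ

/-- A ring specification as a datum: the list of relations and the table of structure constants. -/
def RingSpec.enc (P : RingSpec) : Data :=
  .pair (encVecs P.rels)
    (encList (List.ofFn fun i => encVecs (List.ofFn fun j => P.mul i j)))

/-- The integer linear combination of the `e i` with coefficients `v i`. -/
def lin {R : Type u} [CommRing R] {n : ℕ} (e : Fin n → R) (v : Fin n → ℤ) : R :=
  ∑ i, v i • e i

/-- The ring `R` is specified by `P`, the generators being the elements `e i`: they generate the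
additive group of `R`, their integer linear relations are those generated by the listed ones, and
they multiply according to the structure constants. -/
structure RingSpec.Specifies (P : RingSpec) {R : Type u} [CommRing R] (e : Fin P.n → R) :
    Prop where
  surjective : Function.Surjective (lin e)
  relations : ∀ v : Fin P.n → ℤ, lin e v = 0 ↔ v ∈ AddSubgroup.closure {r | r ∈ P.rels}
  mul_eq : ∀ i j, e i * e j = lin e (P.mul i j)

/-! ## The group `1 + I` -/

/-- The group `1 + I` of the units of the form `1 + x` with `x ∈ I`. If `I` is nilpotent, then
`1 + x` is a unit for every `x ∈ I`, see `exists_mem_onePlus`. -/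
def onePlus {R : Type u} [CommRing R] (I : Ideal R) : Subgroup Rˣ where
  carrier := {w | ∃ x ∈ I, (w : R) = 1 + x}
  one_mem' := ⟨0, I.zero_mem, by simp⟩
  mul_mem' := by
    rintro a b ⟨x, hx, ha⟩ ⟨y, hy, hb⟩
    refine ⟨x + y + x * y, I.add_mem (I.add_mem hx hy) (I.mul_mem_right y hx), ?_⟩
    rw [Units.val_mul, ha, hb]
    ring
  inv_mem' := by
    rintro a ⟨x, hx, ha⟩
    refine ⟨-((a⁻¹ : Rˣ) : R) * x, I.mul_mem_left _ hx, ?_⟩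
    have h : ((a⁻¹ : Rˣ) : R) * (1 + x) = 1 := by rw [← ha, Units.inv_mul]
    linear_combination h

theorem exists_mem_onePlus {R : Type u} [CommRing R] {I : Ideal R} (hI : IsNilpotent I) {x : R}
    (hx : x ∈ I) : ∃ w ∈ onePlus I, (w : R) = 1 + x := by
  obtain ⟨n, hn⟩ := hI
  have hn' : IsNilpotent x :=
    ⟨n, by simpa [hn] using Ideal.pow_mem_pow hx n⟩
  obtain ⟨w, hw⟩ := hn'.isUnit_one_add
  exact ⟨w, ⟨x, hx, hw⟩, hw⟩

/-- The list `rels` is a set of defining relations for the finite system `s` of elements of a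
commutative group: it generates the kernel of `b ↦ ∏ i, s i ^ b i`. -/
def IsDefiningRelations {G : Type u} [CommGroup G] {m : ℕ} (s : Fin m → G)
    (rels : List (Fin m → ℤ)) : Prop :=
  ∀ b : Fin m → ℤ, ∏ i, s i ^ b i = 1 ↔ b ∈ AddSubgroup.closure {r | r ∈ rels}

end NilUnits

open NilUnits

/-!
Put `J k = I ^ 2 ^ k`. This chain of ideals reaches zero after `m` steps, where `m` is the number
`n` of generators of the ring times the binary length of a number `N` that kills its additive group:
every squaring at least halves the number of elements until the ideal is zero (`Models.pow_eq_bot`).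
Since `J (k + 1) = J k ^ 2`, the map `1 + x ↦ x` induces an injective homomorphism from `(1 + J k) /
(1 + J (k + 1))` to the additive group `J k / J (k + 1)` (`layerHom`, `prod_zpow_mem_iff`). Hence
the elements `1 + b`, where `b` runs through a basis of `J k` as a lattice of coordinate vectors and
`k` through the layers, generate `1 + I`. An element of `1 + I` is written in terms of them by
linear algebra over `ℤ` in each layer, followed by a multiplication that moves it to the next layer
(`IsFiltr.dlog_spec`). Every linear relation between the `b` modulo `J (k + 1)` gives a product that
lies in the later layers; rewriting this product there yields a relation, and the relations of all
layers together are defining relations (`expProd_eq_one_iff`, `IsFiltr.relMats_spec`). Given these,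
the discrete logarithm in a subgroup `⟨T⟩` is again linear algebra over `ℤ`: the exponent vector of
`ζ` has to be a combination of those of the elements of `T` modulo the lattice of relations
(`IsFiltr.dlogVec_sub_mem_iff`).

All lattices that occur contain the multiples of a known number `N` of polynomial bit length, so
they are represented by triangular matrices with entries between `0` and `N`, found by running the
Euclidean algorithm on each column and reducing modulo `N` (`tri_spec`); no intermediate result
grows. For the ring, `N` is the determinant of the Gram matrix of the given relations, up to sign;
it is not zero because the ring is finite (`gram_det`). It is computed by the recursion of Faddeev
and LeVerrier, whose divisions are exact and whose intermediate results have polynomial bit length.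
For the group `1 + I` the number `N ^ m` serves. The identity of the ring is not part of the input;
it is found by solving `e j * u = e j` for every generator and combining the solutions
(`Models.ev_oneVec`).

The running times are handled by the predicate `PolyTime` on functions between encoded types. It is
closed under composition, branching, maps over lists, and left folds whose state remains
polynomially bounded (`PolyTime.foldl_inv`), and `fun_prop` verifies it for the algorithms.
-/

namespace NilUnits

/-! ### Functions computable in polynomial time -/

/-- A representation of the elements of a type as data. -/
class Encoding (α : Type) where
  enc : α → Data

open Encoding

/-- The bit length of the encoding of an element. -/
def sz {α : Type} [Encoding α] (a : α) : ℕ := (enc a).size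

instance : Encoding ℤ := ⟨.int⟩
instance : Encoding ℕ := ⟨fun n => .int n⟩
instance : Encoding Bool := ⟨fun b => .int (if b then 1 else 0)⟩
instance {α β : Type} [Encoding α] [Encoding β] : Encoding (α × β) :=
  ⟨fun p => .pair (enc p.1) (enc p.2)⟩
instance {α : Type} [Encoding α] : Encoding (List α) := ⟨fun l => encList (l.map enc)⟩
instance {α : Type} [Encoding α] : Encoding (Option α) :=
  ⟨fun o => o.elim (.int 0) fun a => .pair (.int 1) (enc a)⟩

/-- A single program computes `f` on the encodings, in time bounded by a polynomial in the bit
length of the argument. -/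
@[fun_prop]
def PolyTime {α β : Type} [Encoding α] [Encoding β] (f : α → β) : Prop :=
  ∃ (p : Prog) (B : Polynomial ℕ), ∀ a, RunsInTime p B (enc a) (enc (f a))

/-- A number depending on `a` is bounded by a polynomial in the bit length of `a`. -/
@[fun_prop]
def PolyBdd {α : Type} [Encoding α] (g : α → ℕ) : Prop :=
  ∃ B : Polynomial ℕ, ∀ a, g a ≤ B.eval (sz a)

theorem eval_mono (B : Polynomial ℕ) {m n : ℕ} (h : m ≤ n) : B.eval m ≤ B.eval n := by
  rw [Polynomial.eval_eq_sum, Polynomial.eval_eq_sum]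
  exact Finset.sum_le_sum fun i _ => Nat.mul_le_mul_left _ (Nat.pow_le_pow_left h i)

section

variable {α β γ δ σ τ : Type} [Encoding α] [Encoding β] [Encoding γ] [Encoding δ] [Encoding σ]
  [Encoding τ]

theorem PolyBdd.mono {f g : α → ℕ} (hg : PolyBdd g) (h : ∀ a, f a ≤ g a) : PolyBdd f := by
  obtain ⟨B, hB⟩ := hg
  exact ⟨B, fun a => (h a).trans (hB a)⟩

@[fun_prop]
theorem PolyBdd.const (c : ℕ) : PolyBdd (fun _ : α => c) := ⟨Polynomial.C c, fun a => by simp⟩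

@[fun_prop]
theorem PolyBdd.add {f g : α → ℕ} (hf : PolyBdd f) (hg : PolyBdd g) :
    PolyBdd (fun a => f a + g a) := by
  obtain ⟨B, hB⟩ := hf
  obtain ⟨C, hC⟩ := hg
  exact ⟨B + C, fun a => by simpa using Nat.add_le_add (hB a) (hC a)⟩

@[fun_prop]
theorem PolyBdd.mul {f g : α → ℕ} (hf : PolyBdd f) (hg : PolyBdd g) :
    PolyBdd (fun a => f a * g a) := by
  obtain ⟨B, hB⟩ := hf
  obtain ⟨C, hC⟩ := hg
  exact ⟨B * C, fun a => by simpa using Nat.mul_le_mul (hB a) (hC a)⟩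

@[fun_prop]
theorem PolyTime.polyBdd_sz {f : α → β} (hf : PolyTime f) : PolyBdd (fun a => sz (f a)) := by
  obtain ⟨p, B, h⟩ := hf
  refine ⟨B, fun a => ?_⟩
  obtain ⟨t, ht, htB⟩ := h a
  exact ht.size_le_time.2.trans htB

theorem PolyBdd.eval {g : α → ℕ} (hg : PolyBdd g) (C : Polynomial ℕ) :
    PolyBdd (fun a => C.eval (g a)) := by
  obtain ⟨B, hB⟩ := hg
  exact ⟨C.comp B, fun a => by rw [Polynomial.eval_comp]; exact eval_mono C (hB a)⟩

theorem PolyBdd.comp {g : β → ℕ} {f : α → β} (hg : PolyBdd g) (hf : PolyTime f) :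
    PolyBdd (fun a => g (f a)) := by
  obtain ⟨C, hC⟩ := hg
  exact (hf.polyBdd_sz.eval C).mono fun a => hC (f a)

/-- It is enough to bound the running time by any polynomially bounded quantity. -/
theorem PolyTime.of_runs {f : α → β} (p : Prog) (g : α → ℕ) (hg : PolyBdd g)
    (h : ∀ a, ∃ t, Runs p (enc a) (enc (f a)) t ∧ t ≤ g a) : PolyTime f := by
  obtain ⟨B, hB⟩ := hg
  refine ⟨p, B, fun a => ?_⟩
  obtain ⟨t, ht, hle⟩ := h a
  exact ⟨t, ht, hle.trans (hB a)⟩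

/-- A program for `f`, with its running time as a polynomially bounded function. -/
theorem PolyTime.runs {f : α → β} (hf : PolyTime f) :
    ∃ (p : Prog) (g : α → ℕ), PolyBdd g ∧ ∀ a, ∃ t, Runs p (enc a) (enc (f a)) t ∧ t ≤ g a := by
  obtain ⟨p, B, h⟩ := hf
  exact ⟨p, fun a => B.eval (sz a), ⟨B, fun a => le_rfl⟩, h⟩

@[fun_prop]
theorem PolyBdd.sz_self : PolyBdd (fun a : α => sz a) := ⟨Polynomial.X, fun a => by simp⟩

theorem PolyTime.of_op {f : α → β} (o : Op) (g : α → ℕ) (hg : PolyBdd g)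
    (h : ∀ a, o.eval (enc a) = enc (f a)) (hs : ∀ a, sz (f a) ≤ g a) : PolyTime f := by
  refine .of_runs (.op o) (fun a => sz a + g a + 1) (by fun_prop) fun a => ?_
  refine ⟨sz a + sz (f a) + 1, ?_, by have := hs a; omega⟩
  have := Runs.op o (enc a)
  rw [h a] at this
  exact this

@[fun_prop]
theorem PolyTime.id : PolyTime (fun a : α => a) :=
  .of_op .id (fun a => sz a) (by fun_prop) (fun _ => rfl) fun _ => le_rfl

theorem PolyTime.comp {g : β → γ} {f : α → β} (hg : PolyTime g) (hf : PolyTime f) :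
    PolyTime (fun a => g (f a)) := by
  obtain ⟨p, B, hB, hp⟩ := hf.runs
  obtain ⟨q, C, hC, hq⟩ := hg.runs
  refine .of_runs (.seq p q) (fun a => B a + C (f a) + 1)
    ((hB.add (hC.comp hf)).add (.const 1)) fun a => ?_
  obtain ⟨s, hs, hsB⟩ := hp a
  obtain ⟨t, ht, htC⟩ := hq (f a)
  exact ⟨_, .seq hs ht, by omega⟩

@[fun_prop]
theorem PolyTime.comp' {g : β → γ} {f : α → β} (hg : PolyTime g) (hf : PolyTime f) :
    PolyTime (fun a => g (f a)) := hg.comp hf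

@[fun_prop]
theorem PolyTime.prodMk {f : α → β} {g : α → γ} (hf : PolyTime f) (hg : PolyTime g) :
    PolyTime (fun a => (f a, g a)) := by
  obtain ⟨p, B, hB, hp⟩ := hf.runs
  obtain ⟨q, C, hC, hq⟩ := hg.runs
  refine .of_runs (.pair p q) (fun a => B a + C a + 1) (by fun_prop) fun a => ?_
  obtain ⟨s, hs, hsB⟩ := hp a
  obtain ⟨t, ht, htC⟩ := hq a
  exact ⟨_, .pair hs ht, by omega⟩

theorem sz_int (z : ℤ) : sz z = z.natAbs.size + 1 := rfl

theorem sz_nat (n : ℕ) : sz n = n.size + 1 := rfl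

theorem sz_bool_le (b : Bool) : sz b ≤ 2 := by cases b <;> decide

theorem sz_prod (p : α × β) : sz p = sz p.1 + sz p.2 + 1 := rfl

theorem sz_nil : sz ([] : List α) = 1 := rfl

theorem sz_cons (x : α) (l : List α) : sz (x :: l) = sz x + sz l + 1 := rfl

@[fun_prop]
theorem PolyTime.fst : PolyTime (fun p : α × β => p.1) :=
  .of_op .fst (fun p => sz p) (by fun_prop) (fun _ => rfl) fun p => by rw [sz_prod]; omega

@[fun_prop]
theorem PolyTime.snd : PolyTime (fun p : α × β => p.2) :=
  .of_op .snd (fun p => sz p) (by fun_prop) (fun _ => rfl) fun p => by rw [sz_prod]; omega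

theorem exists_const_prog (d : Data) :
    ∃ (p : Prog) (c k : ℕ), ∀ x, ∃ t, Runs p x d t ∧ t ≤ c * x.size + k := by
  induction d with
  | int z =>
    exact ⟨.op (.const z), 1, (Data.int z).size + 1, fun x => ⟨_, .op _ x, by
      simp only [Op.eval]; omega⟩⟩
  | pair a b iha ihb =>
    obtain ⟨p, c, k, hp⟩ := iha
    obtain ⟨q, c', k', hq⟩ := ihb
    refine ⟨.pair p q, c + c', k + k' + 1, fun x => ?_⟩
    obtain ⟨s, hs, hs'⟩ := hp x
    obtain ⟨t, ht, ht'⟩ := hq x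
    exact ⟨_, .pair hs ht, by rw [add_mul]; omega⟩

@[fun_prop]
theorem PolyTime.const (b : β) : PolyTime (fun _ : α => b) := by
  obtain ⟨p, c, k, h⟩ := exists_const_prog (enc b)
  exact .of_runs p (fun a => c * sz a + k) (by fun_prop) fun a => h (enc a)

/-- A function whose values have the same encodings as those of `g` is as easy as `g`. -/
theorem PolyTime.of_enc_eq {f : α → β} {g : α → γ} (hg : PolyTime g)
    (h : ∀ a, enc (f a) = enc (g a)) : PolyTime f := by
  obtain ⟨p, B, hp⟩ := hg
  exact ⟨p, B, fun a => h a ▸ hp a⟩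

/-! ### Arithmetic and branching -/

theorem natSize_le_size_of_le {m n : ℕ} (h : m ≤ n) : m.size ≤ n.size := Nat.size_le_size h

theorem natSize_add_le (m n : ℕ) : (m + n).size ≤ max m.size n.size + 1 := by
  rw [Nat.size_le, pow_succ]
  have h1 : m < 2 ^ max m.size n.size :=
    m.lt_size_self.trans_le (Nat.pow_le_pow_right two_pos (le_max_left _ _))
  have h2 : n < 2 ^ max m.size n.size :=
    n.lt_size_self.trans_le (Nat.pow_le_pow_right two_pos (le_max_right _ _))
  omega

theorem natSize_mul_le (m n : ℕ) : (m * n).size ≤ m.size + n.size := by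
  rw [Nat.size_le, pow_add]
  exact Nat.mul_lt_mul'' m.lt_size_self n.lt_size_self

theorem sz_add_le (x y : ℤ) : sz (x + y) ≤ sz x + sz y := by
  have h1 := natSize_le_size_of_le (Int.natAbs_add_le x y)
  have h2 := natSize_add_le x.natAbs y.natAbs
  simp only [sz_int]
  omega

theorem sz_neg (x : ℤ) : sz (-x) = sz x := by simp [sz_int]

theorem sz_sub_le (x y : ℤ) : sz (x - y) ≤ sz x + sz y := by
  rw [sub_eq_add_neg, ← sz_neg y]
  exact sz_add_le _ _

theorem sz_mul_le (x y : ℤ) : sz (x * y) ≤ sz x + sz y := by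
  have h := natSize_mul_le x.natAbs y.natAbs
  rw [← Int.natAbs_mul] at h
  simp only [sz_int]
  omega

theorem sz_ediv_le (x y : ℤ) : sz (x / y) ≤ sz x := by
  have h := natSize_le_size_of_le (Int.natAbs_ediv_le_natAbs x y)
  simp only [sz_int]
  omega

@[fun_prop]
theorem PolyTime.intAdd : PolyTime (fun p : ℤ × ℤ => p.1 + p.2) :=
  .of_op .add (fun p => sz p.1 + sz p.2) (by fun_prop) (fun _ => rfl) fun p => sz_add_le _ _

@[fun_prop]
theorem PolyTime.intSub : PolyTime (fun p : ℤ × ℤ => p.1 - p.2) :=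
  .of_op .sub (fun p => sz p.1 + sz p.2) (by fun_prop) (fun _ => rfl) fun p => sz_sub_le _ _

@[fun_prop]
theorem PolyTime.intMul : PolyTime (fun p : ℤ × ℤ => p.1 * p.2) :=
  .of_op .mul (fun p => sz p.1 + sz p.2) (by fun_prop) (fun _ => rfl) fun p => sz_mul_le _ _

@[fun_prop]
theorem PolyTime.intDiv : PolyTime (fun p : ℤ × ℤ => p.1 / p.2) :=
  .of_op .div (fun p => sz p.1) (by fun_prop) (fun _ => rfl) fun p => sz_ediv_le _ _

@[fun_prop]
theorem PolyTime.intNeg {f : α → ℤ} (hf : PolyTime f) : PolyTime (fun a => -f a) := by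
  have : PolyTime (fun a => 0 - f a) := by fun_prop
  simpa using this

@[fun_prop]
theorem PolyTime.intMod {f g : α → ℤ} (hf : PolyTime f) (hg : PolyTime g) :
    PolyTime (fun a => f a % g a) := by
  simp only [Int.emod_def]
  fun_prop

/-- Comparison of integers as a truth value. -/
def leb (x y : ℤ) : Bool := decide (x ≤ y)

@[fun_prop]
theorem PolyTime.leb : PolyTime (fun p : ℤ × ℤ => leb p.1 p.2) :=
  .of_op .le (fun _ => 2) (by fun_prop)
    (fun p => by simp [Op.eval, Data.toInt, NilUnits.leb, enc, Data.fst, Data.snd]; rfl)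
    fun _ => sz_bool_le _

@[fun_prop]
theorem PolyTime.cond {c : α → Bool} {f g : α → β} (hc : PolyTime c) (hf : PolyTime f)
    (hg : PolyTime g) : PolyTime (fun a => cond (c a) (f a) (g a)) := by
  obtain ⟨r, D, hD, hr⟩ := hc.runs
  obtain ⟨p, B, hB, hp⟩ := hf.runs
  obtain ⟨q, C, hC, hq⟩ := hg.runs
  refine .of_runs (.ite r p q) (fun a => D a + B a + C a + 1) (by fun_prop) fun a => ?_
  obtain ⟨u, hu, huD⟩ := hr a
  obtain ⟨s, hs, hsB⟩ := hp a
  obtain ⟨t, ht, htC⟩ := hq a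
  cases hca : c a with
  | true =>
    exact ⟨_, .ite_true hu (by simp [hca, enc, Data.toInt]) hs, by omega⟩
  | false =>
    exact ⟨_, .ite_false hu (by simp [hca, enc, Data.toInt]) ht, by omega⟩

@[fun_prop]
theorem PolyTime.not {f : α → Bool} (hf : PolyTime f) : PolyTime (fun a => !f a) := by
  have : PolyTime (fun a => bif f a then false else true) := by fun_prop
  convert! this using 2 with a

@[fun_prop]
theorem PolyTime.and {f g : α → Bool} (hf : PolyTime f) (hg : PolyTime g) :
    PolyTime (fun a => f a && g a) := by
  have : PolyTime (fun a => bif f a then g a else false) := by fun_prop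
  convert! this using 2 with a
  cases f a <;> rfl

@[fun_prop]
theorem PolyTime.intBeq {f g : α → ℤ} (hf : PolyTime f) (hg : PolyTime g) :
    PolyTime (fun a => f a == g a) := by
  have : PolyTime (fun a => NilUnits.leb (f a) (g a) && NilUnits.leb (g a) (f a)) := by fun_prop
  convert! this using 2 with a
  by_cases h : f a = g a
  · simp [NilUnits.leb, h]
  · rw [beq_false_of_ne h]
    rcases lt_or_gt_of_ne h with h | h <;> simp [NilUnits.leb, h]

theorem PolyTime.natCast {f : α → ℕ} (hf : PolyTime f) : PolyTime (fun a => (f a : ℤ)) :=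
  hf.of_enc_eq fun _ => rfl

theorem PolyTime.of_natCast {f : α → ℕ} (hf : PolyTime (fun a => (f a : ℤ))) : PolyTime f :=
  hf.of_enc_eq fun _ => rfl

attribute [fun_prop] PolyTime.natCast

@[fun_prop]
theorem PolyTime.natAdd {f g : α → ℕ} (hf : PolyTime f) (hg : PolyTime g) :
    PolyTime (fun a => f a + g a) :=
  .of_natCast (by push_cast; fun_prop)

@[fun_prop]
theorem PolyTime.natMul {f g : α → ℕ} (hf : PolyTime f) (hg : PolyTime g) :
    PolyTime (fun a => f a * g a) :=
  .of_natCast (by push_cast; fun_prop)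

@[fun_prop]
theorem PolyTime.natDiv {f g : α → ℕ} (hf : PolyTime f) (hg : PolyTime g) :
    PolyTime (fun a => f a / g a) :=
  .of_natCast (by push_cast; fun_prop)

@[fun_prop]
theorem PolyTime.natMod {f g : α → ℕ} (hf : PolyTime f) (hg : PolyTime g) :
    PolyTime (fun a => f a % g a) :=
  .of_natCast (by push_cast; fun_prop)

@[fun_prop]
theorem PolyTime.natBeq {f g : α → ℕ} (hf : PolyTime f) (hg : PolyTime g) :
    PolyTime (fun a => f a == g a) := by
  have : PolyTime (fun a => (f a : ℤ) == (g a : ℤ)) := by fun_prop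
  convert! this using 2 with a
  rw [Bool.eq_iff_iff]
  simp

@[fun_prop]
theorem PolyTime.natAbs {f : α → ℤ} (hf : PolyTime f) : PolyTime (fun a => (f a).natAbs) := by
  have : PolyTime (fun a => bif NilUnits.leb 0 (f a) then f a else -f a) := by fun_prop
  refine .of_natCast ?_
  convert! this using 2 with a
  by_cases h : 0 ≤ f a <;> simp [NilUnits.leb, h]
  omega

@[fun_prop]
theorem PolyTime.toNat {f : α → ℤ} (hf : PolyTime f) : PolyTime (fun a => (f a).toNat) := by
  have : PolyTime (fun a => bif NilUnits.leb 0 (f a) then f a else 0) := by fun_prop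
  refine .of_natCast ?_
  convert! this using 2 with a
  by_cases h : 0 ≤ f a <;> simp [NilUnits.leb, h]
  omega

@[fun_prop]
theorem PolyTime.some {f : α → β} (hf : PolyTime f) : PolyTime (fun a => Option.some (f a)) := by
  have : PolyTime (fun a => ((1 : ℤ), f a)) := by fun_prop
  exact this.of_enc_eq fun _ => rfl

/-! ### Loops and lists -/

@[fun_prop]
theorem PolyTime.cons {f : α → β} {l : α → List β} (hf : PolyTime f) (hl : PolyTime l) :
    PolyTime (fun a => f a :: l a) := by
  have : PolyTime (fun a => (f a, l a)) := by fun_prop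
  exact this.of_enc_eq fun _ => rfl

/-- A while loop runs in polynomial time if the number of passes and the sizes of all intermediate
states are polynomially bounded. -/
theorem PolyTime.loop {c : σ → Bool} {f : σ → σ} {init : α → σ} (hc : PolyTime c) (hf : PolyTime f)
    (hi : PolyTime init) (k g : α → ℕ) (hk : PolyBdd k) (hg : PolyBdd g)
    (hsz : ∀ a, ∀ j ≤ k a, sz (f^[j] (init a)) ≤ g a)
    (htrue : ∀ a, ∀ j < k a, c (f^[j] (init a)) = true)
    (hfalse : ∀ a, c (f^[k a] (init a)) = false) :
    PolyTime (fun a => f^[k a] (init a)) := by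
  obtain ⟨r, C, hr⟩ := hc
  obtain ⟨p, B, hp⟩ := hf
  obtain ⟨q, D, hD, hq⟩ := hi.runs
  have h1 := hg.eval C
  have h2 := hg.eval B
  refine .of_runs (.seq q (.loop r p))
    (fun a => D a + (k a + 1) * (C.eval (g a) + B.eval (g a) + g a + 1) + 1) (by fun_prop)
    fun a => ?_
  have key : ∀ i ≤ k a, ∃ t,
      Runs (.loop r p) (enc (f^[k a - i] (init a))) (enc (f^[k a] (init a))) t ∧
      t ≤ (i + 1) * (C.eval (g a) + B.eval (g a) + g a + 1) := by
    intro i hi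
    induction i with
    | zero =>
      obtain ⟨u, hu, huC⟩ := hr (f^[k a] (init a))
      have hs := hsz a (k a) le_rfl
      have := huC.trans (eval_mono C hs)
      refine ⟨_, Runs.loop_stop hu (by simp [hfalse, enc, Data.toInt]), ?_⟩
      simp only [sz, Nat.sub_zero] at hs this ⊢
      omega
    | succ i ih =>
      obtain ⟨t, ht, htle⟩ := ih (by omega)
      obtain ⟨u, hu, huC⟩ := hr (f^[k a - (i + 1)] (init a))
      obtain ⟨v, hv, hvB⟩ := hp (f^[k a - (i + 1)] (init a))
      have hs := hsz a (k a - (i + 1)) (by omega)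
      have h1 := huC.trans (eval_mono C hs)
      have h2 := hvB.trans (eval_mono B hs)
      have e : f (f^[k a - (i + 1)] (init a)) = f^[k a - i] (init a) := by
        rw [← Function.iterate_succ_apply' f]
        congr 1
        omega
      rw [e] at hv
      refine ⟨_, .loop_step hu (by simp [htrue a _ (show k a - (i + 1) < k a by omega), enc,
        Data.toInt]) hv ht, ?_⟩
      rw [add_mul (i + 1) 1]
      omega
  obtain ⟨t, ht, hle⟩ := key (k a) le_rfl
  obtain ⟨s, hs, hsD⟩ := hq a
  rw [Nat.sub_self] at ht
  exact ⟨_, .seq hs ht, by omega⟩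

/-- Case distinction on a list. -/
theorem PolyTime.listCases {l : α → List τ} {h : α → β} {g : α → τ → List τ → β} (hl : PolyTime l)
    (hh : PolyTime h) (hg : PolyTime (fun p : α × τ × List τ => g p.1 p.2.1 p.2.2)) :
    PolyTime (fun a => match l a with
      | [] => h a
      | x :: xs => g a x xs) := by
  obtain ⟨q, C, hC, hq⟩ := hl.runs
  obtain ⟨p, B, hB, hp⟩ := hh.runs
  obtain ⟨r, D, hr⟩ := hg
  have hszl := hl.polyBdd_sz
  have hD : PolyBdd fun a => D.eval (sz a + sz (l a) + 1) :=
    PolyBdd.eval (g := fun a => sz a + sz (l a) + 1) (by fun_prop) D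
  refine .of_runs (.seq (.pair (.op .id) q)
    (.ite (.seq (.op .snd) (.op .isPair)) r (.seq (.op .fst) p)))
    (fun a => (2 * sz a + 1 + C a + 1) + ((sz a + sz (l a) + 1) + sz (l a) + 1 +
      (sz (l a) + 2 + 1) + 1 + (D.eval (sz a + sz (l a) + 1) +
        ((sz a + sz (l a) + 1) + sz a + 1 + B a + 1)) + 1) + 1) (by fun_prop) fun a => ?_
  obtain ⟨t, ht, htC⟩ := hq a
  obtain ⟨s, hs, hsB⟩ := hp a
  have h0 : Runs (.pair (.op .id) q) (enc a) (.pair (enc a) (enc (l a))) _ :=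
    .pair (.op .id (enc a)) ht
  have h1 : Runs (.seq (.op .snd) (.op .isPair)) (.pair (enc a) (enc (l a))) _ _ :=
    .seq (.op .snd _) (.op .isPair _)
  cases hla : l a with
  | nil =>
    have h2 : Runs (.seq (.op .fst) p) (.pair (enc a) (enc (l a))) (enc (h a)) _ :=
      .seq (.op .fst _) hs
    refine ⟨_, .seq h0 (.ite_false h1 (by simp [hla, enc, Op.eval, Data.snd, encList, Data.toInt])
      h2), ?_⟩
    have e : (Op.eval .isPair (enc ([] : List τ))).size = 1 := by
      simp [Op.eval, enc, encList, Data.size]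
    simp only [Op.eval, Data.fst, Data.snd, Data.size, hla] at e ⊢
    simp only [sz]
    omega
  | cons x xs =>
    obtain ⟨v, hv, hvD⟩ := hr (a, x, xs)
    change v ≤ D.eval (sz (a, x, xs)) at hvD
    have e1 : (.pair (enc a) (enc (l a)) : Data) = enc (a, x, xs) := by rw [hla]; rfl
    have e2 : sz (a, x, xs) = sz a + sz (x :: xs) + 1 := by simp only [sz_prod, sz_cons]
    refine ⟨_, .seq h0 (.ite_true h1 (by simp [hla, enc, Op.eval, Data.snd, encList, Data.toInt])
      (e1 ▸ hv)), ?_⟩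
    have e : (Op.eval .isPair (enc (x :: xs))).size = 2 := by
      simp [Op.eval, enc, encList, Data.size]
    rw [e2] at hvD
    simp only [Op.eval, Data.fst, Data.snd, Data.size, hla] at e ⊢
    simp only [sz] at hvD ⊢
    omega

/-- Left folds, if the sizes of all intermediate results are polynomially bounded. -/
theorem PolyTime.foldl {init : α → σ} {l : α → List τ} {step : α → σ → τ → σ} (hi : PolyTime init)
    (hl : PolyTime l) (hs : PolyTime (fun p : α × σ × τ => step p.1 p.2.1 p.2.2)) (g : α → ℕ)
    (hg : PolyBdd g)
    (hb : ∀ a, ∀ l', l' <+: l a → sz (l'.foldl (step a) (init a)) ≤ g a) :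
    PolyTime (fun a => (l a).foldl (step a) (init a)) := by
  let f : α × List τ × σ → α × List τ × σ := fun s =>
    match s.2.1 with
    | [] => s
    | x :: xs => (s.1, xs, step s.1 s.2.2 x)
  let c : α × List τ × σ → Bool := fun s =>
    match s.2.1 with
    | [] => false
    | _ :: _ => true
  have hf : PolyTime f := by
    have h2 : PolyTime (fun p : (α × List τ × σ) × τ × List τ =>
        (p.1.1, p.2.2, step p.1.1 p.1.2.2 p.2.1)) := by
      have : PolyTime (fun p : (α × List τ × σ) × τ × List τ =>
        step p.1.1 p.1.2.2 p.2.1) := hs.comp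
          (f := fun p : (α × List τ × σ) × τ × List τ => (p.1.1, p.1.2.2, p.2.1))
          (by fun_prop)
      fun_prop
    exact PolyTime.listCases (l := fun s : α × List τ × σ => s.2.1) (h := fun s => s)
      (g := fun s x xs => (s.1, xs, step s.1 s.2.2 x)) (by fun_prop) (by fun_prop) h2
  have hc : PolyTime c :=
    PolyTime.listCases (l := fun s : α × List τ × σ => s.2.1) (h := fun _ => false)
      (g := fun _ _ _ => true) (by fun_prop) (by fun_prop) (by fun_prop)
  have iter : ∀ a, ∀ j ≤ (l a).length, f^[j] (a, l a, init a) =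
      (a, (l a).drop j, ((l a).take j).foldl (step a) (init a)) := by
    intro a j hj
    induction j with
    | zero => simp
    | succ j ih =>
      rw [Function.iterate_succ_apply', ih (by omega)]
      have hd : (l a).drop j = (l a)[j] ::
          (l a).drop (j + 1) := List.drop_eq_getElem_cons (by omega)
      simp only [f, hd]
      rw [← List.take_concat_get' _ _ (by omega : j < (l a).length), List.foldl_append]
      rfl
  have len : ∀ m : List τ, m.length ≤ sz m := by
    intro m
    induction m with
    | nil => simp
    | cons x m ih => rw [sz_cons, List.length_cons]; omega
  have drp : ∀ (m : List τ) j, sz (m.drop j) ≤ sz m := by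
    intro m
    induction m with
    | nil => simp
    | cons x m ih =>
      intro j
      cases j with
      | zero => simp
      | succ j => rw [sz_cons, List.drop_succ_cons]; have := ih j; omega
  have := PolyTime.loop (init := fun a => (a, l a, init a)) hc hf (by fun_prop)
    (fun a => (l a).length) (fun a => sz a + (sz (l a) + g a + 1) + 1)
    (hl.polyBdd_sz.mono fun a => len _) (by have := hl.polyBdd_sz; fun_prop) ?_ ?_ ?_
  · have h2 : PolyTime (fun a => (f^[(l a).length] (a, l a, init a)).2.2) := by fun_prop
    convert! h2 using 2 with a
    rw [iter a _ le_rfl, List.take_length]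
  · intro a j hj
    rw [iter a j hj]
    simp only [sz_prod]
    have h1 := drp (l a) j
    have h2 := hb a _ (List.take_prefix j _)
    omega
  · intro a j hj
    rw [iter a j hj.le]
    simp only [c]
    rw [List.drop_eq_getElem_cons hj]
  · intro a
    rw [iter a _ le_rfl]
    simp [c]

theorem length_le_sz (m : List τ) : m.length ≤ sz m := by
  induction m with
  | nil => simp
  | cons x m ih => rw [sz_cons, List.length_cons]; omega

theorem sz_le_of_mem {m : List τ} {x : τ} (h : x ∈ m) : sz x ≤ sz m := by
  induction m with
  | nil => simp at h
  | cons y m ih =>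
    rw [sz_cons]
    rcases List.mem_cons.1 h with rfl | h
    · omega
    · have := ih h; omega

theorem sz_append (l m : List τ) : sz (l ++ m) + 1 = sz l + sz m := by
  induction l with
  | nil => rw [List.nil_append, sz_nil]; omega
  | cons x l ih => rw [List.cons_append, sz_cons, sz_cons]; omega

theorem sz_list_le {m : List τ} {b : ℕ} (h : ∀ x ∈ m, sz x ≤ b) :
    sz m ≤ m.length * (b + 1) + 1 := by
  induction m with
  | nil => simp [sz_nil]
  | cons x m ih =>
    rw [sz_cons, List.length_cons, add_mul]
    have h1 := h x (by simp)
    have h2 := ih fun y hy => h y (by simp [hy])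
    omega

/-- Left folds whose steps preserve an invariant, and increase the size of every state with the
invariant by a polynomially bounded amount at most. -/
theorem PolyTime.foldl_inv {init : α → σ} {l : α → List τ} {step : α → σ → τ → σ}
    (hi : PolyTime init) (hl : PolyTime l)
    (hs : PolyTime (fun p : α × σ × τ => step p.1 p.2.1 p.2.2)) (Inv : α → σ → Prop)
    (g : α → ℕ) (hg : PolyBdd g) (h0 : ∀ a, Inv a (init a))
    (h1 : ∀ a s, ∀ x ∈ l a, Inv a s → Inv a (step a s x))
    (hb : ∀ a s, ∀ x ∈ l a, Inv a s → sz (step a s x) ≤ sz s + g a) :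
    PolyTime (fun a => (l a).foldl (step a) (init a)) := by
  have hi' := hi.polyBdd_sz
  have hl' : PolyBdd (fun a => (l a).length) := hl.polyBdd_sz.mono fun a => length_le_sz _
  refine .foldl hi hl hs (fun a => sz (init a) + (l a).length * g a) (by fun_prop) fun a => ?_
  suffices h : ∀ l', l' <+: l a → Inv a (l'.foldl (step a) (init a)) ∧
      sz (l'.foldl (step a) (init a)) ≤ sz (init a) + l'.length * g a by
    intro l' hl'
    exact (h l' hl').2.trans (by gcongr; exact hl'.length_le)
  intro l' hl'
  induction l' using List.reverseRecOn with
  | nil => exact ⟨h0 a, by simp⟩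
  | append_singleton m x ih =>
    obtain ⟨i1, i2⟩ := ih ((List.prefix_append m [x]).trans hl')
    have hx : x ∈ l a := hl'.subset (by simp)
    rw [List.foldl_append, List.foldl_cons, List.foldl_nil, List.length_append, add_mul]
    have := hb a _ x hx i1
    refine ⟨h1 a _ x hx i1, ?_⟩
    simp only [List.length_singleton]
    omega

/-- Left folds whose steps increase the size by a polynomially bounded amount at most. -/
theorem PolyTime.foldl_add {init : α → σ} {l : α → List τ} {step : α → σ → τ → σ}
    (hi : PolyTime init) (hl : PolyTime l)
    (hs : PolyTime (fun p : α × σ × τ => step p.1 p.2.1 p.2.2))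
    (g : α → ℕ) (hg : PolyBdd g)
    (hb : ∀ a s, ∀ x ∈ l a, sz (step a s x) ≤ sz s + g a) :
    PolyTime (fun a => (l a).foldl (step a) (init a)) :=
  .foldl_inv hi hl hs (fun _ _ => True) g hg (fun _ => trivial) (fun _ _ _ _ _ => trivial)
    fun a s x hx _ => hb a s x hx

@[fun_prop]
theorem PolyTime.reverse {l : α → List β} (hl : PolyTime l) :
    PolyTime (fun a => (l a).reverse) := by
  have := PolyTime.foldl_add (init := fun _ => []) (step := fun (_ : α) s x => x :: s) (by fun_prop)
    hl (by fun_prop) (fun a => sz (l a) + 1) (by fun_prop)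
    (fun a s x hx => by have := sz_le_of_mem hx; rw [sz_cons]; omega)
  simpa using this

@[fun_prop]
theorem PolyTime.append {l m : α → List β} (hl : PolyTime l) (hm : PolyTime m) :
    PolyTime (fun a => l a ++ m a) := by
  have := PolyTime.foldl_add (l := fun a => (l a).reverse) (step := fun (_ : α) s x => x :: s) hm
    (by fun_prop) (by fun_prop) (fun a => sz (l a).reverse + 1) (by fun_prop)
    (fun a s x hx => by have := sz_le_of_mem hx; rw [sz_cons]; omega)
  simpa using this

@[fun_prop]
theorem PolyTime.map {l : α → List τ} {f : α → τ → β} (hl : PolyTime l)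
    (hf : PolyTime (fun p : α × τ => f p.1 p.2)) : PolyTime (fun a => (l a).map (f a)) := by
  obtain ⟨B, hB⟩ := hf.polyBdd_sz
  have hl' := hl.polyBdd_sz
  have hs : PolyTime (fun p : α × List β × τ => p.2.1 ++ [f p.1 p.2.2]) := by
    have : PolyTime (fun p : α × List β × τ => f p.1 p.2.2) :=
      hf.comp (f := fun p : α × List β × τ => (p.1, p.2.2)) (by fun_prop)
    fun_prop
  have := PolyTime.foldl_add (init := fun _ => []) (step := fun a s x => s ++ [f a x]) (by fun_prop)
    hl hs (fun a => B.eval (sz a + sz (l a) + 1) + 2)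
    (by have := PolyBdd.eval (g := fun a => sz a + sz (l a) + 1) (by fun_prop) B; fun_prop)
    (fun a s x hx => by
      have h1 := sz_le_of_mem hx
      have h2 : sz (f a x) ≤ B.eval (sz a + sz x + 1) := hB (a, x)
      have h3 : B.eval (sz a + sz x + 1) ≤ B.eval (sz a + sz (l a) + 1) := eval_mono B (by omega)
      have h4 := sz_append s [f a x]
      rw [sz_cons, sz_nil] at h4
      omega)
  convert! this using 2 with a
  suffices h : ∀ s, (l a).foldl (fun s x => s ++ [f a x]) s = s ++ (l a).map (f a) by
    simp [h]
  induction l a with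
  | nil => simp
  | cons x m ih => intro s; simp [ih]

@[fun_prop]
theorem PolyTime.flatten {l : α → List (List β)} (hl : PolyTime l) :
    PolyTime (fun a => (l a).flatten) := by
  have := PolyTime.foldl_add (init := fun _ => []) (step := fun (_ : α) (s : List β) x => s ++ x)
    (by fun_prop) hl (by fun_prop) (fun a => sz (l a)) (by fun_prop)
    (fun a s x hx => by have := sz_le_of_mem hx; have := sz_append s x; omega)
  convert! this using 2 with a
  suffices h : ∀ s, (l a).foldl (fun s x => s ++ x) s = s ++ (l a).flatten by
    simp [h]
  induction l a with
  | nil => simp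
  | cons x m ih => intro s; simp [ih]

@[fun_prop]
theorem PolyTime.sum {l : α → List ℤ} (hl : PolyTime l) : PolyTime (fun a => (l a).sum) := by
  have := PolyTime.foldl_add (init := fun _ => 0) (step := fun (_ : α) (s : ℤ) x => s + x)
    (by fun_prop) hl (by fun_prop) (fun a => sz (l a)) (by fun_prop)
    (fun a s x hx => by have := sz_le_of_mem hx; have := sz_add_le s x; omega)
  simpa only [List.sum_eq_foldl] using this

@[fun_prop]
theorem PolyTime.length {l : α → List β} (hl : PolyTime l) : PolyTime (fun a => (l a).length) := by
  have h : PolyTime (fun a => ((l a).map fun _ => (1 : ℤ)).sum) := by fun_prop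
  refine .of_natCast ?_
  simpa using h

@[fun_prop]
theorem PolyTime.getD {l : α → List β} {i : α → ℕ} {d : α → β} (hl : PolyTime l) (hi : PolyTime i)
    (hd : PolyTime d) : PolyTime (fun a => (l a).getD (i a) (d a)) := by
  have hl' := hl.polyBdd_sz
  have hd' := hd.polyBdd_sz
  have := PolyTime.foldl_inv (init := fun a => (0, d a))
    (step := fun a (s : ℕ × β) x => bif s.1 == i a then (s.1 + 1, x) else (s.1 + 1, s.2))
    (by fun_prop) hl ?_ (fun a s => sz s.2 ≤ sz (l a) + sz (d a))
    (fun a => sz (1 : ℤ) + sz (l a) + sz (d a)) (by fun_prop) (fun a => by simp) ?_ ?_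
  · have h2 := (PolyTime.snd).comp this
    convert! h2 using 2 with a
    suffices h : ∀ k e, ((l a).foldl (fun (s : ℕ × β) x =>
        bif s.1 == i a then (s.1 + 1, x) else (s.1 + 1, s.2)) (k, e)).2 =
          if k ≤ i a then (l a).getD (i a - k) e else e by
      rw [h]; simp
    induction l a with
    | nil => simp
    | cons x m ih =>
      intro k e
      rw [List.foldl_cons]
      rcases lt_trichotomy k (i a) with hk | hk | hk
      · have e1 : (k == i a) = false := by simpa using hk.ne
        have e2 : i a - k = (i a - (k + 1)) + 1 := by omega
        simp [e1, ih, hk.le, e2, hk]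
      · simp [hk, ih]
      · have e1 : (k == i a) = false := by simpa using hk.ne'
        simp [e1, ih, show ¬ k ≤ i a by omega, show ¬ k + 1 ≤ i a by omega]
  · have : PolyTime (fun p : α × (ℕ × β) × β => i p.1) := hi.comp (by fun_prop)
    fun_prop
  · intro a s x hx hs
    have := sz_le_of_mem hx
    cases s.1 == i a
    · exact hs
    · change sz x ≤ _; omega
  · intro a s x hx hs
    have h1 := sz_le_of_mem hx
    have h2 : sz (s.1 + 1) ≤ sz s.1 + sz (1 : ℤ) := sz_add_le s.1 1
    cases s.1 == i a
    · change sz (s.1 + 1) + sz s.2 + 1 ≤ sz s.1 + sz s.2 + 1 + _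
      omega
    · change sz (s.1 + 1) + sz x + 1 ≤ sz s.1 + sz s.2 + 1 + _
      omega

/-- The indices of the entries of a list. Lists of indices also serve as numbers in unary. -/
def indices (l : List β) : List ℕ := List.range l.length

@[fun_prop]
theorem PolyTime.indices {l : α → List β} (hl : PolyTime l) :
    PolyTime (fun a => indices (l a)) := by
  have hl' := hl.polyBdd_sz
  refine .of_enc_eq (g := fun a => (l a).foldl (fun (s : List ℕ) _ => s ++ [s.length]) []) ?_ ?_
  · refine .foldl (by fun_prop) hl (by fun_prop) (fun a => sz (l a) * (sz (l a) + 1 + 1) + 1)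
      (by fun_prop) fun a l' hl' => ?_
    have e : l'.foldl (fun (s : List ℕ) _ => s ++ [s.length]) [] = List.range l'.length := by
      clear hl'
      induction l' using List.reverseRecOn with
      | nil => simp
      | append_singleton m x ih => rw [List.foldl_append, ih]; simp [List.range_succ]
    rw [e]
    have h1 := hl'.length_le.trans (length_le_sz (l a))
    refine (sz_list_le (b := sz (l a) + 1) fun x hx => ?_).trans (by
      rw [List.length_range]; gcongr)
    have h2 := List.mem_range.1 hx
    have h3 := x.size_le.2 x.lt_two_pow_self
    rw [sz_nat]
    omega
  · intro a
    congr 1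
    unfold NilUnits.indices
    induction l a using List.reverseRecOn with
    | nil => simp
    | append_singleton m x ih =>
      rw [List.foldl_append, ← ih]
      simp [List.range_succ]

end

/-! ### Vectors, matrices and reduction modulo `N` -/

/-- Reduction modulo `N`; everything reduces to `0` if `N = 0`, so that the result is bounded. -/
def md (N : ℕ) (x : ℤ) : ℤ := bif N == 0 then 0 else x % N

@[fun_prop]
theorem polyTime_md : PolyTime (fun p : ℕ × ℤ => md p.1 p.2) := by
  unfold md; fun_prop

/-- The entry of a vector at a position, and `0` beyond the end. Vectors are lists whose entries are
read in this way, so no assumption on their lengths is needed. -/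
def gz (v : List ℤ) (i : ℕ) : ℤ := v.getD i 0

@[fun_prop]
theorem polyTime_gz : PolyTime (fun p : List ℤ × ℕ => gz p.1 p.2) := by
  unfold gz; fun_prop

/-- The row of a matrix at a position. -/
def gv (v : List (List ℤ)) (i : ℕ) : List ℤ := v.getD i []

@[fun_prop]
theorem polyTime_gv : PolyTime (fun p : List (List ℤ) × ℕ => gv p.1 p.2) := by
  unfold gv; fun_prop

/-- The entry of a list of matrices at a position. -/
def gm (v : List (List (List ℤ))) (i : ℕ) : List (List ℤ) := v.getD i []

@[fun_prop]
theorem polyTime_gm : PolyTime (fun p : List (List (List ℤ)) × ℕ => gm p.1 p.2) := by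
  unfold gm; fun_prop

/-- A list as long as the binary expansion of `N`. -/
def bits (N : ℕ) : List ℕ := List.replicate N.size 0

@[fun_prop]
theorem polyTime_bits {α : Type} [Encoding α] {f : α → ℕ} (hf : PolyTime f) :
    PolyTime (fun a => bits (f a)) := by
  have hf' := hf.polyBdd_sz
  have iter : ∀ n j : ℕ, (fun s : ℕ × List ℕ => (s.1 / 2, 0 :: s.2))^[j] (n, []) =
      (n / 2 ^ j, List.replicate j 0) := by
    intro n j
    induction j with
    | zero => simp
    | succ j ih => rw [Function.iterate_succ_apply', ih, Nat.div_div_eq_div_mul, pow_succ]; rfl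
  have rep : ∀ j : ℕ, sz (List.replicate j 0) = 2 * j + 1 := by
    intro j
    induction j with
    | zero => rfl
    | succ j ih =>
      rw [List.replicate_succ, sz_cons, ih, show sz 0 = 1 from rfl]
      omega
  have := PolyTime.loop (c := fun s : ℕ × List ℕ => !(s.1 == 0))
    (f := fun s => (s.1 / 2, 0 :: s.2)) (init := fun a => (f a, [])) (by fun_prop)
    (by fun_prop) (by fun_prop) (fun a => (f a).size) (fun a => sz (f a) + 2 * sz (f a) + 1)
    (hf'.mono fun a => by rw [sz_nat]; omega) (by fun_prop) ?_ ?_ ?_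
  · have h2 := PolyTime.snd.comp this
    convert! h2 using 2 with a
    rw [iter]; rfl
  · intro a j hj
    rw [iter, sz_prod, rep, sz_nat, sz_nat]
    have := natSize_le_size_of_le (Nat.div_le_self (f a) (2 ^ j))
    dsimp only
    omega
  · intro a j hj
    rw [iter]
    have := Nat.lt_size.1 hj
    have := Nat.div_pos this (by positivity)
    simp; omega
  · intro a
    rw [iter, Nat.div_eq_of_lt (Nat.lt_size_self _)]
    rfl

/-- The vector with the entries of a list. -/
def tv (n : ℕ) (l : List ℤ) : Fin n → ℤ := fun i => gz l i

theorem tv_apply (n : ℕ) (l : List ℤ) (i : Fin n) : tv n l i = gz l i := rfl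

theorem gz_map_range {n i : ℕ} (h : i < n) (f : ℕ → ℤ) : gz ((List.range n).map f) i = f i := by
  simp [gz, List.getD, h]

theorem gz_map_range_of_le {n i : ℕ} (h : n ≤ i) (f : ℕ → ℤ) :
    gz ((List.range n).map f) i = 0 := by
  simp [gz, List.getD, h]

theorem gv_map_range {n i : ℕ} (h : i < n) (f : ℕ → List ℤ) :
    gv ((List.range n).map f) i = f i := by
  simp [gv, List.getD, h]

theorem gm_map_range {n i : ℕ} (h : i < n) (f : ℕ → List (List ℤ)) :
    gm ((List.range n).map f) i = f i := by
  simp [gm, List.getD, h]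

theorem tv_map_range (n : ℕ) (f : ℕ → ℤ) : tv n ((List.range n).map f) = fun i : Fin n => f i :=
  funext fun i => gz_map_range i.2 f

theorem md_eq {N : ℕ} (hN : 0 < N) (x : ℤ) : md N x = x % N := by
  have : (N == 0) = false := by simpa using hN.ne'
  simp [md, this]

theorem md_nonneg (N : ℕ) (x : ℤ) : 0 ≤ md N x := by
  rcases Nat.eq_zero_or_pos N with rfl | h
  · simp [md]
  · rw [md_eq h]; exact Int.emod_nonneg _ (by omega)

theorem md_le (N : ℕ) (x : ℤ) : md N x ≤ N := by
  rcases Nat.eq_zero_or_pos N with rfl | h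
  · simp [md]
  · rw [md_eq h]; exact (Int.emod_lt_of_pos _ (by omega)).le

theorem md_lt {N : ℕ} (hN : 0 < N) (x : ℤ) : md N x < N := by
  rw [md_eq hN]; exact Int.emod_lt_of_pos _ (by omega)

theorem md_of_lt {N : ℕ} {x : ℤ} (h0 : 0 ≤ x) (h : x < N) : md N x = x := by
  rw [md_eq (by omega), Int.emod_eq_of_lt h0 h]

theorem md_zero (N : ℕ) : md N 0 = 0 := by
  simp [md]

theorem dvd_sub_md {N : ℕ} (hN : 0 < N) (x : ℤ) : (N : ℤ) ∣ x - md N x := by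
  rw [md_eq hN]; exact Int.dvd_self_sub_emod

/-- A vector indexed by `ix` with entries bounded by `N`. -/
def Bd (N : ℕ) (ix : List ℕ) (v : List ℤ) : Prop :=
  v.length = ix.length ∧ ∀ x ∈ v, 0 ≤ x ∧ x ≤ N

/-- A bound for the size of the vectors indexed by `ix` with entries bounded by `N`. -/
def bdSize (N : ℕ) (ix : List ℕ) : ℕ := ix.length * (N.size + 2) + 1

theorem Bd.sz_le {N : ℕ} {ix : List ℕ} {v : List ℤ} (h : Bd N ix v) : sz v ≤ bdSize N ix := by
  rw [bdSize, ← h.1]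
  refine sz_list_le (b := N.size + 1) fun x hx => ?_
  rw [sz_int]
  have h1 := natSize_le_size_of_le (show x.natAbs ≤ N by have := h.2 x hx; omega)
  omega

theorem bd_map_md (N : ℕ) (ix : List ℕ) (f : ℕ → ℤ) : Bd N ix (ix.map fun i => md N (f i)) := by
  refine ⟨by simp, fun x hx => ?_⟩
  obtain ⟨i, -, rfl⟩ := List.mem_map.1 hx
  exact ⟨md_nonneg _ _, md_le _ _⟩

@[fun_prop]
theorem polyBdd_bdSize {α : Type} [Encoding α] {N : α → ℕ} {ix : α → List ℕ} (hN : PolyTime N)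
    (hix : PolyTime ix) : PolyBdd (fun a => bdSize (N a) (ix a)) := by
  have h1 := hN.polyBdd_sz
  have h2 := hix.polyBdd_sz
  refine PolyBdd.mono (g := fun a => sz (ix a) * (sz (N a) + 2) + 1) (by fun_prop) fun a => ?_
  have h3 := length_le_sz (ix a)
  have h4 : (N a).size ≤ sz (N a) := by rw [sz_nat]; omega
  unfold bdSize
  gcongr

/-! ### Triangular bases of lattices modulo `N` -/

/-- One step of the Euclidean algorithm on the entries at `i` of two vectors, carried out on the
whole vectors modulo `N`. -/
def euclidStep (N : ℕ) (ix : List ℕ) (i : ℕ) (s : List ℤ × List ℤ) : List ℤ × List ℤ :=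
  bif gz s.2 i == 0 then s
  else (s.2, ix.map fun j => md N (gz s.1 j - gz s.1 i / gz s.2 i * gz s.2 j))

/-- The Euclidean algorithm on the entries at `i` of two vectors. After the first step the product
of the entries is less than `2 ^ (2 * N.size)`, and every further step halves it, which gives the
number of steps. -/
def euclid (N : ℕ) (ix : List ℕ) (i : ℕ) (s : List ℤ × List ℤ) : List ℤ × List ℤ :=
  (0 :: (bits N ++ bits N)).foldl (fun s _ => euclidStep N ix i s) s

/-- The vector reduced modulo `N`. -/
def reduceVec (N : ℕ) (ix : List ℕ) (w : List ℤ) : List ℤ := ix.map fun j => md N (gz w j)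

@[fun_prop]
theorem polyTime_reduceVec :
    PolyTime (fun p : ℕ × List ℕ × List ℤ => reduceVec p.1 p.2.1 p.2.2) := by
  unfold reduceVec; fun_prop

/-- Row operations that leave only one row with a nonzero entry at `i`, the first component of the
result. The vector `N • e i` is added to the rows. -/
def clearColumn (N : ℕ) (ix : List ℕ) (i : ℕ) (W : List (List ℤ)) : List ℤ × List (List ℤ) :=
  W.foldl (fun s w =>
    ((euclid N ix i (s.1, reduceVec N ix w)).1, s.2 ++ [(euclid N ix i (s.1, reduceVec N ix w)).2]))
    (ix.map fun j => bif j == i then (N : ℤ) else 0, [])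

/-- The triangular basis of the lattice generated by `W` and the multiples of `N`, found by clearing
one column after the other. -/
def tri (N : ℕ) (ix : List ℕ) (W : List (List ℤ)) : List (List ℤ) :=
  (ix.foldl (fun s i => (s.1 ++ [(clearColumn N ix i s.2).1], (clearColumn N ix i s.2).2))
    (([] : List (List ℤ)), W)).1

theorem euclidStep_bd {N : ℕ} {ix : List ℕ} {i : ℕ} {s : List ℤ × List ℤ} (h1 : Bd N ix s.1)
    (h2 : Bd N ix s.2) : Bd N ix (euclidStep N ix i s).1 ∧ Bd N ix (euclidStep N ix i s).2 := by
  unfold euclidStep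
  cases gz s.2 i == 0
  · exact ⟨h2, bd_map_md _ _ _⟩
  · exact ⟨h1, h2⟩

theorem euclid_bd {N : ℕ} {ix : List ℕ} {i : ℕ} {s : List ℤ × List ℤ} (h1 : Bd N ix s.1)
    (h2 : Bd N ix s.2) : Bd N ix (euclid N ix i s).1 ∧ Bd N ix (euclid N ix i s).2 := by
  unfold euclid
  induction 0 :: (bits N ++ bits N) generalizing s with
  | nil => exact ⟨h1, h2⟩
  | cons x l ih => exact ih (euclidStep_bd h1 h2).1 (euclidStep_bd h1 h2).2

theorem bd_reduceVec (N : ℕ) (ix : List ℕ) (w : List ℤ) : Bd N ix (reduceVec N ix w) :=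
  bd_map_md N ix _

theorem clearColumn_bd (N : ℕ) (ix : List ℕ) (i : ℕ) (W : List (List ℤ)) :
    Bd N ix (clearColumn N ix i W).1 ∧ (clearColumn N ix i W).2.length = W.length ∧
      ∀ w ∈ (clearColumn N ix i W).2, Bd N ix w := by
  unfold clearColumn
  induction W using List.reverseRecOn with
  | nil =>
    refine ⟨⟨by simp, fun x hx => ?_⟩, rfl, by simp⟩
    obtain ⟨j, -, rfl⟩ := List.mem_map.1 hx
    cases j == i <;> simp
  | append_singleton W w ih =>
    obtain ⟨h1, h2, h3⟩ := ih
    rw [List.foldl_append, List.foldl_cons, List.foldl_nil]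
    have h4 := euclid_bd (i := i) (s := (_, reduceVec N ix w)) h1 (bd_reduceVec N ix w)
    refine ⟨h4.1, by simp [h2], fun v hv => ?_⟩
    rcases List.mem_append.1 hv with hv | hv
    · exact h3 v hv
    · rw [List.mem_singleton.1 hv]
      exact h4.2

@[fun_prop]
theorem polyTime_euclid : PolyTime (fun p : ℕ × List ℕ × ℕ × List ℤ × List ℤ =>
    euclid p.1 p.2.1 p.2.2.1 p.2.2.2) := by
  unfold euclid
  refine .foldl_add (by fun_prop) (by fun_prop) (by unfold euclidStep; fun_prop)
    (fun p => bdSize p.1 p.2.1) (by fun_prop) fun p s x _ => ?_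
  unfold euclidStep
  cases gz s.2 p.2.2.1 == 0
  · have := (bd_map_md p.1 p.2.1
      fun j => gz s.1 j - gz s.1 p.2.2.1 / gz s.2 p.2.2.1 * gz s.2 j).sz_le
    simp only [cond_false, sz_prod]
    omega
  · simp

@[fun_prop]
theorem polyTime_clearColumn : PolyTime (fun p : ℕ × List ℕ × ℕ × List (List ℤ) =>
    clearColumn p.1 p.2.1 p.2.2.1 p.2.2.2) := by
  unfold clearColumn
  refine .foldl_inv (by fun_prop) (by fun_prop) (by fun_prop) (fun p s => Bd p.1 p.2.1 s.1)
    (fun p => 2 * bdSize p.1 p.2.1 + 1) (by fun_prop)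
    (fun p => (clearColumn_bd p.1 p.2.1 p.2.2.1 []).1)
    (fun p s w _ h => (euclid_bd (s := (_, _)) h (bd_reduceVec p.1 p.2.1 w)).1)
    fun p s w _ h => ?_
  have h1 := euclid_bd (i := p.2.2.1)
      (s := (s.1, reduceVec p.1 p.2.1 w)) h (bd_reduceVec p.1 p.2.1 w)
  have h2 := h1.1.sz_le
  have h3 := h1.2.sz_le
  have h4 := sz_append s.2 [(euclid p.1 p.2.1 p.2.2.1
    (s.1, reduceVec p.1 p.2.1 w)).2]
  rw [sz_cons, sz_nil] at h4
  simp only [sz_prod] at h2 h3 h4 ⊢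
  omega

/-- The size of a triangular basis does not depend on the size of the generators. -/
theorem sz_tri_le (N : ℕ) (ix : List ℕ) (W : List (List ℤ)) :
    sz (tri N ix W) ≤ ix.length * (bdSize N ix + 1) + 1 := by
  have : ∀ (l : List ℕ) (s : List (List ℤ) × List (List ℤ)), (∀ v ∈ s.1, Bd N ix v) →
      (∀ v ∈ (l.foldl (fun s i => (s.1 ++ [(clearColumn N ix i s.2).1], (clearColumn N ix i s.2).2))
        s).1, Bd N ix v) ∧ (l.foldl (fun s i => (s.1 ++ [(clearColumn N ix i s.2).1],
          (clearColumn N ix i s.2).2)) s).1.length = s.1.length + l.length := by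
    intro l
    induction l with
    | nil => intro s hs; exact ⟨hs, rfl⟩
    | cons i l ih =>
      intro s hs
      rw [List.foldl_cons]
      refine (ih (s.1 ++ [(clearColumn N ix i s.2).1], (clearColumn N ix i s.2).2) ?_).imp
        id fun h => by rw [h]; simp; omega
      intro v hv
      rcases List.mem_append.1 hv with hv | hv
      · exact hs v hv
      · rw [List.mem_singleton.1 hv]
        exact (clearColumn_bd N ix i s.2).1
  obtain ⟨h1, h2⟩ := this ix ([], W) (by simp)
  refine (sz_list_le fun v hv => (h1 v hv).sz_le).trans ?_
  rw [h2]
  simp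

@[fun_prop]
theorem polyTime_tri : PolyTime (fun p : ℕ × List ℕ × List (List ℤ) => tri p.1 p.2.1 p.2.2) := by
  unfold tri
  refine PolyTime.fst.comp (.foldl_inv (by fun_prop) (by fun_prop) (by fun_prop)
    (fun p s => s.2.length = p.2.2.length)
    (fun p => (sz p.2.2 * (bdSize p.1 p.2.1 + 1) + 1) + bdSize p.1 p.2.1 + 1)
    (by fun_prop) (fun p => rfl) (fun p s i _ h => ?_) fun p s i _ h => ?_)
  · exact (clearColumn_bd p.1 p.2.1 i s.2).2.1.trans h
  · have h1 := clearColumn_bd p.1 p.2.1 i s.2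
    have h2 := h1.1.sz_le
    have h3 : sz (clearColumn p.1 p.2.1 i s.2).2 ≤
        sz p.2.2 * (bdSize p.1 p.2.1 + 1) + 1 := by
      refine (sz_list_le fun v hv => (h1.2.2 v hv).sz_le).trans ?_
      rw [h1.2.1, h]
      gcongr
      exact length_le_sz _
    have h4 := sz_append s.1 [(clearColumn p.1 p.2.1 i s.2).1]
    rw [sz_cons, sz_nil] at h4
    simp only [sz_prod]
    omega

/-- A vector may be changed modulo `N` at the positions `j` for which the lattice contains `N • e
j`. -/
theorem mem_iff_of_congr {n N : ℕ} {H : AddSubgroup (Fin n → ℤ)} {x y : Fin n → ℤ}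
    (h : ∀ j, x j = y j ∨ (N : ℤ) ∣ x j - y j ∧ Pi.single j (N : ℤ) ∈ H) : x ∈ H ↔ y ∈ H := by
  have key : x - y ∈ H := by
    have e : x - y = ∑ j, Pi.single j (x j - y j) := by
      rw [Finset.univ_sum_single fun j => x j - y j]
      rfl
    rw [e]
    refine H.sum_mem fun j _ => ?_
    rcases h j with h | ⟨⟨c, hc⟩, h⟩
    · rw [h, sub_self, Pi.single_zero]
      exact H.zero_mem
    · have : Pi.single j (x j - y j) = c • Pi.single (M := fun _ => ℤ) j (N : ℤ) := by
        rw [hc, ← Pi.single_smul]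
        simp [mul_comm]
      rw [this]
      exact H.zsmul_mem h c
  constructor
  · intro hx
    have := H.sub_mem hx key
    simpa using this
  · intro hy
    have := H.add_mem key hy
    simpa using this

/-- The entries of the vector lie between `0` and `N`, and those before position `i` are `0`. -/
structure Good (N i : ℕ) (v : List ℤ) : Prop where
  zero : ∀ j < i, gz v j = 0
  nonneg : ∀ j, 0 ≤ gz v j
  le : ∀ j, gz v j ≤ N

theorem good_map_md {N n i : ℕ} {f : ℕ → ℤ} (h : ∀ j < i, f j = 0) :
    Good N i ((List.range n).map fun j => md N (f j)) := by
  refine ⟨fun j hj => ?_, fun j => ?_, fun j => ?_⟩ <;> rcases lt_or_ge j n with hjn | hjn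
  · rw [gz_map_range hjn, h j hj, md_zero]
  · rw [gz_map_range_of_le hjn]
  · rw [gz_map_range hjn]; exact md_nonneg _ _
  · rw [gz_map_range_of_le hjn]
  · rw [gz_map_range hjn]; exact md_le _ _
  · rw [gz_map_range_of_le hjn]; positivity

section

variable {N n i : ℕ} (hN : 0 < N) (hi : i < n)

include hN hi in
theorem euclidStep_spec {s : List ℤ × List ℤ} (h1 : Good N i s.1) (h2 : Good N i s.2)
    (hp : 0 < gz s.1 i) (hlt : gz s.2 i < N) :
    let r := euclidStep N (List.range n) i s
    Good N i r.1 ∧ Good N i r.2 ∧ 0 < gz r.1 i ∧ gz r.2 i < N ∧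
    ((gz s.2 i = 0 ∧ r = s) ∨ (gz r.1 i = gz s.2 i ∧ gz r.2 i = gz s.1 i % gz s.2 i)) ∧
    ∀ H : AddSubgroup (Fin n → ℤ), (∀ j : Fin n, i < j → Pi.single j (N : ℤ) ∈ H) →
      ((tv n r.1 ∈ H ∧ tv n r.2 ∈ H) ↔ (tv n s.1 ∈ H ∧ tv n s.2 ∈ H)) := by
  intro r
  by_cases h0 : gz s.2 i = 0
  · have e : r = s := by simp [r, euclidStep, h0]
    rw [e]
    exact ⟨h1, h2, hp, hlt, .inl ⟨h0, rfl⟩, fun H _ => Iff.rfl⟩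
  have e : r = (s.2, (List.range n).map
      fun j => md N (gz s.1 j - gz s.1 i / gz s.2 i * gz s.2 j)) := by
    simp [r, euclidStep, beq_false_of_ne h0]
  rw [e]
  have hpos : 0 < gz s.2 i := lt_of_le_of_ne (h2.nonneg i) (Ne.symm h0)
  have hmod : gz s.1 i - gz s.1 i / gz s.2 i * gz s.2 i = gz s.1 i % gz s.2 i := by
    rw [Int.emod_def, mul_comm]
  have hm0 := Int.emod_nonneg (gz s.1 i) h0
  have hm1 := Int.emod_lt_of_pos (gz s.1 i) hpos
  have hmd : md N (gz s.1 i % gz s.2 i) = gz s.1 i % gz s.2 i := md_of_lt hm0 (by omega)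
  refine ⟨h2, good_map_md fun j hj => by rw [h1.zero j hj, h2.zero j hj]; simp, hpos, ?_,
    .inr ⟨rfl, ?_⟩, fun H hH => ?_⟩
  · rw [gz_map_range hi, hmod, hmd]; omega
  · rw [gz_map_range hi, hmod, hmd]
  · have : tv n ((List.range n).map fun j => md N (gz s.1 j - gz s.1 i / gz s.2 i * gz s.2 j)) ∈ H ↔
        tv n s.1 - (gz s.1 i / gz s.2 i) • tv n s.2 ∈ H := by
      refine mem_iff_of_congr (N := N) fun j => ?_
      rw [tv_map_range]
      simp only [Pi.sub_apply, Pi.smul_apply, smul_eq_mul, tv_apply]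
      rcases lt_trichotomy (j : ℕ) i with hj | hj | hj
      · left; rw [h1.zero j hj, h2.zero j hj]; simp [md_zero]
      · left; rw [hj, hmod, hmd]
      · right
        refine ⟨?_, hH j hj⟩
        rw [dvd_sub_comm]
        exact dvd_sub_md hN _
    dsimp only
    rw [this]
    constructor
    · rintro ⟨ha, hb⟩
      have := H.add_mem hb (H.zsmul_mem ha (gz s.1 i / gz s.2 i))
      exact ⟨by simpa using this, ha⟩
    · rintro ⟨ha, hb⟩
      exact ⟨hb, H.sub_mem ha (H.zsmul_mem hb _)⟩

include hN hi in
theorem euclid_spec {s : List ℤ × List ℤ} (h1 : Good N i s.1) (h2 : Good N i s.2)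
    (hp : 0 < gz s.1 i) (hlt : gz s.2 i < N) :
    let r := euclid N (List.range n) i s
    Good N i r.1 ∧ Good N (i + 1) r.2 ∧ 0 < gz r.1 i ∧
    ∀ H : AddSubgroup (Fin n → ℤ), (∀ j : Fin n, i < j → Pi.single j (N : ℤ) ∈ H) →
      ((tv n r.1 ∈ H ∧ tv n r.2 ∈ H) ↔ (tv n s.1 ∈ H ∧ tv n s.2 ∈ H)) := by
  -- Every step halves the product of the two entries, if the second is at most the first.
  have iter : ∀ (l : List ℕ) (s : List ℤ × List ℤ), Good N i s.1 → Good N i s.2 →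
      0 < gz s.1 i → gz s.2 i < N →
      let r := l.foldl (fun s _ => euclidStep N (List.range n) i s) s
      Good N i r.1 ∧ Good N i r.2 ∧ 0 < gz r.1 i ∧
      (∀ H : AddSubgroup (Fin n → ℤ), (∀ j : Fin n, i < j → Pi.single j (N : ℤ) ∈ H) →
        ((tv n r.1 ∈ H ∧ tv n r.2 ∈ H) ↔ (tv n s.1 ∈ H ∧ tv n s.2 ∈ H))) ∧
      (gz s.2 i ≤ gz s.1 i → gz s.1 i * gz s.2 i < 2 ^ l.length → gz r.2 i = 0) := by
    intro l
    induction l with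
    | nil =>
      intro s h1 h2 hp hlt
      refine ⟨h1, h2, hp, fun H _ => Iff.rfl, fun _ h => ?_⟩
      have := h2.nonneg i
      simp only [List.length_nil, pow_zero] at h
      simp only [List.foldl_nil]
      nlinarith
    | cons x l ih =>
      intro s h1 h2 hp hlt
      obtain ⟨a1, a2, a3, a4, a5, a6⟩ := euclidStep_spec hN hi h1 h2 hp hlt
      obtain ⟨b1, b2, b3, b4, b5⟩ := ih _ a1 a2 a3 a4
      refine ⟨b1, b2, b3, fun H hH => (b4 H hH).trans (a6 H hH), fun hle h => b5 ?_ ?_⟩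
      · rcases a5 with ⟨-, a⟩ | ⟨a, a'⟩
        · rw [a]; exact hle
        · rw [a, a']
          exact (Int.emod_lt_of_pos _ (a ▸ a3)).le
      · rcases a5 with ⟨a, a'⟩ | ⟨a, a'⟩
        · rw [a', a]; simp
        · rw [a, a']
          rw [a] at a3
          have e1 := Int.mul_ediv_add_emod (gz s.1 i) (gz s.2 i)
          have e2 : 1 ≤ gz s.1 i / gz s.2 i := (Int.le_ediv_iff_mul_le a3).2 (by linarith)
          have e3 := Int.emod_lt_of_pos (gz s.1 i) a3
          have e4 : 2 * (gz s.1 i % gz s.2 i) ≤ gz s.1 i := by nlinarith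
          rw [List.length_cons, pow_succ] at h
          nlinarith
  intro r
  have hr : r = (bits N ++ bits N).foldl (fun s _ => euclidStep N (List.range n) i s)
    (euclidStep N (List.range n) i s) := rfl
  obtain ⟨a1, a2, a3, a4, a5, a6⟩ := euclidStep_spec hN hi h1 h2 hp hlt
  obtain ⟨b1, b2, b3, b4, b5⟩ := iter (bits N ++ bits N) _ a1 a2 a3 a4
  rw [← hr] at b1 b2 b3 b4 b5
  refine ⟨b1, ⟨fun j hj => ?_, b2.nonneg, b2.le⟩, b3, fun H hH => (b4 H hH).trans (a6 H hH)⟩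
  rcases Nat.lt_succ_iff_lt_or_eq.1 hj with hj | rfl
  · exact b2.zero j hj
  · refine b5 ?_ ?_
    · rcases a5 with ⟨a, a'⟩ | ⟨a, a'⟩
      · rw [a', a]; exact hp.le
      · rw [a, a']
        exact (Int.emod_lt_of_pos _ (a ▸ a3)).le
    · have e1 : (N : ℤ) < 2 ^ N.size := by exact_mod_cast Nat.lt_size_self N
      have e2 := a1.le j
      have e3 := a2.nonneg j
      simp only [bits, List.length_append, List.length_replicate, pow_add]
      calc _ ≤ (N : ℤ) * N := by gcongr
        _ < _ := by gcongr

include hN hi in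
theorem clearColumn_spec {W : List (List ℤ)} (hW : ∀ w ∈ W, ∀ j < i, gz w j = 0) :
    let r := clearColumn N (List.range n) i W
    Good N i r.1 ∧ 0 < gz r.1 i ∧ (∀ w ∈ r.2, ∀ j < i + 1, gz w j = 0) ∧
    ∀ H : AddSubgroup (Fin n → ℤ), (∀ j : Fin n, i < j → Pi.single j (N : ℤ) ∈ H) →
      ((tv n r.1 ∈ H ∧ ∀ w ∈ r.2, tv n w ∈ H) ↔
        (Pi.single ⟨i, hi⟩ (N : ℤ) ∈ H ∧ ∀ w ∈ W, tv n w ∈ H)) := by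
  unfold clearColumn
  induction W using List.reverseRecOn with
  | nil =>
    have e : ∀ j, gz ((List.range n).map fun j => bif j == i then (N : ℤ) else 0) j =
        if j = i then (N : ℤ) else 0 := by
      intro j
      rcases lt_or_ge j n with hj | hj
      · rw [gz_map_range hj, cond_eq_ite]; simp
      · rw [gz_map_range_of_le hj, if_neg (by omega)]
    refine ⟨⟨fun j hj => ?_, fun j => ?_, fun j => ?_⟩, ?_, by simp, fun H hH => ?_⟩
    · rw [List.foldl_nil, e, if_neg hj.ne]
    · rw [List.foldl_nil, e]; split_ifs <;> omega
    · rw [List.foldl_nil, e]; split_ifs <;> omega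
    · rw [List.foldl_nil, e, if_pos rfl]; omega
    · have : tv n ((List.range n).map fun j => bif j == i then (N : ℤ) else 0) =
          Pi.single ⟨i, hi⟩ (N : ℤ) := by
        ext j
        rw [tv_apply, e, Pi.single_apply]
        simp [Fin.ext_iff]
      simp [this]
  | append_singleton W w ih =>
    obtain ⟨a1, a2, a3, a4⟩ := ih fun v hv => hW v (by simp [hv])
    rw [List.foldl_append, List.foldl_cons, List.foldl_nil]
    set s := W.foldl _ _ with hs
    clear_value s
    have hw := hW w (by simp)
    set v := reduceVec N (List.range n) w with hv
    have hvg : Good N i v := good_map_md hw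
    have hvi : gz v i = md N (gz w i) := gz_map_range hi _
    obtain ⟨b1, b2, b3, b4⟩ := euclid_spec hN hi (s := (s.1, v)) a1 hvg a2
      (by rw [hvi]; exact md_lt hN _)
    refine ⟨b1, b3, fun u hu => ?_, fun H hH => ?_⟩
    · rcases List.mem_append.1 hu with hu | hu
      · exact a3 u hu
      · rw [List.mem_singleton.1 hu]; exact b2.zero
    · have c1 := b4 H hH
      have c2 := a4 H hH
      have c3 : Pi.single ⟨i, hi⟩ (N : ℤ) ∈ H → (tv n v ∈ H ↔ tv n w ∈ H) := by
        intro hNi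
        refine mem_iff_of_congr (N := N) fun j => ?_
        have e : tv n v j = md N (gz w j) := by rw [hv, reduceVec, tv_map_range]
        rw [e]
        rcases lt_trichotomy (j : ℕ) i with hj | hj | hj
        · left; rw [tv_apply, hw j hj, md_zero]
        · right
          have : j = ⟨i, hi⟩ := Fin.ext hj
          subst this
          exact ⟨by rw [dvd_sub_comm]; exact dvd_sub_md hN _, hNi⟩
        · exact .inr ⟨by rw [dvd_sub_comm]; exact dvd_sub_md hN _, hH j hj⟩
      simp only [List.mem_append, List.mem_singleton, or_imp, forall_and, forall_eq]
      constructor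
      · rintro ⟨d1, d2, d3⟩
        obtain ⟨d4, d5⟩ := c1.1 ⟨d1, d3⟩
        obtain ⟨d6, d7⟩ := c2.1 ⟨d4, d2⟩
        exact ⟨d6, d7, (c3 d6).1 d5⟩
      · rintro ⟨d1, d2, d3⟩
        obtain ⟨d4, d5⟩ := c2.2 ⟨d1, d2⟩
        obtain ⟨d6, d7⟩ := c1.2 ⟨d4, (c3 d1).2 d3⟩
        exact ⟨d6, d5, d7⟩

end

/-- The rows form an upper triangular matrix with positive diagonal, and their entries lie between
`0` and `N`. -/
structure IsTri (N n : ℕ) (T : List (List ℤ)) : Prop where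
  good : ∀ i < n, Good N i (gv T i)
  pos : ∀ i < n, 0 < gz (gv T i) i
  length : T.length = n

theorem gv_append_left {A B : List (List ℤ)} {i : ℕ} (h : i < A.length) :
    gv (A ++ B) i = gv A i := by
  simp [gv, List.getD, List.getElem?_append_left h]

theorem gv_append_length (A : List (List ℤ)) (x : List ℤ) : gv (A ++ [x]) A.length = x := by
  simp [gv, List.getD]

/-- A lattice contains the rows of the triangular matrix if and only if it contains the given
vectors and the multiples of `N`; in other words, both generate the same lattice. -/
theorem tri_spec {N n : ℕ} (hN : 0 < N) (W : List (List ℤ)) :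
    IsTri N n (tri N (List.range n) W) ∧ ∀ H : AddSubgroup (Fin n → ℤ),
      (∀ i < n, tv n (gv (tri N (List.range n) W) i) ∈ H) ↔
        (∀ w ∈ W, tv n w ∈ H) ∧ ∀ j : Fin n, Pi.single j (N : ℤ) ∈ H := by
  unfold tri
  have key : ∀ k ≤ n,
      let s := (List.range k).foldl (fun s i => (s.1 ++ [(clearColumn N (List.range n) i s.2).1],
        (clearColumn N (List.range n) i s.2).2)) (([] : List (List ℤ)), W)
      s.1.length = k ∧ (∀ i < k, Good N i (gv s.1 i) ∧ 0 < gz (gv s.1 i) i) ∧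
      (∀ w ∈ s.2, ∀ j < k, gz w j = 0) ∧ ∀ H : AddSubgroup (Fin n → ℤ),
      ((∀ i < k, tv n (gv s.1 i) ∈ H) ∧ (∀ w ∈ s.2, tv n w ∈ H) ∧
        (∀ j : Fin n, k ≤ j → Pi.single j (N : ℤ) ∈ H)) ↔
        (∀ w ∈ W, tv n w ∈ H) ∧ ∀ j : Fin n, Pi.single j (N : ℤ) ∈ H := by
    intro k
    induction k with
    | zero => intro _; simp
    | succ k ih =>
      intro hk
      obtain ⟨a1, a2, a3, a4⟩ := ih (by omega)
      rw [List.range_succ, List.foldl_append, List.foldl_cons, List.foldl_nil]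
      set s := (List.range k).foldl _ _ with hs
      clear_value s
      obtain ⟨b1, b2, b3, b4⟩ := clearColumn_spec hN (show k < n by omega) a3
      set r := clearColumn N (List.range n) k s.2
      clear_value r
      have g1 : ∀ i < k, gv (s.1 ++ [r.1]) i = gv s.1 i := fun i hi => gv_append_left (by omega)
      have g2 : gv (s.1 ++ [r.1]) k = r.1 := by
        have := gv_append_length s.1 r.1
        rwa [a1] at this
      refine ⟨by simp [a1], fun i hi => ?_, b3, fun H => ?_⟩
      · rcases Nat.lt_succ_iff_lt_or_eq.1 hi with hi | rfl
        · dsimp only; rw [g1 i hi]; exact a2 i hi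
        · dsimp only; rw [g2]; exact ⟨b1, b2⟩
      · rw [← a4 H]
        dsimp only
        constructor
        · rintro ⟨h1, h2, h3⟩
          have := (b4 H fun j hj => h3 j hj).1 ⟨g2 ▸ h1 k (by omega), h2⟩
          refine ⟨fun i hi => g1 i hi ▸ h1 i (by omega), this.2, fun j hj => ?_⟩
          rcases hj.eq_or_lt with hj | hj
          · have e : j = ⟨k, hk⟩ := Fin.ext hj.symm
            rw [e]; exact this.1
          · exact h3 j hj
        · rintro ⟨h1, h2, h3⟩
          have := (b4 H fun j hj => h3 j hj.le).2 ⟨h3 ⟨k, hk⟩ le_rfl, h2⟩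
          refine ⟨fun i hi => ?_, this.2, fun j hj => h3 j (by omega)⟩
          rcases Nat.lt_succ_iff_lt_or_eq.1 hi with hi | rfl
          · rw [g1 i hi]; exact h1 i hi
          · rw [g2]; exact this.1
  obtain ⟨a1, a2, a3, a4⟩ := key n le_rfl
  refine ⟨⟨fun i hi => (a2 i hi).1, fun i hi => (a2 i hi).2, a1⟩, fun H => ?_⟩
  rw [← a4 H]
  refine ⟨fun h => ⟨h, fun w hw => ?_, fun j hj => absurd j.2 (by omega)⟩, fun h => h.1⟩
  have : tv n w = 0 := funext fun j => a3 w hw j j.2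
  rw [this]
  exact H.zero_mem

/-- The lattice generated by the rows of a matrix. -/
def rowLat (n : ℕ) (T : List (List ℤ)) : AddSubgroup (Fin n → ℤ) :=
  AddSubgroup.closure (Set.range fun i : Fin n => tv n (gv T i))

/-- The lattice generated by a list of vectors and the multiples of `N`. -/
def modLat (N n : ℕ) (W : List (List ℤ)) : AddSubgroup (Fin n → ℤ) :=
  AddSubgroup.closure ({v | ∃ w ∈ W, v = tv n w} ∪ Set.range fun j => Pi.single j (N : ℤ))

theorem modLat_le {N n : ℕ} {W : List (List ℤ)} {H : AddSubgroup (Fin n → ℤ)} :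
    modLat N n W ≤ H ↔ (∀ w ∈ W, tv n w ∈ H) ∧ ∀ j : Fin n, Pi.single j (N : ℤ) ∈ H := by
  rw [modLat, AddSubgroup.closure_le, Set.union_subset_iff, Set.range_subset_iff]
  refine and_congr ⟨fun h w hw => h ⟨w, hw, rfl⟩, ?_⟩ Iff.rfl
  rintro h _ ⟨w, hw, rfl⟩
  exact h w hw

theorem smul_mem_modLat {N n : ℕ} (W : List (List ℤ)) (x : Fin n → ℤ) :
    (N : ℤ) • x ∈ modLat N n W :=
  (mem_iff_of_congr (N := N) (y := 0) fun j => .inr ⟨by simp, (modLat_le.1 le_rfl).2 j⟩).2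
    (zero_mem _)

theorem rowLat_le {n : ℕ} {T : List (List ℤ)} {H : AddSubgroup (Fin n → ℤ)} :
    rowLat n T ≤ H ↔ ∀ i < n, tv n (gv T i) ∈ H := by
  rw [rowLat, AddSubgroup.closure_le, Set.range_subset_iff]
  exact ⟨fun h i hi => h ⟨i, hi⟩, fun h i => h i i.2⟩

theorem rowLat_tri {N n : ℕ} (hN : 0 < N) (W : List (List ℤ)) :
    rowLat n (tri N (List.range n) W) = modLat N n W := by
  refine eq_of_forall_ge_iff fun H => ?_
  rw [rowLat_le, modLat_le]
  exact (tri_spec hN W).2 H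

theorem mem_rowLat {n : ℕ} {T : List (List ℤ)} {x : Fin n → ℤ} :
    x ∈ rowLat n T ↔ ∃ a : Fin n → ℤ, x = ∑ i, a i • tv n (gv T i) := by
  rw [rowLat, ← Submodule.span_int_eq_addSubgroupClosure, Submodule.mem_toAddSubgroup,
    Submodule.mem_span_range_iff_exists_fun]
  exact ⟨fun ⟨c, h⟩ => ⟨c, h.symm⟩, fun ⟨c, h⟩ => ⟨c, h.symm⟩⟩

/-- A vector of a lattice with a triangular basis that starts with zeros involves only the later
basis vectors. -/
theorem IsTri.exists_coeff {N n : ℕ} {T : List (List ℤ)} (hT : IsTri N n T) {x : Fin n → ℤ}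
    (hx : x ∈ rowLat n T) {k : ℕ} (h0 : ∀ j : Fin n, (j : ℕ) < k → x j = 0) :
    ∃ a : Fin n → ℤ, (∀ j : Fin n, (j : ℕ) < k → a j = 0) ∧ x = ∑ i, a i • tv n (gv T i) := by
  obtain ⟨a, ha⟩ := mem_rowLat.1 hx
  refine ⟨a, fun j hj => ?_, ha⟩
  obtain ⟨j, hjn⟩ := j
  induction j using Nat.strong_induction_on with
  | _ j ih =>
    have h1 := h0 ⟨j, hjn⟩ hj
    rw [ha, Finset.sum_apply, Finset.sum_eq_single ⟨j, hjn⟩] at h1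
    · rw [Pi.smul_apply, tv_apply, smul_eq_mul] at h1
      exact (mul_eq_zero.1 h1).resolve_right (hT.pos j hjn).ne'
    · intro i _ hi
      rw [Pi.smul_apply, tv_apply, smul_eq_mul]
      rcases lt_or_gt_of_ne (fun h => hi (Fin.ext h) : (i : ℕ) ≠ j) with h | h
      · rw [ih i h i.2 (h.trans hj), zero_mul]
      · rw [(hT.good i i.2).zero j h, mul_zero]
    · simp

/-- Reduction of a vector by the first rows of a triangular matrix, modulo `N`. The truth value
says whether the corresponding entries could be made zero. -/
def redTri (N : ℕ) (ix ixD : List ℕ) (T : List (List ℤ)) (z : List ℤ) : Bool × List ℤ :=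
  ixD.foldl (fun s i => (s.1 && (gz s.2 i % gz (gv T i) i == 0),
    ix.map fun j => md N (gz s.2 j - gz s.2 i / gz (gv T i) i * gz (gv T i) j)))
    (true, reduceVec N ix z)

@[fun_prop]
theorem polyTime_redTri : PolyTime (fun p : ℕ × List ℕ × List ℕ × List (List ℤ) × List ℤ =>
    redTri p.1 p.2.1 p.2.2.1 p.2.2.2.1 p.2.2.2.2) := by
  unfold redTri
  refine .foldl_add (by fun_prop) (by fun_prop) (by fun_prop) (fun p => 3 + bdSize p.1 p.2.1)
    (by fun_prop) fun p s i _ => ?_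
  have h1 := (bd_map_md p.1 p.2.1 fun j => gz s.2 j -
    gz s.2 i / gz (gv p.2.2.2.1 i) i * gz (gv p.2.2.2.1 i) j).sz_le
  have h2 := sz_bool_le (s.1 && (gz s.2 i % gz (gv p.2.2.2.1 i) i == 0))
  simp only [sz_prod]
  omega

/-- The result differs from `z` by an element of the lattice, and the truth value says whether `z`
is congruent to a vector that begins with `D` zeros. -/
theorem redTri_spec {N n D : ℕ} (hN : 0 < N) (hD : D ≤ n) {T : List (List ℤ)} (hT : IsTri N n T)
    (hNT : ∀ j, Pi.single j (N : ℤ) ∈ rowLat n T) (z : List ℤ) :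
    let r := redTri N (List.range n) (List.range D) T z
    tv n z - tv n r.2 ∈ rowLat n T ∧ (r.1 = true → ∀ j < D, gz r.2 j = 0) ∧
      ((∃ y, tv n z - y ∈ rowLat n T ∧ ∀ j : Fin n, (j : ℕ) < D → y j = 0) → r.1 = true) := by
  have congr_md : ∀ f : ℕ → ℤ, (fun j : Fin n => f j) -
      tv n ((List.range n).map fun j => md N (f j)) ∈ rowLat n T := by
    intro f
    refine (mem_iff_of_congr (N := N) (y := 0) fun j => .inr ⟨?_, hNT j⟩).2 (zero_mem _)
    rw [tv_map_range]
    simpa using dvd_sub_md hN (f j)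
  unfold redTri
  induction D with
  | zero => exact ⟨congr_md (gz z), by simp, fun _ => rfl⟩
  | succ D ih =>
    obtain ⟨a1, a2, a3⟩ := ih (by omega)
    rw [List.range_succ, List.foldl_append, List.foldl_cons, List.foldl_nil]
    set s := (List.range D).foldl _ _ with hs
    clear_value s
    have hDn : D < n := hD
    set d := gz (gv T D) D with hd
    have hdpos : 0 < d := hT.pos D hDn
    have hrow : tv n (gv T D) ∈ rowLat n T := rowLat_le.1 le_rfl D hDn
    refine ⟨?_, fun h j hj => ?_, ?_⟩
    · have h1 := congr_md fun j => gz s.2 j - gz s.2 D / d * gz (gv T D) j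
      have h2 := AddSubgroup.zsmul_mem _ hrow (gz s.2 D / d)
      have := add_mem (add_mem a1 h2) h1
      convert! this using 1
      ext j
      simp only [Pi.sub_apply, Pi.add_apply, Pi.smul_apply, smul_eq_mul, tv_apply]
      ring
    · simp only [Bool.and_eq_true, beq_iff_eq] at h
      have hz := a2 h.1
      rw [gz_map_range (by omega)]
      rcases Nat.lt_succ_iff_lt_or_eq.1 hj with hj | rfl
      · rw [hz j hj, (hT.good D hDn).zero j hj]
        simp [md_zero]
      · have := Int.ediv_mul_cancel (Int.dvd_of_emod_eq_zero h.2)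
        rw [this, sub_self, md_zero]
    · rintro ⟨y, hy, hy0⟩
      have hs1 := a3 ⟨y, hy, fun j hj => hy0 j (by omega)⟩
      have hz := a2 hs1
      simp only [Bool.and_eq_true, beq_iff_eq]
      refine ⟨hs1, ?_⟩
      have h1 : tv n s.2 - y ∈ rowLat n T := by
        have := sub_mem hy a1
        convert! this using 1
        abel
      obtain ⟨a, ha, hsum⟩ := hT.exists_coeff h1 (k := D) fun j hj => by
        rw [Pi.sub_apply, tv_apply, hz j hj, hy0 j (by omega), sub_zero]
      have h2 := congrFun hsum ⟨D, hDn⟩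
      rw [Finset.sum_apply, Finset.sum_eq_single ⟨D, hDn⟩, Pi.sub_apply, hy0 _ (by simp),
        sub_zero, Pi.smul_apply, smul_eq_mul, tv_apply, tv_apply] at h2
      · rw [h2]
        exact Int.mul_emod_left _ _
      · intro i _ hi
        rw [Pi.smul_apply, tv_apply, smul_eq_mul]
        rcases lt_or_gt_of_ne (fun h => hi (Fin.ext h) : (i : ℕ) ≠ D) with h | h
        · rw [ha i h, zero_mul]
        · rw [(hT.good i i.2).zero D h, mul_zero]
      · simp

/-! ### Linear equations modulo a lattice -/

/-- The triangular basis of the lattice of all `(y, m)` such that `y - ∑ t, m t • xs t` is an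
element of the lattice generated by `K` and the multiples of `N`. -/
def relLat (N : ℕ) (ixD ixk : List ℕ) (K xs : List (List ℤ)) : List (List ℤ) :=
  tri N (indices (ixD ++ ixk)) ((K.map fun r => ixD.map (gz r)) ++
    ixk.map fun t => ixD.map (gz (gv xs t)) ++ ixk.map fun j => bif j == t then 1 else 0)

/-- Coefficients for a representation of `z` as a linear combination of the `xs` modulo the lattice
generated by `K`, given `T = relLat N ixD ixk K xs`, and whether there are any. -/
def coef (N : ℕ) (ixD ixk : List ℕ) (T : List (List ℤ)) (z : List ℤ) : Bool × List ℤ :=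
  ((redTri N (indices (ixD ++ ixk)) ixD T (ixD.map (gz z))).1,
    ixk.map fun t => md N (-gz (redTri N (indices (ixD ++ ixk)) ixD T (ixD.map (gz z))).2
      (ixD.length + t)))

/-- Generators for the lattice of linear relations between the `xs` modulo the lattice generated by
`K`, given `T = relLat N ixD ixk K xs`. -/
def kernelRows (ixD ixk : List ℕ) (T : List (List ℤ)) : List (List ℤ) :=
  ixk.map fun j => ixk.map fun t => gz (gv T (ixD.length + j)) (ixD.length + t)

@[fun_prop]
theorem polyTime_relLat : PolyTime (fun p : ℕ × List ℕ × List ℕ × List (List ℤ) × List (List ℤ) =>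
    relLat p.1 p.2.1 p.2.2.1 p.2.2.2.1 p.2.2.2.2) := by
  unfold relLat
  fun_prop

@[fun_prop]
theorem polyTime_kernelRows : PolyTime (fun p : List ℕ × List ℕ × List (List ℤ) =>
    kernelRows p.1 p.2.1 p.2.2) := by
  unfold kernelRows
  fun_prop

theorem indices_range_append (D k : ℕ) :
    indices (List.range D ++ List.range k) = List.range (D + k) := by
  simp [indices]

theorem gz_append_left {A B : List ℤ} {i : ℕ} (h : i < A.length) : gz (A ++ B) i = gz A i := by
  simp [gz, List.getD, List.getElem?_append_left h]

theorem gz_append_right {A B : List ℤ} (i : ℕ) : gz (A ++ B) (A.length + i) = gz B i := by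
  simp [gz, List.getD, List.getElem?_append_right]

section

variable {N D k : ℕ} (hN : 0 < N) (K xs : List (List ℤ))

include hN

theorem isTri_relLat : IsTri N (D + k) (relLat N (List.range D) (List.range k) K xs) := by
  rw [relLat, indices_range_append]
  exact (tri_spec hN _).1

/-- The lattice of relations is the inverse image of the lattice generated by `K` and the multiples
of `N` under `(y, m) ↦ y - ∑ t, m t • xs t`. -/
theorem mem_rowLat_relLat (y : Fin (D + k) → ℤ) :
    y ∈ rowLat (D + k) (relLat N (List.range D) (List.range k) K xs) ↔
      (fun i => y (Fin.castAdd k i)) - ∑ t, y (Fin.natAdd D t) • tv D (gv xs t) ∈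
        modLat N D K := by
  rw [relLat, indices_range_append, rowLat_tri hN]
  let ψ : (Fin (D + k) → ℤ) →+ (Fin D → ℤ) :=
    { toFun := fun y => (fun i => y (Fin.castAdd k i)) - ∑ t, y (Fin.natAdd D t) • tv D (gv xs t)
      map_zero' := by ext i; simp
      map_add' := fun y z => by
        simp only [Pi.add_apply, add_smul, Finset.sum_add_distrib]
        ext i
        simp only [Pi.sub_apply, Pi.add_apply]
        ring }
  set Λ := modLat N (D + k) ((K.map fun r => (List.range D).map (gz r)) ++
    (List.range k).map fun t => (List.range D).map (gz (gv xs t)) ++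
      (List.range k).map fun j => bif j == t then 1 else 0) with hΛ
  change y ∈ Λ ↔ y ∈ (modLat N D K).comap ψ
  have hpad : ∀ r, tv (D + k) ((List.range D).map (gz r)) = Fin.append (tv D r) 0 := by
    intro r
    ext j
    refine Fin.addCases (fun i => ?_) (fun t => ?_) j
    · rw [tv_apply, Fin.val_castAdd, gz_map_range i.2, Fin.append_left]; rfl
    · rw [tv_apply, Fin.val_natAdd, gz_map_range_of_le (by omega), Fin.append_right]; rfl
  have hgen : ∀ t : Fin k, tv (D + k) ((List.range D).map (gz (gv xs t)) ++
      (List.range k).map fun j => bif j == (t : ℕ) then 1 else 0) =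
        Fin.append (tv D (gv xs t)) (Pi.single t 1) := by
    intro t
    ext j
    refine Fin.addCases (fun i => ?_) (fun s => ?_) j
    · rw [tv_apply, Fin.val_castAdd, gz_append_left (by simp), gz_map_range i.2, Fin.append_left]
      rfl
    · have := gz_append_right (A := (List.range D).map (gz (gv xs t)))
        (B := (List.range k).map fun j => bif j == (t : ℕ) then 1 else 0) s
      rw [List.length_map, List.length_range] at this
      rw [tv_apply, Fin.val_natAdd, this, gz_map_range s.2, Fin.append_right, Pi.single_apply,
        cond_eq_ite]
      simp [Fin.ext_iff]
  constructor
  · refine fun h => (modLat_le.2 ⟨fun w hw => ?_, fun j => ?_⟩ : Λ ≤ _) h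
    · rcases List.mem_append.1 hw with hw | hw
      · obtain ⟨r, hr, rfl⟩ := List.mem_map.1 hw
        rw [hpad, AddSubgroup.mem_comap]
        have : ψ (Fin.append (tv D r) 0) = tv D r := by
          ext i; simp [ψ]
        rw [this]
        exact (modLat_le.1 le_rfl).1 r hr
      · obtain ⟨t, ht, rfl⟩ := List.mem_map.1 hw
        have := hgen ⟨t, List.mem_range.1 ht⟩
        rw [this, AddSubgroup.mem_comap]
        have : ψ (Fin.append (tv D (gv xs t)) (Pi.single ⟨t, List.mem_range.1 ht⟩ 1)) = 0 := by
          ext i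
          simp only [ψ, AddMonoidHom.coe_mk, ZeroHom.coe_mk, Fin.append_left, Fin.append_right]
          rw [Finset.sum_eq_single ⟨t, List.mem_range.1 ht⟩]
          · simp
          · intro s _ hs
            rw [Pi.single_eq_of_ne hs, zero_smul]
          · simp
        rw [this]
        exact zero_mem _
    · have : Pi.single j (N : ℤ) = (N : ℤ) • Pi.single (M := fun _ => ℤ) j 1 := by
        rw [← Pi.single_smul]; simp
      rw [AddSubgroup.mem_comap, this, map_zsmul]
      exact smul_mem_modLat K _
  · intro h
    have h1 : (modLat N D K) ≤ Λ.comap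
        { toFun := fun x : Fin D → ℤ => Fin.append x (0 : Fin k → ℤ)
          map_zero' := by
            ext j; refine Fin.addCases (fun i => ?_) (fun t => ?_) j <;> simp
          map_add' := fun x y => by
            ext j; refine Fin.addCases (fun i => ?_) (fun t => ?_) j <;> simp } := by
      refine modLat_le.2 ⟨fun r hr => ?_, fun j => ?_⟩
      · change Fin.append (tv D r) 0 ∈ Λ
        rw [← hpad]
        exact (modLat_le.1 le_rfl).1 _ (List.mem_append.2 (.inl (List.mem_map.2 ⟨r, hr, rfl⟩)))
      · change Fin.append (Pi.single j (N : ℤ)) 0 ∈ Λ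
        have : Fin.append (Pi.single j (N : ℤ)) (0 : Fin k → ℤ) =
            Pi.single (Fin.castAdd k j) (N : ℤ) := by
          ext i
          refine Fin.addCases (fun i => ?_) (fun t => ?_) i
          · rw [Fin.append_left, Pi.single_apply, Pi.single_apply]
            simp
          · rw [Fin.append_right, Pi.single_eq_of_ne (by simp [Fin.ext_iff]; omega)]
            rfl
        rw [this]
        exact (modLat_le.1 le_rfl).2 _
    have h2 : Fin.append (ψ y) 0 ∈ Λ := h1 h
    have h3 : ∑ t, y (Fin.natAdd D t) • Fin.append (tv D (gv xs t)) (Pi.single t 1) ∈ Λ := by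
      refine sum_mem fun t _ => zsmul_mem ?_ _
      rw [← hgen]
      exact (modLat_le.1 le_rfl).1 _ (List.mem_append.2 (.inr
        (List.mem_map.2 ⟨t, List.mem_range.2 t.2, rfl⟩)))
    convert! add_mem h2 h3 using 1
    ext j
    refine Fin.addCases (fun i => ?_) (fun t => ?_) j
    · simp [ψ, Finset.sum_apply]
    · simp [Finset.sum_apply, Pi.single_apply]

theorem single_mem_rowLat_relLat (j : Fin (D + k)) :
    Pi.single j (N : ℤ) ∈ rowLat (D + k) (relLat N (List.range D) (List.range k) K xs) := by
  rw [relLat, indices_range_append, rowLat_tri hN]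
  exact (modLat_le.1 le_rfl).2 j

theorem coef_sound {z : List ℤ}
    (h : (coef N (List.range D) (List.range k)
      (relLat N (List.range D) (List.range k) K xs) z).1 = true) :
    tv D z - ∑ t : Fin k, gz (coef N (List.range D) (List.range k)
      (relLat N (List.range D) (List.range k) K xs) z).2 t • tv D (gv xs t) ∈ modLat N D K := by
  unfold coef at h ⊢
  rw [indices_range_append] at h ⊢
  obtain ⟨a1, a2, -⟩ := redTri_spec hN (Nat.le_add_right D k) (isTri_relLat hN K xs)
    (single_mem_rowLat_relLat hN K xs) ((List.range D).map (gz z))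
  set r := redTri N (List.range (D + k)) (List.range D)
    (relLat N (List.range D) (List.range k) K xs) ((List.range D).map (gz z))
  have hz := a2 h
  rw [mem_rowLat_relLat hN] at a1
  have h2 : ∑ t : Fin k, (-gz r.2 (D + t) - md N (-gz r.2 (D + t))) • tv D (gv xs t) ∈
      modLat N D K := by
    refine sum_mem fun t _ => ?_
    obtain ⟨c, hc⟩ := dvd_sub_md hN (-gz r.2 (D + t))
    rw [hc, mul_smul]
    exact smul_mem_modLat K _
  have := add_mem a1 h2
  convert! this using 1
  ext i
  simp only [Pi.sub_apply, Pi.add_apply, Finset.sum_apply, Pi.smul_apply, smul_eq_mul, tv_apply,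
    Fin.val_castAdd, Fin.val_natAdd, List.length_range]
  rw [gz_map_range i.2, hz i i.2, sub_zero, sub_eq_add_neg, sub_eq_add_neg, add_assoc,
    add_right_inj, ← Finset.sum_neg_distrib, ← Finset.sum_neg_distrib, ← Finset.sum_add_distrib]
  refine Finset.sum_congr rfl fun t _ => ?_
  rw [gz_map_range t.2, gz_map_range_of_le (by omega)]
  ring

theorem coef_complete {z : List ℤ} (m : Fin k → ℤ)
    (h : tv D z - ∑ t, m t • tv D (gv xs t) ∈ modLat N D K) :
    (coef N (List.range D) (List.range k)
      (relLat N (List.range D) (List.range k) K xs) z).1 = true := by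
  unfold coef
  rw [indices_range_append]
  refine (redTri_spec hN (Nat.le_add_right D k) (isTri_relLat hN K xs)
    (single_mem_rowLat_relLat hN K xs) ((List.range D).map (gz z))).2.2
    ⟨Fin.append 0 (-m), ?_, fun j hj => ?_⟩
  · rw [mem_rowLat_relLat hN]
    convert! h using 1
    ext i
    simp only [Pi.sub_apply, Finset.sum_apply, Pi.smul_apply, smul_eq_mul, tv_apply,
      Fin.val_castAdd, Fin.val_natAdd, Fin.append_left, Fin.append_right]
    rw [gz_map_range i.2]
    congr 1
    · simp
    · refine Finset.sum_congr rfl fun t _ => ?_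
      rw [gz_map_range_of_le (by omega)]
      simp
  · have : j = Fin.castAdd k ⟨j, hj⟩ := rfl
    rw [this, Fin.append_left]
    rfl

/-- The rows of the triangular basis that begin with `D` zeros generate all relations with `y = 0`.
-/
theorem mem_closure_kernelRows (c : Fin k → ℤ) :
    c ∈ AddSubgroup.closure {v | ∃ r ∈ kernelRows (List.range D) (List.range k)
      (relLat N (List.range D) (List.range k) K xs), v = tv k r} ↔
    ∑ t, c t • tv D (gv xs t) ∈ modLat N D K := by
  set T := relLat N (List.range D) (List.range k) K xs with hT
  have htri : IsTri N (D + k) T := isTri_relLat hN K xs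
  have hrow : ∀ (j : Fin k), ∀ t : Fin k,
      gz (gv (kernelRows (List.range D) (List.range k) T) j) t = gz (gv T (D + j)) (D + t) := by
    intro j t
    rw [kernelRows, gv_map_range j.2, gz_map_range t.2, List.length_range]
  constructor
  · let φ : (Fin k → ℤ) →+ (Fin D → ℤ) :=
      { toFun := fun c => ∑ t, c t • tv D (gv xs t)
        map_zero' := by simp
        map_add' := fun y z => by simp only [Pi.add_apply, add_smul, Finset.sum_add_distrib] }
    suffices h : AddSubgroup.closure {v | ∃ r ∈ kernelRows (List.range D) (List.range k) T,
        v = tv k r} ≤ (modLat N D K).comap φ from fun hc => h hc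
    rw [AddSubgroup.closure_le]
    rintro _ ⟨r, hr, rfl⟩
    obtain ⟨j, hj, rfl⟩ := List.mem_map.1 hr
    have hj := List.mem_range.1 hj
    have h1 : tv (D + k) (gv T (D + j)) ∈ rowLat (D + k) T :=
      rowLat_le.1 le_rfl (D + j) (by omega)
    rw [hT, mem_rowLat_relLat hN] at h1
    have h2 := neg_mem h1
    change ∑ t : Fin k, _ • _ ∈ modLat N D K
    convert! h2 using 1
    ext i
    simp only [Pi.neg_apply, Pi.sub_apply, Finset.sum_apply, Pi.smul_apply, tv_apply,
      Fin.val_castAdd, Fin.val_natAdd]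
    rw [(htri.good (D + j) (by omega)).zero i (by omega), zero_sub, neg_neg]
    refine Finset.sum_congr rfl fun t _ => ?_
    rw [gz_map_range t.2, List.length_range]
  · intro h
    have h1 : Fin.append 0 c ∈ rowLat (D + k) T := by
      rw [hT, mem_rowLat_relLat hN]
      have := neg_mem h
      convert! this using 1
      ext i
      simp
    obtain ⟨a, ha, hsum⟩ := htri.exists_coeff h1 (k := D) fun j hj => by
      have : j = Fin.castAdd k ⟨j, hj⟩ := rfl
      rw [this, Fin.append_left]
      rfl
    have h2 : c = ∑ j : Fin k, a (Fin.natAdd D j) •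
        tv k (gv (kernelRows (List.range D) (List.range k) T) j) := by
      ext t
      have h3 := congrFun hsum (Fin.natAdd D t)
      rw [Fin.append_right, Finset.sum_apply, Fin.sum_univ_add, Finset.sum_eq_zero, zero_add] at h3
      · rw [h3, Finset.sum_apply]
        refine Finset.sum_congr rfl fun j _ => ?_
        rw [Pi.smul_apply, Pi.smul_apply, tv_apply, tv_apply, hrow]
        rfl
      · intro i _
        rw [ha _ (by simp), zero_smul]
        rfl
    rw [h2]
    refine sum_mem fun j _ => AddSubgroup.zsmul_mem _ (AddSubgroup.subset_closure ?_) _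
    refine ⟨_, List.mem_map.2 ⟨j, List.mem_range.2 j.2, rfl⟩, ?_⟩
    rw [kernelRows, gv_map_range j.2]

end

theorem kernelRows_nonneg {N D k : ℕ} (hN : 0 < N) (K xs : List (List ℤ)) {r : List ℤ}
    (hr : r ∈ kernelRows (List.range D) (List.range k)
      (relLat N (List.range D) (List.range k) K xs)) (t : ℕ) : 0 ≤ gz r t ∧ gz r t ≤ N := by
  obtain ⟨j, hj, rfl⟩ := List.mem_map.1 hr
  have hj := List.mem_range.1 hj
  have := (isTri_relLat hN K xs (D := D) (k := k)).good (D + j) (by omega)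
  rcases lt_or_ge t k with h | h
  · rw [gz_map_range h, List.length_range]
    exact ⟨this.nonneg _, this.le _⟩
  · rw [gz_map_range_of_le h]; simp

theorem coef_nonneg (N : ℕ) {k : ℕ} (ixD : List ℕ) (T : List (List ℤ)) (z : List ℤ) (t : ℕ) :
    0 ≤ gz (coef N ixD (List.range k) T z).2 t ∧ gz (coef N ixD (List.range k) T z).2 t ≤ N := by
  unfold coef
  rcases lt_or_ge t k with h | h
  · rw [gz_map_range h]
    exact ⟨md_nonneg _ _, md_le _ _⟩
  · rw [gz_map_range_of_le h]; simp

/-! ### The characteristic polynomial by the method of Faddeev and LeVerrier -/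

section CharPoly

open Polynomial Matrix

variable {n : ℕ} (A : Matrix (Fin n) (Fin n) ℤ)

/-- The matrices of coefficients of the adjugate of `X - A`. -/
noncomputable def adjCoeff (j : ℕ) : Matrix (Fin n) (Fin n) ℤ :=
  fun a b => ((charmatrix A).adjugate a b).coeff j

theorem charpoly_smul_one_apply (a b : Fin n) :
    (A.charpoly • (1 : Matrix (Fin n) (Fin n) ℤ[X])) a b =
      X * (charmatrix A).adjugate a b - ∑ l, C (A a l) * (charmatrix A).adjugate l b := by
  rw [charpoly, ← mul_adjugate, mul_apply]
  simp only [charmatrix_apply, sub_mul, Finset.sum_sub_distrib, diagonal_apply, ite_mul, zero_mul,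
    Finset.sum_ite_eq, Finset.mem_univ, if_true]

/-- The recursion comes from comparing coefficients in `(X - A) * adjugate (X - A) = charpoly A`. -/
theorem adjCoeff_eq (j : ℕ) :
    adjCoeff A j = A * adjCoeff A (j + 1) + A.charpoly.coeff (j + 1) • 1 := by
  ext a b
  have h := congrArg (fun p => p.coeff (j + 1)) (charpoly_smul_one_apply A a b)
  simp only [coeff_sub, coeff_X_mul, finsetSum_coeff, coeff_C_mul, Matrix.smul_apply, one_apply,
    smul_eq_mul] at h
  simp only [Matrix.add_apply, mul_apply, adjCoeff, Matrix.smul_apply, one_apply, smul_eq_mul]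
  split_ifs at h ⊢ <;> simp at h ⊢ <;> linarith

theorem mul_adjCoeff_zero : A * adjCoeff A 0 = -(A.charpoly.coeff 0 • 1) := by
  ext a b
  have h := congrArg (fun p => p.coeff 0) (charpoly_smul_one_apply A a b)
  simp only [coeff_sub, mul_coeff_zero, coeff_X_zero, zero_mul, finsetSum_coeff, coeff_C_zero,
    Matrix.smul_apply, one_apply, smul_eq_mul] at h
  simp only [Matrix.neg_apply, mul_apply, adjCoeff, Matrix.smul_apply, one_apply, smul_eq_mul]
  split_ifs at h ⊢ <;> simp at h ⊢ <;> linarith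

/-- From degree `n` on, the coefficients of the characteristic polynomial no longer contribute to
the recursion, so `adjCoeff A j` is `A ^ t * adjCoeff A (j + t)`, which is zero for large `t`. -/
theorem adjCoeff_eq_zero {j : ℕ} (hj : n ≤ j) : adjCoeff A j = 0 := by
  have hp : ∀ i, n ≤ i → adjCoeff A i = A * adjCoeff A (i + 1) := by
    intro i hi
    rw [adjCoeff_eq, coeff_eq_zero_of_natDegree_lt, zero_smul, add_zero]
    rw [charpoly_natDegree_eq_dim, Fintype.card_fin]
    omega
  have h1 : ∀ t, adjCoeff A j = A ^ t * adjCoeff A (j + t) := by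
    intro t
    induction t with
    | zero => simp
    | succ t ih => rw [ih, hp _ (by omega), pow_succ, Matrix.mul_assoc]; rfl
  let d := ∑ a, ∑ b, ((charmatrix A).adjugate a b).natDegree
  have h2 : adjCoeff A (j + (d + 1)) = 0 := by
    ext a b
    refine coeff_eq_zero_of_natDegree_lt ?_
    have h3 : ((charmatrix A).adjugate a b).natDegree ≤ d :=
      (Finset.single_le_sum (f := fun b => ((charmatrix A).adjugate a b).natDegree)
        (fun _ _ => Nat.zero_le _) (Finset.mem_univ b)).trans
        (Finset.single_le_sum (f := fun a => ∑ b, ((charmatrix A).adjugate a b).natDegree)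
          (fun _ _ => Nat.zero_le _) (Finset.mem_univ a))
    omega
  rw [h1 (d + 1), h2, Matrix.mul_zero]

/-- The trace of the adjugate of `X - A` is the derivative of the characteristic polynomial. -/
theorem trace_adjugate_charmatrix :
    (charmatrix A).adjugate.trace = derivative A.charpoly := by
  rw [charpoly, det_apply, derivative_sum]
  simp only [trace, diag_apply, adjugate_apply, det_apply]
  rw [Finset.sum_comm]
  refine Finset.sum_congr rfl fun σ _ => ?_
  rw [← Finset.smul_sum, derivative_smul, derivative_prod_finset]
  congr 1
  refine Finset.sum_congr rfl fun a _ => ?_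
  by_cases h : σ a = a
  · rw [← Finset.mul_prod_erase _ _ (Finset.mem_univ a), h, charmatrix_apply_eq]
    simp only [updateRow_self, Pi.single_eq_same, one_mul, derivative_sub, derivative_X,
      derivative_C, sub_zero, mul_one]
    refine Finset.prod_congr rfl fun i hi => ?_
    rw [updateRow_ne]
    intro h'
    exact (Finset.mem_erase.1 hi).1 (σ.injective (h'.trans h.symm))
  · rw [charmatrix_apply_ne _ _ _ h, derivative_neg, derivative_C, neg_zero, mul_zero]
    refine Finset.prod_eq_zero (Finset.mem_univ (σ.symm a)) ?_
    rw [Equiv.apply_symm_apply, updateRow_self, Pi.single_eq_of_ne]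
    intro h'
    exact h (by rw [← h', Equiv.apply_symm_apply, h'])

theorem trace_adjCoeff (j : ℕ) : (adjCoeff A j).trace = A.charpoly.coeff (j + 1) * (j + 1) := by
  rw [← coeff_derivative, ← trace_adjugate_charmatrix, trace, trace, finsetSum_coeff]
  rfl

/-- The traces of the matrices in the recursion give the coefficients of the characteristic
polynomial. -/
theorem trace_mul_adjCoeff {j k : ℕ} (h : j + k = n) :
    (A * adjCoeff A j).trace = -(k * A.charpoly.coeff j) := by
  cases j with
  | zero =>
    have : k = n := by omega
    rw [mul_adjCoeff_zero, trace_neg, trace_smul, trace_one, Fintype.card_fin, this, smul_eq_mul,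
      mul_comm]
  | succ j =>
    have h1 := trace_adjCoeff A j
    rw [adjCoeff_eq, trace_add, trace_smul, trace_one, Fintype.card_fin, smul_eq_mul] at h1
    have : (n : ℤ) = j + 1 + k := by exact_mod_cast h.symm
    rw [this] at h1
    linarith

end CharPoly

/-- The product of two matrices. -/
def matMul (ix : List ℕ) (A M : List (List ℤ)) : List (List ℤ) :=
  ix.map fun i => ix.map fun j => (ix.map fun l => gz (gv A i) l * gz (gv M l) j).sum

/-- The matrix `A * M + c`. -/
def mulAdd (ix : List ℕ) (A M : List (List ℤ)) (c : ℤ) : List (List ℤ) :=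
  ix.map fun i => ix.map fun j => gz (gv (matMul ix A M) i) j + bif i == j then c else 0

/-- The trace of a product of two matrices, divided by `-(k + 1)`. -/
def traceDiv (ix : List ℕ) (A M : List (List ℤ)) (k : ℕ) : ℤ :=
  -(ix.map fun i => gz (gv (matMul ix A M) i) i).sum / ((k + 1 : ℕ) : ℤ)

/-- The constant coefficient of the characteristic polynomial. The state after `k + 1` steps
consists of the coefficient of `X ^ (n - k - 1)` in the adjugate of `X - A` and of the coefficient
of the same power in the characteristic polynomial. -/
def charConst (ix : List ℕ) (A : List (List ℤ)) : ℤ :=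
  (ix.foldl (fun s k => (mulAdd ix A s.1 s.2, traceDiv ix A (mulAdd ix A s.1 s.2) k))
    (([] : List (List ℤ)), (1 : ℤ))).2

/-- The Gram matrix of the columns of the matrix with the given rows. -/
def gram (ix : List ℕ) (rels : List (List ℤ)) : List (List ℤ) :=
  ix.map fun i => ix.map fun j => (rels.map fun r => gz r i * gz r j).sum

@[fun_prop]
theorem polyTime_matMul : PolyTime (fun p : List ℕ × List (List ℤ) × List (List ℤ) =>
    matMul p.1 p.2.1 p.2.2) := by
  unfold matMul; fun_prop

@[fun_prop]
theorem polyTime_mulAdd : PolyTime (fun p : List ℕ × List (List ℤ) × List (List ℤ) × ℤ =>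
    mulAdd p.1 p.2.1 p.2.2.1 p.2.2.2) := by
  unfold mulAdd; fun_prop

@[fun_prop]
theorem polyTime_traceDiv : PolyTime (fun p : List ℕ × List (List ℤ) × List (List ℤ) × ℕ =>
    traceDiv p.1 p.2.1 p.2.2.1 p.2.2.2) := by
  unfold traceDiv; fun_prop

@[fun_prop]
theorem polyTime_gram : PolyTime (fun p : List ℕ × List (List ℤ) => gram p.1 p.2) := by
  unfold gram; fun_prop

theorem gz_mem (v : List ℤ) (i : ℕ) : gz v i ∈ v ∨ gz v i = 0 := by
  rcases lt_or_ge i v.length with h | h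
  · left; simp [gz, List.getD, h]
  · right; simp [gz, List.getD, h]

theorem gv_mem (v : List (List ℤ)) (i : ℕ) : gv v i ∈ v ∨ gv v i = [] := by
  rcases lt_or_ge i v.length with h | h
  · left; simp [gv, List.getD, h]
  · right; simp [gv, List.getD, h]

theorem natAbs_sum_map_le {α : Type} {l : List α} {f : α → ℤ} {b : ℕ}
    (h : ∀ x ∈ l, (f x).natAbs ≤ b) : (l.map f).sum.natAbs ≤ l.length * b := by
  induction l with
  | nil => simp
  | cons x l ih =>
    rw [List.map_cons, List.sum_cons, List.length_cons, add_mul]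
    have h1 := h x (by simp)
    have h2 := ih fun y hy => h y (by simp [hy])
    have := Int.natAbs_add_le (f x) (l.map f).sum
    omega

/-- All entries of the matrix are bounded by `b`. -/
def MatBd (b : ℕ) (M : List (List ℤ)) : Prop := ∀ r ∈ M, ∀ x ∈ r, x.natAbs ≤ b

theorem MatBd.gz_le {b : ℕ} {M : List (List ℤ)} (h : MatBd b M) (i j : ℕ) :
    (gz (gv M i) j).natAbs ≤ b := by
  rcases gz_mem (gv M i) j with h1 | h1
  · rcases gv_mem M i with h2 | h2
    · exact h _ h2 _ h1
    · rw [h2] at h1; simp at h1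
  · rw [h1]; simp

theorem matBd_map {ix ix' : List ℕ} {f : ℕ → ℕ → ℤ} {b : ℕ}
    (h : ∀ i ∈ ix, ∀ j ∈ ix', (f i j).natAbs ≤ b) :
    MatBd b (ix.map fun i => ix'.map fun j => f i j) := by
  intro r hr x hx
  obtain ⟨i, hi, rfl⟩ := List.mem_map.1 hr
  obtain ⟨j, hj, rfl⟩ := List.mem_map.1 hx
  exact h i hi j hj

theorem matBd_matMul {ix : List ℕ} {A M : List (List ℤ)} {a b : ℕ} (hA : MatBd a A)
    (hM : MatBd b M) : MatBd (ix.length * (a * b)) (matMul ix A M) := by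
  refine matBd_map fun i _ j _ => natAbs_sum_map_le fun l _ => ?_
  rw [Int.natAbs_mul]
  exact Nat.mul_le_mul (hA.gz_le _ _) (hM.gz_le _ _)

theorem matBd_mulAdd {ix : List ℕ} {A M : List (List ℤ)} {a b : ℕ} {c : ℤ} (hA : MatBd a A)
    (hM : MatBd b M) (hc : c.natAbs ≤ b) : MatBd ((ix.length * a + 1) * b) (mulAdd ix A M c) := by
  refine matBd_map fun i _ j _ => (Int.natAbs_add_le _ _).trans ?_
  have h1 := (matBd_matMul (ix := ix) hA hM).gz_le i j
  have h2 : (bif i == j then c else 0).natAbs ≤ b := by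
    cases i == j
    · simp
    · exact hc
  rw [add_mul, mul_assoc]
  omega

theorem natAbs_traceDiv_le {ix : List ℕ} {A M : List (List ℤ)} {a b k : ℕ} (hA : MatBd a A)
    (hM : MatBd b M) : (traceDiv ix A M k).natAbs ≤ ix.length * (ix.length * (a * b)) := by
  refine (Int.natAbs_ediv_le_natAbs _ _).trans ?_
  rw [Int.natAbs_neg]
  exact natAbs_sum_map_le fun i _ => (matBd_matMul (ix := ix) hA hM).gz_le i i

theorem natAbs_lt_two_pow_sz (x : ℤ) : x.natAbs < 2 ^ sz x := by
  rw [sz_int]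
  exact (Nat.lt_size_self _).trans (Nat.pow_lt_pow_right (by norm_num) (by omega))

@[fun_prop]
theorem polyTime_charConst : PolyTime (fun p : List ℕ × List (List ℤ) => charConst p.1 p.2) := by
  unfold charConst
  -- Every step multiplies the bound for the entries by `2 ^ y` at most.
  let y : List ℕ × List (List ℤ) → ℕ := fun p => 3 * sz p.1 + 2 * sz p.2 + 2
  let b : List ℕ × List (List ℤ) → ℕ := fun p => sz p.1 * y p + 2
  have hy : PolyBdd y := by unfold y; fun_prop
  have hb : PolyBdd b := by unfold b; fun_prop
  refine PolyTime.snd.comp (.foldl (by fun_prop) (by fun_prop) (by fun_prop)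
    (fun p => (sz p.1 * (sz p.1 * (b p + 1) + 1 + 1) + 1) + b p + 1) (by fun_prop) fun p l hl => ?_)
  have hA : MatBd (2 ^ sz p.2) p.2 := fun r hr x hx =>
    (natAbs_lt_two_pow_sz x).le.trans (Nat.pow_le_pow_right (by norm_num)
      ((sz_le_of_mem hx).trans (sz_le_of_mem hr)))
  have hlen := length_le_sz p.1
  have hlen2 : p.1.length ≤ 2 ^ sz p.1 := hlen.trans Nat.lt_two_pow_self.le
  have key : ∀ l : List ℕ, let s := l.foldl (fun s k => (mulAdd p.1 p.2 s.1 s.2,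
      traceDiv p.1 p.2 (mulAdd p.1 p.2 s.1 s.2) k)) (([] : List (List ℤ)), (1 : ℤ))
      (s.1.length ≤ p.1.length ∧ ∀ r ∈ s.1, r.length ≤ p.1.length) ∧
        MatBd (2 ^ (l.length * y p)) s.1 ∧ s.2.natAbs ≤ 2 ^ (l.length * y p) := by
    intro l
    induction l using List.reverseRecOn with
    | nil => exact ⟨by simp, by simp [MatBd], by simp⟩
    | append_singleton l k ih =>
      obtain ⟨-, h1, h2⟩ := ih
      rw [List.foldl_append, List.foldl_cons, List.foldl_nil]
      set s := l.foldl _ _ with hs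
      clear_value s
      have h3 := matBd_mulAdd (ix := p.1) hA h1 h2
      have h4 := natAbs_traceDiv_le (ix := p.1) (k := k) hA h3
      have e1 : p.1.length * 2 ^ sz p.2 + 1 ≤ 2 ^ (sz p.1 + sz p.2 + 1) := by
        have : p.1.length * 2 ^ sz p.2 ≤ 2 ^ sz p.1 * 2 ^ sz p.2 := by gcongr
        have : 1 ≤ 2 ^ sz p.1 * 2 ^ sz p.2 := Nat.one_le_iff_ne_zero.2 (by positivity)
        rw [pow_succ, pow_add]
        omega
      have e2 : 2 ^ ((l ++ [k]).length * y p) = 2 ^ (2 * sz p.1 + sz p.2 + 1) *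
          (2 ^ (sz p.1 + sz p.2 + 1) * 2 ^ (l.length * y p)) := by
        rw [List.length_append, List.length_singleton, add_mul, ← pow_add, ← pow_add]
        congr 1
        simp only [y]
        ring
      have e3 : (p.1.length * 2 ^ sz p.2 + 1) * 2 ^ (l.length * y p) ≤
          2 ^ (sz p.1 + sz p.2 + 1) * 2 ^ (l.length * y p) := by gcongr
      refine ⟨⟨by simp [mulAdd], ?_⟩, fun r hr x hx => (h3 r hr x hx).trans ?_, h4.trans ?_⟩
      · intro r hr
        obtain ⟨i, -, rfl⟩ := List.mem_map.1 hr
        simp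
      · rw [e2]
        exact e3.trans (Nat.le_mul_of_pos_left _ (by positivity))
      · rw [e2]
        calc _ = (p.1.length * p.1.length * 2 ^ sz p.2) *
              ((p.1.length * 2 ^ sz p.2 + 1) * 2 ^ (l.length * y p)) := by ring
          _ ≤ (2 ^ sz p.1 * 2 ^ sz p.1 * 2 ^ sz p.2) *
              (2 ^ (sz p.1 + sz p.2 + 1) * 2 ^ (l.length * y p)) := by gcongr
          _ ≤ _ := by
            gcongr
            rw [← pow_add, ← pow_add]
            exact Nat.pow_le_pow_right (by norm_num) (by omega)
  obtain ⟨⟨h1, h2⟩, h3, h4⟩ := key l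
  have hll : l.length ≤ sz p.1 := hl.length_le.trans hlen
  have small : ∀ x : ℤ, x.natAbs ≤ 2 ^ (l.length * y p) → sz x ≤ b p := by
    intro x hx
    have : x.natAbs.size ≤ l.length * y p + 1 :=
      Nat.size_le.2 (hx.trans_lt (Nat.pow_lt_pow_right (by norm_num) (by omega)))
    have : l.length * y p ≤ sz p.1 * y p := by gcongr
    rw [sz_int]
    simp only [b]
    omega
  rw [sz_prod]
  refine Nat.add_le_add_right (Nat.add_le_add ((sz_list_le fun r hr =>
    (sz_list_le fun x hx => small x (h3 r hr x hx)).trans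
      (Nat.add_le_add_right (Nat.mul_le_mul_right _ ((h2 r hr).trans hlen)) 1)).trans
        (Nat.add_le_add_right (Nat.mul_le_mul_right _ (h1.trans hlen)) 1)) (small _ h4)) 1

/-- The matrix with the entries of a list of lists. -/
def toMat (n : ℕ) (M : List (List ℤ)) : Matrix (Fin n) (Fin n) ℤ := fun i j => gz (gv M i) j

theorem sum_map_range {α : Type*} [AddCommMonoid α] (n : ℕ) (f : ℕ → α) :
    ((List.range n).map f).sum = ∑ i : Fin n, f i := by
  induction n with
  | zero => simp
  | succ n ih => rw [List.range_succ, List.map_append, List.sum_append, ih,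
      Fin.sum_univ_castSucc]; simp

theorem toMat_matMul (n : ℕ) (A M : List (List ℤ)) :
    toMat n (matMul (List.range n) A M) = toMat n A * toMat n M := by
  ext i j
  rw [toMat, matMul, gv_map_range i.2, gz_map_range j.2, sum_map_range, Matrix.mul_apply]
  rfl

theorem toMat_mulAdd (n : ℕ) (A M : List (List ℤ)) (c : ℤ) :
    toMat n (mulAdd (List.range n) A M c) = toMat n A * toMat n M + c • 1 := by
  rw [← toMat_matMul]
  ext i j
  rw [toMat, mulAdd, gv_map_range i.2, gz_map_range j.2, Matrix.add_apply, Matrix.smul_apply,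
    Matrix.one_apply, cond_eq_ite]
  simp [toMat, Fin.ext_iff]

theorem traceDiv_eq (n : ℕ) (A M : List (List ℤ)) (k : ℕ) :
    traceDiv (List.range n) A M k = -(toMat n A * toMat n M).trace / ((k + 1 : ℕ) : ℤ) := by
  rw [traceDiv, sum_map_range, ← toMat_matMul]
  rfl

theorem natAbs_charConst (n : ℕ) (A : List (List ℤ)) :
    (charConst (List.range n) A).natAbs = (toMat n A).det.natAbs := by
  have key : ∀ k ≤ n, ∀ s, s = (List.range k).foldl (fun s k => (mulAdd (List.range n) A s.1 s.2,
      traceDiv (List.range n) A (mulAdd (List.range n) A s.1 s.2) k))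
        (([] : List (List ℤ)), (1 : ℤ)) →
      toMat n s.1 = adjCoeff (toMat n A) (n - k) ∧ s.2 = (toMat n A).charpoly.coeff (n - k) := by
    intro k
    induction k with
    | zero =>
      rintro _ _ rfl
      refine ⟨?_, ?_⟩
      · rw [adjCoeff_eq_zero _ (by omega)]
        ext i j
        simp [toMat, gv, gz]
      · have h1 := (toMat n A).charpoly_monic.coeff_natDegree
        rw [Matrix.charpoly_natDegree_eq_dim, Fintype.card_fin] at h1
        exact h1.symm
    | succ k ih =>
      rintro hk _ rfl
      obtain ⟨h1, h2⟩ := ih (by omega) _ rfl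
      rw [List.range_succ, List.foldl_append, List.foldl_cons, List.foldl_nil]
      set s := (List.range k).foldl _ _ with hs
      clear_value s
      have h3 : toMat n (mulAdd (List.range n) A s.1 s.2) =
          adjCoeff (toMat n A) (n - (k + 1)) := by
        rw [toMat_mulAdd, h1, h2, adjCoeff_eq _ (n - (k + 1)),
          show n - (k + 1) + 1 = n - k by omega]
      refine ⟨h3, ?_⟩
      dsimp only
      rw [traceDiv_eq, h3, trace_mul_adjCoeff _ (show n - (k + 1) + (k + 1) = n by omega), neg_neg]
      exact Int.mul_ediv_cancel_left _ (by positivity)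
  have h := (key n le_rfl _ rfl).2
  rw [Nat.sub_self] at h
  rw [Matrix.det_eq_sign_charpoly_coeff, charConst, h, Int.natAbs_mul, Int.natAbs_pow]
  simp

/-- If a lattice is generated by a list of vectors and contains a nonzero multiple of every vector,
then the determinant of the Gram matrix is not zero, and its multiples lie in the lattice. -/
theorem gram_det {n : ℕ} {rels : List (Fin n → ℤ)} {N : ℕ} (hN : 0 < N)
    (h : ∀ v : Fin n → ℤ, (N : ℤ) • v ∈ AddSubgroup.closure {r | r ∈ rels}) :
    (charConst (List.range n) (gram (List.range n) (rels.map List.ofFn))).natAbs ≠ 0 ∧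
    ∀ v : Fin n → ℤ, ((charConst (List.range n)
      (gram (List.range n) (rels.map List.ofFn))).natAbs : ℤ) • v ∈
        AddSubgroup.closure {r | r ∈ rels} := by
  rw [natAbs_charConst]
  set G := toMat n (gram (List.range n) (rels.map List.ofFn)) with hG
  have hGx : ∀ x : Fin n → ℤ, G.mulVec x = (rels.map fun r => (r ⬝ᵥ x) • r).sum := by
    intro x
    ext i
    have e : ∀ j, G i j = (rels.map fun r => r i * r j).sum := by
      intro j
      rw [hG, toMat, gram, gv_map_range i.2, gz_map_range j.2, List.map_map]
      congr 1
      refine List.map_congr_left fun r _ => ?_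
      simp [gz]
    simp only [Matrix.mulVec, dotProduct, e]
    clear_value G
    clear hG h e
    induction rels with
    | nil => simp
    | cons r rels ih =>
      simp only [List.map_cons, List.sum_cons, Pi.add_apply, add_mul, Finset.sum_add_distrib, ih,
        Pi.smul_apply, smul_eq_mul]
      congr 1
      rw [Finset.sum_mul]
      exact Finset.sum_congr rfl fun j _ => by ring
  have hdet : G.det ≠ 0 := by
    intro h0
    obtain ⟨x, hx, hGx0⟩ := Matrix.exists_mulVec_eq_zero_iff.2 h0
    rw [hGx] at hGx0
    -- The quadratic form is a sum of squares.
    have hsq : (rels.map fun r => (r ⬝ᵥ x) ^ 2).sum = 0 := by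
      have : ((rels.map fun r => (r ⬝ᵥ x) • r).sum ⬝ᵥ x) = 0 := by rw [hGx0, zero_dotProduct]
      rw [← this]
      clear this hGx0 hGx h hG
      clear_value G
      induction rels with
      | nil => simp
      | cons r rels ih =>
        simp only [List.map_cons, List.sum_cons, add_dotProduct, ih, smul_dotProduct, smul_eq_mul,
          sq (r ⬝ᵥ x)]
    have hall : ∀ r ∈ rels, r ⬝ᵥ x = 0 := by
      intro r hr
      have h1 : (r ⬝ᵥ x) ^ 2 ≤ (rels.map fun r => (r ⬝ᵥ x) ^ 2).sum :=
        List.single_le_sum (by simp; intros; positivity) _ (List.mem_map.2 ⟨r, hr, rfl⟩)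
      rw [hsq] at h1
      exact pow_eq_zero_iff (two_ne_zero) |>.1 (le_antisymm h1 (sq_nonneg _))
    have hcl : ∀ v ∈ AddSubgroup.closure {r | r ∈ rels}, v ⬝ᵥ x = 0 := by
      intro v hv
      induction hv using AddSubgroup.closure_induction with
      | mem v hv => exact hall v hv
      | zero => exact zero_dotProduct _
      | add a b _ _ ha hb => rw [add_dotProduct, ha, hb, add_zero]
      | neg a _ ha => rw [neg_dotProduct, ha, neg_zero]
    refine hx (funext fun i => ?_)
    have := hcl _ (h (Pi.single i 1))
    rw [smul_dotProduct, single_dotProduct, one_mul, smul_eq_mul] at this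
    exact (mul_eq_zero.1 this).resolve_left (by positivity)
  refine ⟨by simpa using hdet, fun v => ?_⟩
  have h1 : G.det • v ∈ AddSubgroup.closure {r | r ∈ rels} := by
    have : G.mulVec (G.adjugate.mulVec v) = G.det • v := by
      rw [Matrix.mulVec_mulVec, Matrix.mul_adjugate, Matrix.smul_mulVec, Matrix.one_mulVec]
    rw [← this, hGx]
    refine AddSubgroup.list_sum_mem _ fun y hy => ?_
    obtain ⟨r, hr, rfl⟩ := List.mem_map.1 hy
    exact AddSubgroup.zsmul_mem _ (AddSubgroup.subset_closure (k := {r | r ∈ rels}) hr) _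
  rcases Int.natAbs_eq G.det with h2 | h2
  · rw [← h2]; exact h1
  · have h3 : ((G.det.natAbs : ℕ) : ℤ) = -G.det := by omega
    rw [h3, neg_smul]
    exact neg_mem h1

/-! ### Ring arithmetic and ideals -/

/-- The data needed to calculate in a ring: a multiple `N` of the exponent of its additive group,
the indices of the generators, the relations between them, and the structure constants. -/
structure RingData where
  N : ℕ
  ix : List ℕ
  rels : List (List ℤ)
  tab : List (List (List ℤ))

instance : Encoding RingData := ⟨fun d => Encoding.enc (d.N, d.ix, d.rels, d.tab)⟩

theorem polyTime_toProd : PolyTime (fun d : RingData => (d.N, d.ix, d.rels, d.tab)) :=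
  PolyTime.id.of_enc_eq fun _ => rfl

@[fun_prop]
theorem polyTime_N : PolyTime (fun d : RingData => d.N) := PolyTime.fst.comp polyTime_toProd

@[fun_prop]
theorem polyTime_ix : PolyTime (fun d : RingData => d.ix) :=
  (PolyTime.fst.comp PolyTime.snd).comp polyTime_toProd

@[fun_prop]
theorem polyTime_rels : PolyTime (fun d : RingData => d.rels) :=
  (PolyTime.fst.comp (PolyTime.snd.comp PolyTime.snd)).comp polyTime_toProd

@[fun_prop]
theorem polyTime_tab : PolyTime (fun d : RingData => d.tab) :=
  (PolyTime.snd.comp (PolyTime.snd.comp PolyTime.snd)).comp polyTime_toProd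

@[fun_prop]
theorem polyTime_ringData {α : Type} [Encoding α] {N : α → ℕ} {ix : α → List ℕ}
    {rels : α → List (List ℤ)} {tab : α → List (List (List ℤ))} (hN : PolyTime N)
    (hix : PolyTime ix) (hrels : PolyTime rels) (htab : PolyTime tab) :
    PolyTime (fun a => RingData.mk (N a) (ix a) (rels a) (tab a)) := by
  have : PolyTime (fun a => (N a, ix a, rels a, tab a)) := by fun_prop
  exact this.of_enc_eq fun _ => rfl

/-- The product of two ring elements. -/
def mulv (d : RingData) (u v : List ℤ) : List ℤ :=
  d.ix.map fun k => md d.N (d.ix.map fun i => (d.ix.map fun j =>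
    gz u i * gz v j * gz (gv (gm d.tab i) j) k).sum).sum

@[fun_prop]
theorem polyTime_mulv : PolyTime (fun p : RingData × List ℤ × List ℤ => mulv p.1 p.2.1 p.2.2) := by
  unfold mulv; fun_prop

theorem sz_mulv_le (d : RingData) (u v : List ℤ) : sz (mulv d u v) ≤ bdSize d.N d.ix :=
  (bd_map_md _ _ _).sz_le

/-- The coordinate vector of the generator with the given index. -/
def unitVec (ix : List ℕ) (j : ℕ) : List ℤ := ix.map fun i => bif i == j then 1 else 0

@[fun_prop]
theorem polyTime_unitVec : PolyTime (fun p : List ℕ × ℕ => unitVec p.1 p.2) := by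
  unfold unitVec; fun_prop

/-- One step of the repeated squaring for `y * b ^ c`; the state is `(b, c, y)`. -/
def powStep (d : RingData) (s : List ℤ × ℕ × List ℤ) : List ℤ × ℕ × List ℤ :=
  (mulv d s.1 s.1, s.2.1 / 2, bif s.2.1 % 2 == 1 then mulv d s.2.2 s.1 else s.2.2)

/-- The ring element `y * b ^ c`, for `0 ≤ c ≤ N`. -/
def powMul (d : RingData) (y b : List ℤ) (c : ℤ) : List ℤ :=
  ((bits d.N).foldl (fun s _ => powStep d s) (b, c.toNat, y)).2.2

theorem sz_powMul_le (d : RingData) (y b : List ℤ) (c : ℤ) :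
    sz (powMul d y b c) ≤ sz y + bdSize d.N d.ix := by
  have : ∀ (l : List ℕ) (s : List ℤ × ℕ × List ℤ),
      sz (l.foldl (fun s _ => powStep d s) s).2.2 ≤ sz s.2.2 + bdSize d.N d.ix := by
    intro l
    induction l using List.reverseRecOn with
    | nil => intro s; simp
    | append_singleton l x ih =>
      intro s
      rw [List.foldl_append, List.foldl_cons, List.foldl_nil, powStep]
      cases (l.foldl (fun s _ => powStep d s) s).2.1 % 2 == 1
      · exact ih s
      · exact (sz_mulv_le d _ _).trans (Nat.le_add_left _ _)
  exact this _ _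

@[fun_prop]
theorem polyTime_powMul : PolyTime (fun p : RingData × List ℤ × List ℤ × ℤ =>
    powMul p.1 p.2.1 p.2.2.1 p.2.2.2) := by
  unfold powMul
  refine (PolyTime.snd.comp PolyTime.snd).comp (.foldl_add (by fun_prop) (by fun_prop)
    (by unfold powStep; fun_prop) (fun p => 2 * bdSize p.1.N p.1.ix) (by fun_prop)
    fun p s x _ => ?_)
  have h1 := sz_mulv_le p.1 s.1 s.1
  have h2 := sz_mulv_le p.1 s.2.2 s.1
  have h3 : sz (s.2.1 / 2) ≤ sz s.2.1 :=
    Nat.add_le_add_right (natSize_le_size_of_le (Nat.div_le_self _ _)) 1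
  unfold powStep
  simp only [sz_prod]
  cases s.2.1 % 2 == 1 <;> simp only [cond_true, cond_false] <;> omega

/-- The ring element `y * ∏ i, S i ^ c i`. -/
def mulProd (d : RingData) (y : List ℤ) (S : List (List ℤ)) (c : List ℤ) : List ℤ :=
  d.ix.foldl (fun y i => powMul d y (gv S i) (gz c i)) y

@[fun_prop]
theorem polyTime_mulProd : PolyTime (fun p : RingData × List ℤ × List (List ℤ) × List ℤ =>
    mulProd p.1 p.2.1 p.2.2.1 p.2.2.2) := by
  unfold mulProd
  exact .foldl_add (by fun_prop) (by fun_prop) (by fun_prop) (fun p => bdSize p.1.N p.1.ix)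
    (by fun_prop) fun p s x _ => sz_powMul_le _ _ _ _

/-- An element `u` with `e j * u = e j`. -/
def localOne (d : RingData) (j : ℕ) : List ℤ :=
  (coef d.N d.ix d.ix (relLat d.N d.ix d.ix d.rels (gm d.tab j)) (unitVec d.ix j)).2

@[fun_prop]
theorem polyTime_localOne : PolyTime (fun p : RingData × ℕ => localOne p.1 p.2) := by
  unfold localOne; fun_prop

/-- The element `u + v - u * v`, in other words `1 - (1 - u) * (1 - v)`. -/
def circ (d : RingData) (u v : List ℤ) : List ℤ :=
  d.ix.map fun i => md d.N (gz u i + gz v i - gz (mulv d u v) i)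

@[fun_prop]
theorem polyTime_circ : PolyTime (fun p : RingData × List ℤ × List ℤ => circ p.1 p.2.1 p.2.2) := by
  unfold circ; fun_prop

/-- The coordinate vector of `1`. -/
def oneVec (d : RingData) : List ℤ :=
  d.ix.foldl (fun u j => circ d u (localOne d j)) []

@[fun_prop]
theorem polyTime_oneVec : PolyTime oneVec := by
  unfold oneVec
  exact .foldl_add (by fun_prop) (by fun_prop) (by fun_prop) (fun d => bdSize d.N d.ix)
    (by fun_prop) fun d s x _ => ((bd_map_md _ _ _).sz_le).trans (Nat.le_add_left _ _)

/-- A triangular basis for the ideal with the given generators. -/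
def idealBasis (d : RingData) (gens : List (List ℤ)) : List (List ℤ) :=
  tri d.N d.ix (d.rels ++ (gens.map fun g => d.ix.map fun j => mulv d (unitVec d.ix j) g).flatten)

@[fun_prop]
theorem polyTime_idealBasis : PolyTime (fun p : RingData × List (List ℤ) =>
    idealBasis p.1 p.2) := by
  unfold idealBasis; fun_prop

/-- A triangular basis for the square of the ideal with the given basis. -/
def squareBasis (d : RingData) (B : List (List ℤ)) : List (List ℤ) :=
  tri d.N d.ix (d.rels ++ (d.ix.map fun i => d.ix.map fun j => mulv d (gv B i) (gv B j)).flatten)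

@[fun_prop]
theorem polyTime_squareBasis : PolyTime (fun p : RingData × List (List ℤ) =>
    squareBasis p.1 p.2) := by
  unfold squareBasis; fun_prop

/-- Indices for the layers: their number is `n` times the binary length of `N`. -/
def layerIx (d : RingData) : List ℕ := indices (d.ix.map fun _ => bits d.N).flatten

@[fun_prop]
theorem polyTime_layerIx : PolyTime layerIx := by
  unfold layerIx; fun_prop

/-- Bases of the ideals `I ^ 2 ^ k`, for `k` up to the number of layers. -/
def idealBases (d : RingData) (gens : List (List ℤ)) : List (List (List ℤ)) :=
  ((layerIx d).foldl (fun s _ => (squareBasis d s.1, s.2 ++ [squareBasis d s.1]))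
    (idealBasis d gens, [idealBasis d gens])).2

@[fun_prop]
theorem polyTime_idealBases : PolyTime (fun p : RingData × List (List ℤ) =>
    idealBases p.1 p.2) := by
  unfold idealBases
  have h : PolyBdd (fun p : RingData × List (List ℤ) =>
      p.1.ix.length * (bdSize p.1.N p.1.ix + 1) + 1) := by
    have : PolyTime (fun p : RingData × List (List ℤ) => p.1.ix) := by fun_prop
    have h1 := this.polyBdd_sz.mono fun a => length_le_sz a.1.ix
    fun_prop
  refine PolyTime.snd.comp (.foldl_add (by fun_prop) (by fun_prop) (by fun_prop)
    (fun p => 2 * (p.1.ix.length * (bdSize p.1.N p.1.ix + 1) + 1) + 1) (by fun_prop)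
    fun p s x _ => ?_)
  have h1 : sz (squareBasis p.1 s.1) ≤ _ := sz_tri_le _ _ _
  have h2 := sz_append s.2 [squareBasis p.1 s.1]
  rw [sz_cons, sz_nil] at h2
  simp only [sz_prod]
  omega

/-! ### The filtration of `1 + I` and discrete logarithms -/

/-- The filtration of the group `1 + I` by the groups `1 + I ^ 2 ^ k`: the ring, the indices `k`,
the coordinate vector of `1`, for every `k` the elements `1 + b` where `b` runs through a basis of
`I ^ 2 ^ k`, and for every `k` the triangular basis for the linear relations between the `b` modulo
the next ideal. -/
structure Filtr where
  ring : RingData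
  ixm : List ℕ
  one : List ℤ
  gen : List (List (List ℤ))
  tris : List (List (List ℤ))

instance : Encoding Filtr := ⟨fun F => Encoding.enc (F.ring, F.ixm, F.one, F.gen, F.tris)⟩

theorem polyTime_filtr_toProd :
    PolyTime (fun F : Filtr => (F.ring, F.ixm, F.one, F.gen, F.tris)) :=
  PolyTime.id.of_enc_eq fun _ => rfl

@[fun_prop]
theorem polyTime_ring : PolyTime (fun F : Filtr => F.ring) :=
  PolyTime.fst.comp polyTime_filtr_toProd

@[fun_prop]
theorem polyTime_ixm : PolyTime (fun F : Filtr => F.ixm) :=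
  (PolyTime.fst.comp PolyTime.snd).comp polyTime_filtr_toProd

@[fun_prop]
theorem polyTime_one : PolyTime (fun F : Filtr => F.one) :=
  (PolyTime.fst.comp (PolyTime.snd.comp PolyTime.snd)).comp polyTime_filtr_toProd

@[fun_prop]
theorem polyTime_gen : PolyTime (fun F : Filtr => F.gen) :=
  (PolyTime.fst.comp (PolyTime.snd.comp (PolyTime.snd.comp PolyTime.snd))).comp
    polyTime_filtr_toProd

@[fun_prop]
theorem polyTime_tris : PolyTime (fun F : Filtr => F.tris) :=
  (PolyTime.snd.comp (PolyTime.snd.comp (PolyTime.snd.comp PolyTime.snd))).comp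
    polyTime_filtr_toProd

/-- The sum of two vectors modulo `N`. -/
def addv (d : RingData) (u v : List ℤ) : List ℤ := d.ix.map fun i => md d.N (gz u i + gz v i)

@[fun_prop]
theorem polyTime_addv : PolyTime (fun p : RingData × List ℤ × List ℤ => addv p.1 p.2.1 p.2.2) := by
  unfold addv; fun_prop

/-- The difference of two vectors modulo `N`. -/
def subv (d : RingData) (u v : List ℤ) : List ℤ := d.ix.map fun i => md d.N (gz u i - gz v i)

@[fun_prop]
theorem polyTime_subv : PolyTime (fun p : RingData × List ℤ × List ℤ => subv p.1 p.2.1 p.2.2) := by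
  unfold subv; fun_prop

/-- The filtration of `1 + I`, where `I` is given by generators. -/
def filtr (d : RingData) (gens : List (List ℤ)) : Filtr where
  ring := d
  ixm := layerIx d
  one := oneVec d
  gen := (layerIx d).map fun k => d.ix.map fun i =>
    addv d (oneVec d) (gv (gm (idealBases d gens) k) i)
  tris := (layerIx d).map fun k => relLat d.N d.ix d.ix (gm (idealBases d gens) (k + 1))
    (gm (idealBases d gens) k)

@[fun_prop]
theorem polyTime_filtr : PolyTime (fun p : RingData × List (List ℤ) => filtr p.1 p.2) := by
  have : PolyTime (fun p : RingData × List (List ℤ) =>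
      (p.1, layerIx p.1, oneVec p.1, (layerIx p.1).map (fun k => p.1.ix.map fun i =>
        addv p.1 (oneVec p.1) (gv (gm (idealBases p.1 p.2) k) i)),
      (layerIx p.1).map fun k => relLat p.1.N p.1.ix p.1.ix (gm (idealBases p.1 p.2) (k + 1))
        (gm (idealBases p.1 p.2) k))) := by fun_prop
  exact this.of_enc_eq fun _ => rfl

/-- The exponents for layer `k` that move `y` to the next layer, if `k₀ ≤ k`, and zeros if not. -/
def layerLog (F : Filtr) (k₀ k : ℕ) (y : List ℤ) : List ℤ :=
  bif leb k₀ k then (coef F.ring.N F.ring.ix F.ring.ix (gm F.tris k) (subv F.ring F.one y)).2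
  else F.ring.ix.map fun _ => 0

@[fun_prop]
theorem polyTime_layerLog : PolyTime (fun p : Filtr × ℕ × ℕ × List ℤ =>
    layerLog p.1 p.2.1 p.2.2.1 p.2.2.2) := by
  unfold layerLog; fun_prop

/-- The exponents of generators from the layers `k ≥ k₀` whose product with `y` is `1`. -/
def dlog (F : Filtr) (k₀ : ℕ) (y : List ℤ) : List (List ℤ) :=
  (F.ixm.foldl (fun s k => (mulProd F.ring s.1 (gm F.gen k) (layerLog F k₀ k s.1),
    s.2 ++ [layerLog F k₀ k s.1])) (y, ([] : List (List ℤ)))).2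

theorem sz_mulProd_le (d : RingData) (y : List ℤ) (S : List (List ℤ)) (c : List ℤ) :
    sz (mulProd d y S c) ≤ sz y + d.ix.length * bdSize d.N d.ix := by
  unfold mulProd
  generalize hb : bdSize d.N d.ix = b
  induction d.ix generalizing y with
  | nil => simp
  | cons i l ih =>
    rw [List.foldl_cons, List.length_cons, add_mul]
    have h1 := ih (powMul d y (gv S i) (gz c i))
    have h2 := sz_powMul_le d y (gv S i) (gz c i)
    omega

theorem sz_layerLog_le (F : Filtr) (k₀ k : ℕ) (y : List ℤ) :
    sz (layerLog F k₀ k y) ≤ bdSize F.ring.N F.ring.ix := by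
  unfold layerLog
  cases leb k₀ k
  · refine Bd.sz_le ⟨by simp, fun x hx => ?_⟩
    obtain ⟨i, -, rfl⟩ := List.mem_map.1 hx
    simp
  · exact (bd_map_md _ _ _).sz_le

@[fun_prop]
theorem polyTime_dlog : PolyTime (fun p : Filtr × ℕ × List ℤ => dlog p.1 p.2.1 p.2.2) := by
  unfold dlog
  have h : PolyBdd (fun p : Filtr × ℕ × List ℤ => p.1.ring.ix.length) := by
    have : PolyTime (fun p : Filtr × ℕ × List ℤ => p.1.ring.ix) := by fun_prop
    exact this.polyBdd_sz.mono fun a => length_le_sz a.1.ring.ix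
  refine PolyTime.snd.comp (.foldl_add (by fun_prop) (by fun_prop) (by fun_prop)
    (fun p => p.1.ring.ix.length * bdSize p.1.ring.N p.1.ring.ix +
      bdSize p.1.ring.N p.1.ring.ix + 1) (by fun_prop) fun p s k _ => ?_)
  have h1 := sz_mulProd_le p.1.ring s.1 (gm p.1.gen k) (layerLog p.1 p.2.1 k s.1)
  have h2 := sz_layerLog_le p.1 p.2.1 k s.1
  have h3 := sz_append s.2 [layerLog p.1 p.2.1 k s.1]
  rw [sz_cons, sz_nil] at h3
  simp only [sz_prod]
  omega

/-- A matrix of exponents as a single vector. -/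
def flat (ixm ix : List ℕ) (C : List (List ℤ)) : List ℤ :=
  (ixm.map fun l => ix.map fun i => gz (gv C l) i).flatten

@[fun_prop]
theorem polyTime_flat : PolyTime (fun p : List ℕ × List ℕ × List (List ℤ) =>
    flat p.1 p.2.1 p.2.2) := by
  unfold flat; fun_prop

/-- The relation that starts with the exponents `r` in layer `k`. -/
def relMat (F : Filtr) (k : ℕ) (r : List ℤ) : List (List ℤ) :=
  F.ixm.map fun l => bif l == k then r
    else gv (dlog F (k + 1) (mulProd F.ring F.one (gm F.gen k) r)) l

@[fun_prop]
theorem polyTime_relMat : PolyTime (fun p : Filtr × ℕ × List ℤ => relMat p.1 p.2.1 p.2.2) := by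
  unfold relMat; fun_prop

/-- Defining relations, as matrices of exponents. -/
def relMats (F : Filtr) : List (List (List ℤ)) :=
  (F.ixm.map fun k => (kernelRows F.ring.ix F.ring.ix (gm F.tris k)).map fun r =>
    relMat F k r).flatten

@[fun_prop]
theorem polyTime_relMats : PolyTime relMats := by
  unfold relMats; fun_prop

/-- Defining relations as vectors. -/
def relVecs (F : Filtr) : List (List ℤ) := (relMats F).map fun C => flat F.ixm F.ring.ix C

@[fun_prop]
theorem polyTime_relVecs : PolyTime relVecs := by
  unfold relVecs; fun_prop

/-- The generators of all layers. -/
def genVecs (F : Filtr) : List (List ℤ) :=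
  (F.ixm.map fun k => F.ring.ix.map fun i =>
    F.ring.ix.map fun j => gz (gv (gm F.gen k) i) j).flatten

@[fun_prop]
theorem polyTime_genVecs : PolyTime genVecs := by
  unfold genVecs; fun_prop

/-- The `m`-th power of `N`, where `m` is the length of a list. -/
def powLen (N : ℕ) (l : List ℕ) : ℕ := l.foldl (fun s _ => s * N) 1

@[fun_prop]
theorem polyTime_powLen : PolyTime (fun p : ℕ × List ℕ => powLen p.1 p.2) := by
  unfold powLen
  refine .foldl_add (by fun_prop) (by fun_prop) (by fun_prop) (fun p => sz p.1) (by fun_prop)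
    fun p s x _ => ?_
  have := natSize_mul_le s p.1
  simp only [sz_nat]
  omega

/-! ### The two algorithms -/

/-- The data for calculations in the ring specified by relations and structure constants. -/
def ringData (rels : List (List ℤ)) (tab : List (List (List ℤ))) : RingData where
  N := (charConst (indices tab) (gram (indices tab) rels)).natAbs
  ix := indices tab
  rels := rels
  tab := tab

@[fun_prop]
theorem polyTime_ringData' : PolyTime (fun p : List (List ℤ) × List (List (List ℤ)) =>
    ringData p.1 p.2) := by
  unfold ringData; fun_prop

/-- Generators and defining relations for `1 + I`. -/
def presentation (p : (List (List ℤ) × List (List (List ℤ))) × List (List ℤ)) :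
    List (List ℤ) × List (List ℤ) :=
  (genVecs (filtr (ringData p.1.1 p.1.2) p.2), relVecs (filtr (ringData p.1.1 p.1.2) p.2))

theorem polyTime_presentation : PolyTime presentation := by
  unfold presentation; fun_prop

/-- The vector of exponents of `y` with respect to all generators, up to sign. -/
def dlogVec (F : Filtr) (y : List ℤ) : List ℤ := flat F.ixm F.ring.ix (dlog F 0 y)

@[fun_prop]
theorem polyTime_dlogVec : PolyTime (fun p : Filtr × List ℤ => dlogVec p.1 p.2) := by
  unfold dlogVec; fun_prop

/-- The coefficients of the exponent vector of `z` with respect to those of the `T`, modulo the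
defining relations, and whether there are any. -/
def logCoef (F : Filtr) (T : List (List ℤ)) (z : List ℤ) : Bool × List ℤ :=
  coef (powLen F.ring.N F.ixm) (indices (genVecs F)) (indices T)
    (relLat (powLen F.ring.N F.ixm) (indices (genVecs F)) (indices T) (relVecs F)
      (T.map fun t => dlogVec F t)) (dlogVec F z)

/-- Whether `z - 1` is an element of the ideal. -/
def memOnePlus (d : RingData) (gens : List (List ℤ)) (z : List ℤ) : Bool :=
  (redTri d.N d.ix d.ix (idealBasis d gens) (subv d z (oneVec d))).1

@[fun_prop]
theorem polyTime_memOnePlus : PolyTime (fun p : RingData × List (List ℤ) × List ℤ =>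
    memOnePlus p.1 p.2.1 p.2.2) := by
  unfold memOnePlus; fun_prop

/-- The discrete logarithm of `z` in the subgroup generated by `T`, if `z` is an element of it. -/
def discreteLog (d : RingData) (gens T : List (List ℤ)) (z : List ℤ) : Option (List ℤ) :=
  bif memOnePlus d gens z && (logCoef (filtr d gens) T z).1 then
    some (logCoef (filtr d gens) T z).2
  else none

theorem polyTime_discreteLog : PolyTime
    (fun p : ((List (List ℤ) × List (List (List ℤ))) × List (List ℤ)) × List (List ℤ) × List ℤ =>
      discreteLog (ringData p.1.1.1 p.1.1.2) p.1.2 p.2.1 p.2.2) := by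
  unfold discreteLog; fun_prop

/-! ### Correctness of the ring arithmetic -/

section Ring

variable {R : Type u} [CommRing R] {n : ℕ}

theorem lin_add (e : Fin n → R) (v w : Fin n → ℤ) : lin e (v + w) = lin e v + lin e w := by
  simp [lin, add_smul, Finset.sum_add_distrib]

theorem lin_zero (e : Fin n → R) : lin e 0 = 0 := by simp [lin]

/-- The map `lin e` as a homomorphism. -/
def linHom (e : Fin n → R) : (Fin n → ℤ) →+ R where
  toFun := lin e
  map_zero' := lin_zero e
  map_add' := lin_add e

theorem lin_sub (e : Fin n → R) (v w : Fin n → ℤ) : lin e (v - w) = lin e v - lin e w :=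
  map_sub (linHom e) v w

theorem lin_sum_smul {ι : Type*} (e : Fin n → R) (s : Finset ι) (c : ι → ℤ) (f : ι → Fin n → ℤ) :
    lin e (∑ i ∈ s, c i • f i) = ∑ i ∈ s, c i • lin e (f i) := by
  have : linHom e (∑ i ∈ s, c i • f i) = ∑ i ∈ s, c i • linHom e (f i) := by
    rw [map_sum]
    exact Finset.sum_congr rfl fun i _ => map_zsmul _ _ _
  exact this

theorem lin_single (e : Fin n → R) (i : Fin n) (c : ℤ) : lin e (Pi.single i c) = c • e i := by
  rw [lin, Finset.sum_eq_single i]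
  · simp
  · intro j _ hj; simp [hj]
  · simp

/-- The element of the ring with a given list of coordinates. -/
def ev (e : Fin n → R) (v : List ℤ) : R := lin e (tv n v)

/-- The data describe the ring with the additive generators `e`. -/
structure Models (d : RingData) (e : Fin n → R) : Prop where
  pos : 0 < d.N
  ix : d.ix = List.range n
  smul_eq_zero : ∀ x : R, (d.N : ℤ) • x = 0
  surjective : Function.Surjective (lin e)
  rels : ∀ v : Fin n → ℤ, lin e v = 0 ↔ v ∈ AddSubgroup.closure {w | ∃ r ∈ d.rels, w = tv n r}
  mul : ∀ i j : Fin n, e i * e j = ev e (gv (gm d.tab i) j)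

variable {d : RingData} {e : Fin n → R}

/-- The rows of `B` are a basis of the inverse image of the ideal `J` in the lattice of all
coordinate vectors. This inverse image contains the multiples of `N`. -/
structure IsBasis (d : RingData) (e : Fin n → R) (B : List (List ℤ)) (J : Ideal R) : Prop where
  mem_rowLat : ∀ v, v ∈ rowLat n B ↔ lin e v ∈ J
  mem_modLat : ∀ v, v ∈ modLat d.N n B ↔ lin e v ∈ J

theorem IsBasis.ev_mem {B : List (List ℤ)} {J : Ideal R} (hB : IsBasis d e B J) (i : Fin n) :
    ev e (gv B i) ∈ J :=
  (hB.mem_rowLat _).1 (rowLat_le.1 le_rfl i i.2)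

variable (h : Models d e)

include h

theorem Models.md_smul (x : ℤ) (r : R) : md d.N x • r = x • r := by
  obtain ⟨c, hc⟩ := dvd_sub_md h.pos x
  have : x = md d.N x + c * d.N := by linarith
  conv_rhs => rw [this, add_smul, mul_smul, h.smul_eq_zero, smul_zero, add_zero]

theorem Models.ev_map_md (f : ℕ → ℤ) :
    ev e (d.ix.map fun i => md d.N (f i)) = ∑ i : Fin n, f i • e i := by
  rw [ev, h.ix, tv_map_range, lin]
  exact Finset.sum_congr rfl fun i _ => h.md_smul _ _

theorem Models.ev_addv (u v : List ℤ) : ev e (addv d u v) = ev e u + ev e v := by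
  rw [addv, h.ev_map_md, ev, ev, ← lin_add]
  rfl

theorem Models.ev_subv (u v : List ℤ) : ev e (subv d u v) = ev e u - ev e v := by
  rw [subv, h.ev_map_md, ev, ev, ← lin_sub]
  rfl

theorem Models.ev_mulv (u v : List ℤ) : ev e (mulv d u v) = ev e u * ev e v := by
  have h1 : ev e u * ev e v = ∑ i : Fin n, ∑ j : Fin n, (gz u i * gz v j) • (e i * e j) := by
    simp only [ev, lin, Finset.sum_mul_sum]
    refine Finset.sum_congr rfl fun i _ => Finset.sum_congr rfl fun j _ => ?_
    rw [smul_mul_smul_comm]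
    rfl
  rw [mulv, h.ev_map_md, h1]
  simp only [h.ix, sum_map_range, h.mul, ev, lin, Finset.smul_sum, Finset.sum_smul, mul_smul]
  rw [Finset.sum_comm]
  refine Finset.sum_congr rfl fun i _ => ?_
  rw [Finset.sum_comm]
  rfl

theorem Models.ev_unitVec (j : Fin n) : ev e (unitVec d.ix j) = e j := by
  have : tv n (unitVec d.ix j) = Pi.single j 1 := by
    ext i
    rw [tv_apply, unitVec, h.ix, gz_map_range i.2, Pi.single_apply, cond_eq_ite]
    simp [Fin.ext_iff]
  rw [ev, this, lin_single, one_smul]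

theorem Models.mem_modLat_rels (v : Fin n → ℤ) : v ∈ modLat d.N n d.rels ↔ lin e v = 0 := by
  constructor
  · refine fun hv => (modLat_le.2 ⟨fun w hw => ?_, fun j => ?_⟩ : _ ≤ (linHom e).ker) hv
    · exact (h.rels _).2 (AddSubgroup.subset_closure ⟨w, hw, rfl⟩)
    · change lin e _ = 0
      rw [lin_single, h.smul_eq_zero]
  · intro hv
    refine AddSubgroup.closure_mono ?_ ((h.rels v).1 hv)
    exact Set.subset_union_left

/-- There is an element with `e j * u = e j`, namely `1`, so solving this linear equation succeeds.
-/
theorem Models.mul_ev_localOne (j : Fin n) : e j * ev e (localOne d j) = e j := by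
  have key : ∀ m : Fin n → ℤ,
      lin e (tv n (unitVec d.ix j) - ∑ t, m t • tv n (gv (gm d.tab j) t)) =
        e j - e j * lin e m := by
    intro m
    rw [lin_sub, lin_sum_smul, ← ev, h.ev_unitVec, lin, Finset.mul_sum]
    congr 1
    refine Finset.sum_congr rfl fun t _ => ?_
    rw [← ev, ← h.mul, mul_smul_comm]
  obtain ⟨m, hm⟩ := h.surjective 1
  have h1 := coef_complete h.pos d.rels (gm d.tab j) (z := unitVec d.ix j) m
    (by rw [h.mem_modLat_rels, key, hm, mul_one, sub_self])
  have h2 := coef_sound h.pos d.rels (gm d.tab j) h1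
  rw [h.mem_modLat_rels, ← h.ix] at h2
  have h3 := key (tv n (localOne d j))
  simp only [tv_apply] at h3
  rw [localOne, h2] at h3
  exact (sub_eq_zero.1 h3.symm).symm

theorem Models.ev_circ (u v : List ℤ) :
    ev e (circ d u v) = ev e u + ev e v - ev e u * ev e v := by
  rw [circ, h.ev_map_md, ← h.ev_mulv, ev, ev, ev, ← lin_add, ← lin_sub]
  rfl

/-- The product of the `1 - u j`, where `e j * u j = e j`, annihilates all generators, so it is `0`.
-/
theorem Models.ev_oneVec : ev e (oneVec d) = 1 := by
  have key : ∀ k ≤ n, ∀ j : Fin n, (j : ℕ) < k → e j * (1 - ev e ((List.range k).foldl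
      (fun u j => circ d u (localOne d j)) [])) = 0 := by
    intro k
    induction k with
    | zero => intro _ j hj; omega
    | succ k ih =>
      intro hk j hj
      rw [List.range_succ, List.foldl_append, List.foldl_cons, List.foldl_nil, h.ev_circ]
      set u := ev e ((List.range k).foldl (fun u j => circ d u (localOne d j)) []) with hu
      have e1 : e j * (1 - (u + ev e (localOne d k) - u * ev e (localOne d k))) =
          e j * (1 - u) * (1 - ev e (localOne d k)) := by ring
      rw [e1]
      rcases Nat.lt_succ_iff_lt_or_eq.1 hj with hj | rfl
      · rw [ih (by omega) j hj, zero_mul]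
      · have := h.mul_ev_localOne j
        linear_combination (u - 1) * this
  have h0 := key n le_rfl
  obtain ⟨m, hm⟩ := h.surjective 1
  rw [oneVec, h.ix]
  set u := ev e ((List.range n).foldl (fun u j => circ d u (localOne d j)) [])
  have : lin e m * (1 - u) = 0 := by
    rw [lin, Finset.sum_mul]
    refine Finset.sum_eq_zero fun i _ => ?_
    rw [smul_mul_assoc, h0 i i.2, smul_zero]
  rw [hm, one_mul] at this
  exact (sub_eq_zero.1 this).symm

/-- The repeated squaring has enough steps for every exponent up to `N`. -/
theorem Models.ev_powMul (y b : List ℤ) {c : ℤ} (hc : c ≤ d.N) :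
    ev e (powMul d y b c) = ev e y * ev e b ^ c.toNat := by
  have key : ∀ (l : List ℕ) (s : List ℤ × ℕ × List ℤ), s.2.1 < 2 ^ l.length →
      ev e (l.foldl (fun s _ => powStep d s) s).2.2 = ev e s.2.2 * ev e s.1 ^ s.2.1 := by
    intro l
    induction l with
    | nil =>
      intro s hs
      have : s.2.1 = 0 := by simpa using hs
      simp [this]
    | cons x l ih =>
      intro s hs
      rw [List.length_cons, pow_succ] at hs
      rw [List.foldl_cons, ih _ (by change s.2.1 / 2 < _; omega)]
      have e1 : ev e (powStep d s).2.2 = ev e s.2.2 * ev e s.1 ^ (s.2.1 % 2) := by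
        unfold powStep
        rcases Nat.mod_two_eq_zero_or_one s.2.1 with h0 | h0
        · simp [h0]
        · simp [h0, h.ev_mulv]
      rw [e1]
      change _ * ev e (mulv d s.1 s.1) ^ (s.2.1 / 2) = _
      rw [h.ev_mulv, ← sq, ← pow_mul, mul_assoc, ← pow_add]
      congr 2
      omega
  refine key _ _ ?_
  rw [bits, List.length_replicate]
  have := Nat.lt_size_self d.N
  change c.toNat < _
  omega

theorem Models.ev_mulProd (y : List ℤ) (S : List (List ℤ)) (c : List ℤ) (s : Fin n → Rˣ)
    (hs : ∀ i : Fin n, (s i : R) = ev e (gv S i)) (hc : ∀ i, 0 ≤ gz c i ∧ gz c i ≤ d.N) :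
    ev e (mulProd d y S c) = ev e y * ((∏ i, s i ^ tv n c i : Rˣ) : R) := by
  have key :
      ∀ k (hk : k ≤ n), ev e ((List.range k).foldl (fun y i => powMul d y (gv S i) (gz c i)) y)
      = ev e y * ((∏ i : Fin k, s (Fin.castLE hk i) ^ gz c i : Rˣ) : R) := by
    intro k
    induction k with
    | zero => intro _; simp
    | succ k ih =>
      intro hk
      rw [List.range_succ, List.foldl_append, List.foldl_cons, List.foldl_nil,
        h.ev_powMul _ _ (hc k).2, ih (by omega), Fin.prod_univ_castSucc, Units.val_mul, mul_assoc]
      congr 2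
      have h1 := hs ⟨k, hk⟩
      obtain ⟨m, hm⟩ := Int.eq_ofNat_of_zero_le (hc k).1
      rw [Fin.val_last, hm, zpow_natCast, Units.val_pow_eq_pow_val, Int.toNat_natCast, ← h1]
      rfl
  rw [mulProd, h.ix, key n le_rfl]
  rfl

/-- The triangular basis for the relations and for additive generators of an ideal. -/
theorem Models.isBasis_tri {W : List (List ℤ)} {J : Ideal R} (hW : ∀ r ∈ d.rels, r ∈ W)
    (hJ : AddSubgroup.closure {x | ∃ w ∈ W, x = ev e w} = J.toAddSubgroup) :
    IsBasis d e (tri d.N d.ix W) J := by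
  have h1 : ∀ v, v ∈ modLat d.N n W ↔ lin e v ∈ J := by
    intro v
    constructor
    · refine fun hv => (modLat_le.2 ⟨fun w hw => ?_, fun j => ?_⟩ :
        _ ≤ J.toAddSubgroup.comap (linHom e)) hv
      · rw [← hJ, AddSubgroup.mem_comap]
        exact AddSubgroup.subset_closure ⟨w, hw, rfl⟩
      · change lin e _ ∈ J
        rw [lin_single, h.smul_eq_zero]
        exact J.zero_mem
    · intro hv
      have h2 : lin e v ∈ AddSubgroup.map (linHom e)
          (AddSubgroup.closure {x | ∃ w ∈ W, x = tv n w}) := by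
        rw [AddMonoidHom.map_closure]
        have h3 : lin e v ∈ J.toAddSubgroup := hv
        rw [← hJ] at h3
        convert! h3 using 2
        ext x
        constructor
        · rintro ⟨_, ⟨w, hw, rfl⟩, rfl⟩
          exact ⟨w, hw, rfl⟩
        · rintro ⟨w, hw, rfl⟩
          exact ⟨_, ⟨w, hw, rfl⟩, rfl⟩
      obtain ⟨v', hv', he⟩ := h2
      change lin e v' = lin e v at he
      have h4 : v' ∈ modLat d.N n W := AddSubgroup.closure_mono Set.subset_union_left hv'
      have h5 : v - v' ∈ modLat d.N n d.rels := by
        rw [h.mem_modLat_rels, lin_sub, he, sub_self]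
      have h6 : modLat d.N n d.rels ≤ modLat d.N n W :=
        modLat_le.2 ⟨fun w hw => (modLat_le.1 le_rfl).1 w (hW w hw), (modLat_le.1 le_rfl).2⟩
      simpa using add_mem (h6 h5) h4
  have h2 : rowLat n (tri d.N d.ix W) = modLat d.N n W := by
    rw [h.ix]; exact rowLat_tri h.pos W
  have h3 : modLat d.N n (tri d.N d.ix W) = modLat d.N n W := by
    refine le_antisymm (modLat_le.2 ⟨fun w hw => ?_, (modLat_le.1 le_rfl).2⟩) ?_
    · rw [← h2]
      obtain ⟨i, hi, rfl⟩ := List.mem_iff_getElem.1 hw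
      have hT : IsTri d.N n (tri d.N d.ix W) := by rw [h.ix]; exact (tri_spec h.pos W).1
      have := rowLat_le.1 (le_refl (rowLat n (tri d.N d.ix W))) i (hT.length ▸ hi)
      simpa [gv, List.getD, hi] using this
    · rw [← h2, rowLat_le]
      intro i hi
      have hT : IsTri d.N n (tri d.N d.ix W) := by rw [h.ix]; exact (tri_spec h.pos W).1
      refine (modLat_le.1 le_rfl).1 _ ?_
      rw [← hT.length] at hi
      simp [gv, List.getD, hi]
  exact ⟨fun v => by rw [h2, h1], fun v => by rw [h3, h1]⟩

theorem Models.isBasis_idealBasis {gens : List (List ℤ)} {J : Ideal R}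
    (hJ : J = Ideal.span {x | ∃ g ∈ gens, x = ev e g}) :
    IsBasis d e (idealBasis d gens) J := by
  refine h.isBasis_tri (fun r hr => List.mem_append.2 (.inl hr)) (le_antisymm ?_ ?_)
  · rw [AddSubgroup.closure_le]
    rintro _ ⟨w, hw, rfl⟩
    rcases List.mem_append.1 hw with hw | hw
    · have : ev e w = 0 := (h.rels _).2 (AddSubgroup.subset_closure ⟨w, hw, rfl⟩)
      rw [this]
      exact J.zero_mem
    · obtain ⟨l, hl, hw⟩ := List.mem_flatten.1 hw
      obtain ⟨g, hg, rfl⟩ := List.mem_map.1 hl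
      obtain ⟨j, hj, rfl⟩ := List.mem_map.1 hw
      rw [h.ev_mulv]
      refine J.mul_mem_left _ ?_
      rw [hJ]
      exact Ideal.subset_span ⟨g, hg, rfl⟩
  · intro x hx
    replace hx : x ∈ J := hx
    rw [hJ] at hx
    induction hx using Submodule.closure_induction with
    | zero => exact zero_mem _
    | add x y _ _ hx hy => exact add_mem hx hy
    | smul_mem r x hx =>
      obtain ⟨g, hg, rfl⟩ := hx
      obtain ⟨m, rfl⟩ := h.surjective r
      rw [smul_eq_mul, lin, Finset.sum_mul]
      refine sum_mem fun j _ => ?_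
      rw [smul_mul_assoc]
      refine AddSubgroup.zsmul_mem _ (AddSubgroup.subset_closure ?_) _
      refine ⟨mulv d (unitVec d.ix j) g, List.mem_append.2 (.inr (List.mem_flatten.2
        ⟨_, List.mem_map.2 ⟨g, hg, rfl⟩, List.mem_map.2 ⟨j, ?_, rfl⟩⟩)), ?_⟩
      · rw [h.ix]; exact List.mem_range.2 j.2
      · rw [h.ev_mulv, h.ev_unitVec]

theorem IsBasis.exists_sum {B : List (List ℤ)} {J : Ideal R} (hB : IsBasis d e B J) {x : R}
    (hx : x ∈ J) : ∃ c : Fin n → ℤ, x = ∑ i : Fin n, c i • ev e (gv B i) := by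
  obtain ⟨v, rfl⟩ := h.surjective x
  obtain ⟨c, rfl⟩ := NilUnits.mem_rowLat.1 ((hB.mem_rowLat v).2 hx)
  exact ⟨c, lin_sum_smul e _ _ _⟩

theorem Models.isBasis_squareBasis {B : List (List ℤ)} {J : Ideal R} (hB : IsBasis d e B J) :
    IsBasis d e (squareBasis d B) (J * J) := by
  refine h.isBasis_tri (fun r hr => List.mem_append.2 (.inl hr)) (le_antisymm ?_ ?_)
  · rw [AddSubgroup.closure_le]
    rintro _ ⟨w, hw, rfl⟩
    rcases List.mem_append.1 hw with hw | hw
    · have : ev e w = 0 := (h.rels _).2 (AddSubgroup.subset_closure ⟨w, hw, rfl⟩)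
      rw [this]
      exact (J * J).zero_mem
    · obtain ⟨l, hl, hw⟩ := List.mem_flatten.1 hw
      obtain ⟨i, hi, rfl⟩ := List.mem_map.1 hl
      obtain ⟨j, hj, rfl⟩ := List.mem_map.1 hw
      rw [h.ix] at hi hj
      rw [h.ev_mulv]
      exact Ideal.mul_mem_mul (hB.ev_mem ⟨i, List.mem_range.1 hi⟩)
        (hB.ev_mem ⟨j, List.mem_range.1 hj⟩)
  · intro x hx
    replace hx : x ∈ J * J := hx
    induction hx using Submodule.mul_induction_on' with
    | add x _ y _ hx hy => exact add_mem hx hy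
    | mem_mul_mem x hx y hy =>
      obtain ⟨a, rfl⟩ := hB.exists_sum h hx
      obtain ⟨b, rfl⟩ := hB.exists_sum h hy
      rw [Finset.sum_mul_sum]
      refine sum_mem fun i _ => sum_mem fun j _ => ?_
      rw [smul_mul_smul_comm]
      refine AddSubgroup.zsmul_mem _ (AddSubgroup.subset_closure ?_) _
      refine ⟨mulv d (gv B i) (gv B j), List.mem_append.2 (.inr (List.mem_flatten.2
        ⟨_, List.mem_map.2 ⟨i, ?_, rfl⟩, List.mem_map.2 ⟨j, ?_, rfl⟩⟩)), ?_⟩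
      · rw [h.ix]; exact List.mem_range.2 i.2
      · rw [h.ix]; exact List.mem_range.2 j.2
      · rw [h.ev_mulv]

theorem Models.layerIx_eq : layerIx d = List.range (n * d.N.size) := by
  rw [layerIx, indices, h.ix]
  congr 1
  simp [bits]

theorem Models.isBasis_idealBases {gens : List (List ℤ)} {I : Ideal R}
    (hI : I = Ideal.span {x | ∃ g ∈ gens, x = ev e g}) {k : ℕ} (hk : k ≤ n * d.N.size) :
    IsBasis d e (gm (idealBases d gens) k) (I ^ 2 ^ k) := by
  have key : ∀ m, ∀ s, s = (List.range m).foldl (fun s _ => (squareBasis d s.1,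
      s.2 ++ [squareBasis d s.1])) (idealBasis d gens, [idealBasis d gens]) →
      s.2.length = m + 1 ∧ gm s.2 m = s.1 ∧ ∀ k ≤ m, IsBasis d e (gm s.2 k) (I ^ 2 ^ k) := by
    intro m
    induction m with
    | zero =>
      rintro _ rfl
      refine ⟨rfl, rfl, fun k hk => ?_⟩
      obtain rfl := Nat.le_zero.1 hk
      simpa [gm] using h.isBasis_idealBasis hI
    | succ m ih =>
      rintro _ rfl
      obtain ⟨h1, h2, h3⟩ := ih _ rfl
      rw [List.range_succ, List.foldl_append, List.foldl_cons, List.foldl_nil]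
      set s := (List.range m).foldl _ _ with hs
      clear_value s
      have e1 : gm (s.2 ++ [squareBasis d s.1]) (m + 1) = squareBasis d s.1 := by
        rw [← h1]; simp [gm, List.getD]
      refine ⟨by simp [h1], e1, fun k hk => ?_⟩
      rcases hk.eq_or_lt with rfl | hk
      · dsimp only
        rw [e1, pow_succ, pow_mul, sq, ← h2]
        exact h.isBasis_squareBasis (h3 m le_rfl)
      · have e2 : gm (s.2 ++ [squareBasis d s.1]) k = gm s.2 k := by
          simp [gm, List.getD, List.getElem?_append_left (show k < s.2.length by omega)]
        dsimp only
        rw [e2]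
        exact h3 k (by omega)
  rw [idealBases, h.layerIx_eq]
  exact (key _ _ rfl).2.2 k hk

theorem Models.card_le [Finite R] : Nat.card R ≤ d.N ^ n := by
  have : NeZero d.N := ⟨h.pos.ne'⟩
  have hs : Function.Surjective fun v : Fin n → Fin d.N => lin e fun i => ((v i : ℕ) : ℤ) := by
    intro x
    obtain ⟨v, rfl⟩ := h.surjective x
    have h0 : ∀ i, 0 ≤ md d.N (v i) := fun i => md_nonneg _ _
    refine ⟨fun i => ⟨(md d.N (v i)).toNat, ?_⟩, ?_⟩
    · have := md_lt h.pos (v i)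
      have := h0 i
      omega
    · simp only [lin]
      refine Finset.sum_congr rfl fun i _ => ?_
      rw [Int.toNat_of_nonneg (h0 i), h.md_smul]
  simpa using Nat.card_le_card_of_surjective _ hs

/-- The powers of `I` that are not zero strictly decrease, so squaring at least halves the number of
elements, which is `N ^ n` at most. -/
theorem Models.pow_eq_bot [Finite R] {I : Ideal R} (hI : IsNilpotent I) :
    I ^ 2 ^ (n * d.N.size) = ⊥ := by
  have key : ∀ k, I ^ 2 ^ k = ⊥ ∨ 2 ^ k * Nat.card (I ^ 2 ^ k : Ideal R) ≤ Nat.card R := by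
    intro k
    induction k with
    | zero =>
      right
      rw [pow_zero, one_mul]
      exact Nat.card_le_card_of_injective _ Subtype.val_injective
    | succ k ih =>
      rcases ih with ih | ih
      · left
        rw [pow_succ 2, pow_mul, ih]
        simp [sq]
      by_cases h0 : I ^ 2 ^ (k + 1) = ⊥
      · exact .inl h0
      right
      set J := I ^ 2 ^ k with hJ
      have e1 : I ^ 2 ^ (k + 1) = J * J := by rw [pow_succ, pow_mul, sq]
      rw [e1] at h0 ⊢
      have hle : J * J ≤ J := Ideal.mul_le_left
      have hne : J * J ≠ J := by
        intro hJJ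
        obtain ⟨m, hm⟩ := hI
        have h1 : ∀ t, J ^ (t + 1) = J := by
          intro t
          induction t with
          | zero => simp
          | succ t ih => rw [pow_succ, ih, hJJ]
        have h2 : J ^ (m + 1) = ⊥ := by
          rw [hJ, ← pow_mul, mul_comm, pow_mul, pow_succ, hm]
          simp
        rw [hJJ, ← h1 m, h2] at h0
        exact h0 rfl
      have h1 : Nat.card (J * J : Ideal R) ∣ Nat.card J :=
        AddSubgroup.card_dvd_of_le (H := (J * J).toAddSubgroup) (K := J.toAddSubgroup) hle
      have h2 : Nat.card (J * J : Ideal R) ≠ Nat.card J := by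
        intro hc
        refine hne (SetLike.coe_injective (Set.eq_of_subset_of_ncard_le hle ?_))
        exact hc.ge
      obtain ⟨c, hc⟩ := h1
      have hpos : 0 < Nat.card J := Nat.card_pos
      have hc2 : 2 ≤ c := by
        rcases c with _ | _ | c
        · omega
        · exact absurd (by simpa using hc.symm) h2
        · omega
      rw [hc] at ih
      rw [pow_succ, mul_assoc]
      refine le_trans ?_ ih
      rw [mul_comm (Nat.card _) c]
      gcongr
  rcases key (n * d.N.size) with hk | hk
  · exact hk
  · have h1 := hk.trans h.card_le
    have h2 : d.N ^ n ≤ 2 ^ (n * d.N.size) := by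
      rw [mul_comm, pow_mul]
      exact Nat.pow_le_pow_left (Nat.lt_size_self d.N).le n
    have h3 : Nat.card (I ^ 2 ^ (n * d.N.size) : Ideal R) ≤ 1 := by
      by_contra h4
      have : 2 ^ (n * d.N.size) * 2 ≤
          2 ^ (n * d.N.size) * Nat.card (I ^ 2 ^ (n * d.N.size) : Ideal R) := by
        gcongr; omega
      have : 0 < 2 ^ (n * d.N.size) := by positivity
      omega
    have : Subsingleton (I ^ 2 ^ (n * d.N.size) : Ideal R) :=
      (Finite.card_le_one_iff_subsingleton).1 h3
    exact Submodule.subsingleton_iff_eq_bot.1 this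

end Ring

/-! ### The layers of `1 + I` -/

section Group

variable {R : Type u} [CommRing R]

theorem mem_onePlus_iff {J : Ideal R} {w : Rˣ} : w ∈ onePlus J ↔ (w : R) - 1 ∈ J := by
  constructor
  · rintro ⟨x, hx, hw⟩
    rwa [hw, add_sub_cancel_left]
  · exact fun h => ⟨_, h, by ring⟩

theorem onePlus_mono {J K : Ideal R} (h : J ≤ K) : onePlus J ≤ onePlus K :=
  fun _ hw => mem_onePlus_iff.2 (h (mem_onePlus_iff.1 hw))

/-- The homomorphism `1 + x ↦ x` from `1 + J` to the additive group of `R ⧸ J ^ 2`. -/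
def layerHom (J : Ideal R) : onePlus J →* Multiplicative (R ⧸ (J * J)) where
  toFun w := Multiplicative.ofAdd (Ideal.Quotient.mk (J * J) (((w : Rˣ) : R) - 1))
  map_one' := by simp
  map_mul' a b := by
    rw [← ofAdd_add, ← map_add]
    congr 1
    refine Ideal.Quotient.eq.2 ?_
    have h := Ideal.mul_mem_mul (mem_onePlus_iff.1 a.2) (mem_onePlus_iff.1 b.2)
    convert! h using 1
    simp only [Subgroup.coe_mul, Units.val_mul]
    ring

/-- Modulo `J ^ 2`, a product of powers of elements `1 + x` is given by a linear combination of
the `x`. -/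
theorem prod_zpow_sub_mem {ι : Type*} [Fintype ι] {J : Ideal R} {s : ι → Rˣ}
    (hs : ∀ i, s i ∈ onePlus J) (c : ι → ℤ) :
    ((∏ i, s i ^ c i : Rˣ) : R) - 1 - ∑ i, c i • ((s i : R) - 1) ∈ J * J := by
  have h : layerHom J (∏ i, (⟨s i, hs i⟩ : onePlus J) ^ c i) =
      ∏ i, layerHom J ⟨s i, hs i⟩ ^ c i := by
    rw [map_prod]
    exact Finset.prod_congr rfl fun i _ => map_zpow _ _ _
  have h2 := congrArg Multiplicative.toAdd h
  rw [toAdd_prod] at h2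
  simp only [toAdd_zpow] at h2
  simp only [layerHom, MonoidHom.coe_mk, OneHom.coe_mk, toAdd_ofAdd] at h2
  rw [← Ideal.Quotient.eq]
  convert! h2 using 1
  · simp
  · rw [map_sum]
    exact Finset.sum_congr rfl fun i _ => map_zsmul _ _ _

/-- The homomorphism `layerHom` is injective modulo `1 + J ^ 2`, for products of powers. -/
theorem prod_zpow_mem_iff {ι : Type*} [Fintype ι] {J : Ideal R} {s : ι → Rˣ}
    (hs : ∀ i, s i ∈ onePlus J) (c : ι → ℤ) :
    ∏ i, s i ^ c i ∈ onePlus (J * J) ↔ ∑ i, c i • ((s i : R) - 1) ∈ J * J := by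
  rw [mem_onePlus_iff]
  have h := prod_zpow_sub_mem hs c
  constructor
  · intro h1
    simpa using sub_mem h1 h
  · intro h1
    simpa using add_mem h h1

theorem mul_prod_zpow_mem {ι : Type*} [Fintype ι] {J : Ideal R} {s : ι → Rˣ}
    (hs : ∀ i, s i ∈ onePlus J) (c : ι → ℤ) {y : Rˣ} (hy : y ∈ onePlus J)
    (h : 1 - (y : R) - ∑ i, c i • ((s i : R) - 1) ∈ J * J) :
    y * ∏ i, s i ^ c i ∈ onePlus (J * J) := by
  have h1 := prod_zpow_sub_mem hs c
  have h2 : ∏ i, s i ^ c i ∈ onePlus J :=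
    Subgroup.prod_mem _ fun i _ => Subgroup.zpow_mem _ (hs i) _
  have h3 := Ideal.mul_mem_mul (mem_onePlus_iff.1 hy) (mem_onePlus_iff.1 h2)
  rw [mem_onePlus_iff]
  convert! add_mem (sub_mem h1 h) h3 using 1
  rw [Units.val_mul]
  ring

variable {m n : ℕ}

/-- The product of the powers of a family of units. -/
def expProd (s : Fin m → Fin n → Rˣ) (b : Fin m → Fin n → ℤ) : Rˣ := ∏ k, ∏ i, s k i ^ b k i

theorem expProd_zero (s : Fin m → Fin n → Rˣ) : expProd s 0 = 1 := by simp [expProd]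

theorem expProd_add (s : Fin m → Fin n → Rˣ) (b c : Fin m → Fin n → ℤ) :
    expProd s (b + c) = expProd s b * expProd s c := by
  simp only [expProd, Pi.add_apply, zpow_add, Finset.prod_mul_distrib]

theorem expProd_neg (s : Fin m → Fin n → Rˣ) (b : Fin m → Fin n → ℤ) :
    expProd s (-b) = (expProd s b)⁻¹ := by
  simp only [expProd, Pi.neg_apply, zpow_neg, Finset.prod_inv_distrib]

theorem expProd_sub (s : Fin m → Fin n → Rˣ) (b c : Fin m → Fin n → ℤ) :
    expProd s (b - c) = expProd s b / expProd s c := by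
  rw [sub_eq_add_neg, expProd_add, expProd_neg, div_eq_mul_inv]

theorem expProd_single (s : Fin m → Fin n → Rˣ) (k : Fin m) (c : Fin n → ℤ) :
    expProd s (Pi.single k c) = ∏ i, s k i ^ c i := by
  rw [expProd, Finset.prod_eq_single k]
  · simp
  · intro l _ hl
    simp [hl]
  · simp

/-- If for every layer `k` there are relations without contribution from the earlier layers whose
parts in layer `k` generate the linear relations modulo the next ideal, then they are defining
relations. -/
theorem expProd_eq_one_iff {J : ℕ → Ideal R} (hJ : ∀ k, J (k + 1) = J k * J k)
    {s : Fin m → Fin n → Rˣ} (hs : ∀ (k : Fin m) (i : Fin n), s k i ∈ onePlus (J k))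
    (C : Fin m → Set (Fin n → ℤ))
    (hC : ∀ (k : Fin m) c, ∑ i, c i • ((s k i : R) - 1) ∈ J (k + 1) → c ∈ AddSubgroup.closure (C k))
    (rels : Set (Fin m → Fin n → ℤ)) (hrels : ∀ r ∈ rels, expProd s r = 1)
    (hlift : ∀ k, ∀ c ∈ C k, ∃ r ∈ rels, r k = c ∧ ∀ l < k, r l = 0) (b : Fin m → Fin n → ℤ) :
    expProd s b = 1 ↔ b ∈ AddSubgroup.closure rels := by
  have hcl : ∀ r ∈ AddSubgroup.closure rels, expProd s r = 1 := by
    intro r hr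
    induction hr using AddSubgroup.closure_induction with
    | mem r hr => exact hrels r hr
    | zero => exact expProd_zero s
    | add a b _ _ ha hb => rw [expProd_add, ha, hb, one_mul]
    | neg a _ ha => rw [expProd_neg, ha, inv_one]
  refine ⟨fun hb => ?_, hcl b⟩
  have hanti : Antitone J := antitone_nat_of_succ_le fun k => by
    rw [hJ]; exact Ideal.mul_le_left
  have hlift' : ∀ k, ∀ c ∈ AddSubgroup.closure (C k),
      ∃ r ∈ AddSubgroup.closure rels, r k = c ∧ ∀ l < k, r l = 0 := by
    intro k c hc
    induction hc using AddSubgroup.closure_induction with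
    | mem c hc =>
      obtain ⟨r, hr, h1, h2⟩ := hlift k c hc
      exact ⟨r, AddSubgroup.subset_closure hr, h1, h2⟩
    | zero => exact ⟨0, zero_mem _, rfl, fun _ _ => rfl⟩
    | add x y _ _ hx hy =>
      obtain ⟨r, hr, h1, h2⟩ := hx
      obtain ⟨r', hr', h1', h2'⟩ := hy
      exact ⟨r + r', add_mem hr hr', by rw [Pi.add_apply, h1, h1'],
        fun l hl => by rw [Pi.add_apply, h2 l hl, h2' l hl, add_zero]⟩
    | neg x _ hx =>
      obtain ⟨r, hr, h1, h2⟩ := hx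
      exact ⟨-r, neg_mem hr, by rw [Pi.neg_apply, h1],
        fun l hl => by rw [Pi.neg_apply, h2 l hl, neg_zero]⟩
  suffices key : ∀ t ≤ m, ∀ b : Fin m → Fin n → ℤ, (∀ l : Fin m, (l : ℕ) + t < m → b l = 0) →
      expProd s b = 1 → b ∈ AddSubgroup.closure rels from
    key m le_rfl b (fun l hl => by omega) hb
  intro t
  induction t with
  | zero =>
    intro _ b hb _
    have : b = 0 := funext fun l => hb l (by omega)
    rw [this]
    exact zero_mem _
  | succ t ih =>
    intro ht b hb0 hb1
    let k : Fin m := ⟨m - (t + 1), by omega⟩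
    have hk : (k : ℕ) + (t + 1) = m := by simp only [k]; omega
    have hrest : ∏ l ∈ Finset.univ.erase k, ∏ i, s l i ^ b l i ∈ onePlus (J (k + 1)) := by
      refine Subgroup.prod_mem _ fun l hl => ?_
      have hlk : (l : ℕ) ≠ k := fun h => (Finset.mem_erase.1 hl).1 (Fin.ext h)
      rcases lt_or_gt_of_ne hlk with h | h
      · rw [hb0 l (by omega)]
        simp
      · exact Subgroup.prod_mem _ fun i _ => Subgroup.zpow_mem _
          (onePlus_mono (hanti (show (k : ℕ) + 1 ≤ l by omega)) (hs l i)) _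
    have hprod : (∏ i, s k i ^ b k i) * ∏ l ∈ Finset.univ.erase k, ∏ i, s l i ^ b l i = 1 := by
      rw [Finset.mul_prod_erase _ (fun l => ∏ i, s l i ^ b l i) (Finset.mem_univ k)]
      exact hb1
    have hmem : ∏ i, s k i ^ b k i ∈ onePlus (J (k + 1)) := by
      rw [eq_inv_of_mul_eq_one_left hprod]
      exact Subgroup.inv_mem _ hrest
    rw [hJ, prod_zpow_mem_iff (hs k), ← hJ] at hmem
    obtain ⟨r, hr, hr1, hr0⟩ := hlift' k _ (hC k _ hmem)
    have h1 := ih (by omega) (b - r) (fun l hl => ?_) (by rw [expProd_sub, hb1, hcl r hr, div_one])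
    · simpa using add_mem h1 hr
    · rcases lt_or_eq_of_le (show (l : ℕ) ≤ k by omega) with h | h
      · rw [Pi.sub_apply, hb0 l (by omega), hr0 l h, sub_zero]
      · have : l = k := Fin.ext h
        rw [this, Pi.sub_apply, hr1, sub_self]

/-- The matrix with the entries of a list of lists. -/
def toE (m n : ℕ) (C : List (List ℤ)) : Fin m → Fin n → ℤ := fun k => tv n (gv C k)

variable {e : Fin n → R}

/-- The filtration `F` represents the groups `1 + J k`, where every ideal `J (k + 1)` is the square
of `J k`, and the `s k i` are the generators. -/
structure IsFiltr (F : Filtr) (e : Fin n → R) (J : ℕ → Ideal R) (s : Fin m → Fin n → Rˣ) :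
    Prop where
  models : Models F.ring e
  ixm : F.ixm = List.range m
  one : ev e F.one = 1
  succ : ∀ k, J (k + 1) = J k * J k
  last : J m = ⊥
  gen : ∀ (k : Fin m) (i : Fin n), (s k i : R) = ev e (gv (gm F.gen k) i)
  mem : ∀ (k : Fin m) (i : Fin n), s k i ∈ onePlus (J k)
  tris : ∀ k : Fin m, ∃ K xs, gm F.tris k = relLat F.ring.N F.ring.ix F.ring.ix K xs ∧
    (∀ v, v ∈ modLat F.ring.N n K ↔ lin e v ∈ J (k + 1)) ∧
    ∀ i : Fin n, ev e (gv xs i) = (s k i : R) - 1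
  span : ∀ (k : Fin m), ∀ x ∈ J k, ∃ c : Fin n → ℤ, x = ∑ i, c i • ((s k i : R) - 1)

/-- The computed data represent the filtration by the groups `1 + I ^ 2 ^ k`; since `I` is
nilpotent, the elements `1 + b` are units. -/
theorem Models.exists_isFiltr [Finite R] {d : RingData} (h : Models d e) {gens : List (List ℤ)}
    {I : Ideal R} (hI : I = Ideal.span {x | ∃ g ∈ gens, x = ev e g}) (hnil : IsNilpotent I) :
    ∃ s : Fin (n * d.N.size) → Fin n → Rˣ,
      IsFiltr (filtr d gens) e (fun k => I ^ 2 ^ k) s := by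
  have hB : ∀ k ≤ n * d.N.size, IsBasis d e (gm (idealBases d gens) k) (I ^ 2 ^ k) :=
    fun k hk => h.isBasis_idealBases hI hk
  have hex : ∀ (k : Fin (n * d.N.size)) (i : Fin n), ∃ w ∈ onePlus (I ^ 2 ^ (k : ℕ)),
      (w : R) = 1 + ev e (gv (gm (idealBases d gens) k) i) := fun k i =>
    exists_mem_onePlus (hnil.pow_of_pos (by positivity)) ((hB k k.2.le).ev_mem i)
  choose s hs hs1 using hex
  have hs2 : ∀ (k : Fin (n * d.N.size))
      (i : Fin n), ev e (gv (gm (idealBases d gens) k) i) = (s k i : R) - 1 := fun k i => by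
    rw [hs1]; ring
  refine ⟨s, h, h.layerIx_eq, h.ev_oneVec, fun k => ?_, h.pow_eq_bot hnil, fun k i => ?_, hs,
    fun k => ⟨gm (idealBases d gens) (k + 1), gm (idealBases d gens) k, ?_,
      (hB _ k.2).mem_modLat, hs2 k⟩, fun k x hx => ?_⟩
  · rw [pow_succ, pow_mul, sq]
  · simp only [filtr]
    rw [h.layerIx_eq, gm_map_range k.2, h.ix, gv_map_range i.2, h.ev_addv, h.ev_oneVec, hs1]
  · simp only [filtr]
    rw [h.layerIx_eq, gm_map_range k.2]
  · obtain ⟨c, rfl⟩ := (hB k k.2.le).exists_sum h hx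
    exact ⟨c, by simp only [hs2]⟩

variable {F : Filtr} {J : ℕ → Ideal R} {s : Fin m → Fin n → Rˣ} (hF : IsFiltr F e J s)

include hF

theorem IsFiltr.antitone : Antitone J := antitone_nat_of_succ_le fun k => by
  rw [hF.succ]; exact Ideal.mul_le_left

theorem IsFiltr.layerLog_nonneg (k₀ k : ℕ) (y : List ℤ) (i : ℕ) :
    0 ≤ gz (layerLog F k₀ k y) i ∧ gz (layerLog F k₀ k y) i ≤ F.ring.N := by
  unfold layerLog
  rw [hF.models.ix]
  cases leb k₀ k
  · have : gz ((List.range n).map fun _ => (0 : ℤ)) i = 0 := by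
      rcases lt_or_ge i n with hi | hi
      · rw [gz_map_range hi]
      · rw [gz_map_range_of_le hi]
    rw [cond_false, this]
    simp
  · exact coef_nonneg _ _ _ _ _

/-- Writing `1 - w` as a linear combination of the `s k i - 1` modulo `J (k + 1)` gives exponents
whose product with `w` lies in the next layer. -/
theorem IsFiltr.layerLog_spec {k₀ : ℕ} {k : Fin m} (hk : k₀ ≤ k) {y : List ℤ} {w : Rˣ}
    (hw : (w : R) = ev e y) (hmem : w ∈ onePlus (J k)) :
    w * ∏ i, s k i ^ tv n (layerLog F k₀ k y) i ∈ onePlus (J (k + 1)) := by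
  obtain ⟨K, xs, hT, hK, hx⟩ := hF.tris k
  have hix := hF.models.ix
  have key : ∀ c : Fin n → ℤ, tv n (subv F.ring F.one y) - ∑ t, c t • tv n (gv xs t) ∈
      modLat F.ring.N n K ↔ 1 - (w : R) - ∑ i, c i • ((s k i : R) - 1) ∈ J (k + 1) := by
    intro c
    rw [hK, lin_sub, lin_sum_smul, ← ev, hF.models.ev_subv, hF.one, hw]
    have hx' : ∀ t : Fin n, lin e (tv n (gv xs t)) = (s k t : R) - 1 := hx
    simp only [hx']
  obtain ⟨c, hc⟩ := hF.span k (1 - w) (by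
    have := neg_mem (mem_onePlus_iff.1 hmem)
    rwa [neg_sub] at this)
  have h1 := coef_complete hF.models.pos K xs c ((key c).2 (by
    rw [← hc, sub_self]; exact zero_mem _))
  have h2 := (key _).1 (coef_sound hF.models.pos K xs h1)
  have e1 : layerLog F k₀ k y = (coef F.ring.N (List.range n) (List.range n)
      (relLat F.ring.N (List.range n) (List.range n) K xs) (subv F.ring F.one y)).2 := by
    have : leb k₀ k = true := by simp [leb, hk]
    rw [layerLog, this, cond_true, hT, hix]
  rw [hF.succ] at h2 ⊢
  refine mul_prod_zpow_mem (hF.mem k) _ hmem ?_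
  rw [e1]
  exact h2

/-- One layer after the other is removed from `w`, until a power of the ideal that is zero is
reached. -/
theorem IsFiltr.dlog_spec (k₀ : ℕ) (hk₀ : k₀ ≤ m) {y : List ℤ} {w : Rˣ} (hw : (w : R) = ev e y)
    (hmem : w ∈ onePlus (J k₀)) :
    w * expProd s (toE m n (dlog F k₀ y)) = 1 ∧
      ∀ l : Fin m, (l : ℕ) < k₀ → toE m n (dlog F k₀ y) l = 0 := by
  have key : ∀ t ≤ m, ∀ r, r = (List.range t).foldl (fun s k =>
      (mulProd F.ring s.1 (gm F.gen k) (layerLog F k₀ k s.1), s.2 ++ [layerLog F k₀ k s.1]))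
        (y, ([] : List (List ℤ))) → r.2.length = t ∧
      ((w * expProd s (toE m n r.2) : Rˣ) : R) = ev e r.1 ∧
      w * expProd s (toE m n r.2) ∈ onePlus (J (max k₀ t)) ∧
      ∀ l : Fin m, (l : ℕ) < k₀ → toE m n r.2 l = 0 := by
    intro t
    induction t with
    | zero =>
      rintro _ _ rfl
      have e0 : toE m n [] = 0 := by
        ext l i; simp [toE, tv, gv, gz]
      refine ⟨rfl, ?_, ?_, ?_⟩
      · simp only [List.range_zero, List.foldl_nil, e0, expProd_zero, mul_one, hw]
      · simpa only [List.range_zero, List.foldl_nil, e0, expProd_zero, mul_one, Nat.max_zero]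
      · intro l _
        simp only [List.range_zero, List.foldl_nil, e0]
        rfl
    | succ t ih =>
      rintro ht _ rfl
      obtain ⟨h1, h2, h3, h4⟩ := ih (by omega) _ rfl
      rw [List.range_succ, List.foldl_append, List.foldl_cons, List.foldl_nil]
      set r := (List.range t).foldl _ _ with hr
      clear_value r
      let k : Fin m := ⟨t, ht⟩
      set c := layerLog F k₀ t r.1 with hc
      have e1 : toE m n (r.2 ++ [c]) = toE m n r.2 + Pi.single k (tv n c) := by
        ext l i
        simp only [toE, Pi.add_apply]
        rcases lt_trichotomy (l : ℕ) t with hl | hl | hl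
        · rw [gv_append_left (by omega), Pi.single_eq_of_ne (by
            intro h; simp [k, h] at hl)]
          simp
        · have : l = k := Fin.ext hl
          subst this
          have := gv_append_length r.2 c
          rw [h1] at this
          simp only [Pi.single_eq_same, k, this]
          have : gv r.2 t = [] := by simp [gv, List.getD, h1]
          rw [this]
          simp [tv, gz]
        · rw [Pi.single_eq_of_ne (by intro h; simp [k, h] at hl)]
          have : gv r.2 l = [] := by
            simp [gv, List.getD, h1, hl.le]
          rw [this]
          have : gv (r.2 ++ [c]) l = [] := by
            simp only [gv, List.getD]
            rw [List.getElem?_eq_none (by simp; omega)]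
            rfl
          rw [this]
          simp [tv, gz]
      have e2 : w * expProd s (toE m n (r.2 ++ [c])) =
          w * expProd s (toE m n r.2) * ∏ i, s k i ^ tv n c i := by
        rw [e1, expProd_add, expProd_single, mul_assoc]
      refine ⟨by simp [h1], ?_, ?_, fun l hl => ?_⟩
      · dsimp only
        rw [e2, Units.val_mul, h2]
        exact (hF.models.ev_mulProd r.1 (gm F.gen k) c (s k) (hF.gen k)
          (hF.layerLog_nonneg k₀ t r.1)).symm
      · dsimp only
        rw [e2]
        rcases lt_or_ge t k₀ with hlt | hge
        · -- Before layer `k₀` nothing happens.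
          have hc0 : tv n c = 0 := by
            have : leb k₀ t = false := by simp [leb, hlt]
            rw [hc, layerLog, this, cond_false, hF.models.ix, tv_map_range]
            rfl
          rw [hc0, max_eq_left (by omega)]
          rw [max_eq_left (by omega)] at h3
          simpa using h3
        · rw [max_eq_right (by omega)] at h3 ⊢
          exact hF.layerLog_spec (k := k) hge h2 h3
      · dsimp only
        rw [e1, Pi.add_apply, h4 l hl, zero_add]
        by_cases hlk : l = k
        · subst hlk
          have : leb k₀ t = false := by simpa [leb] using hl
          rw [Pi.single_eq_same, hc, layerLog, this, cond_false, hF.models.ix, tv_map_range]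
          rfl
        · rw [Pi.single_eq_of_ne hlk]
  obtain ⟨-, -, h3, h4⟩ := key m le_rfl _ rfl
  rw [max_eq_right hk₀, hF.last, mem_onePlus_iff, Ideal.mem_bot, sub_eq_zero] at h3
  rw [dlog, hF.ixm]
  exact ⟨Units.ext h3, h4⟩

/-- The relations of all layers, continued through the later layers by discrete logarithms, are
defining relations. -/
theorem IsFiltr.relMats_spec (b : Fin m → Fin n → ℤ) :
    expProd s b = 1 ↔ b ∈ AddSubgroup.closure {r | ∃ C ∈ relMats F, r = toE m n C} := by
  have hix := hF.models.ix
  have mem_relMats : ∀ C, C ∈ relMats F ↔ ∃ k : Fin m, ∃ r ∈ kernelRows F.ring.ix F.ring.ix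
      (gm F.tris k), C = relMat F k r := by
    intro C
    rw [relMats, List.mem_flatten, hF.ixm]
    constructor
    · rintro ⟨l, hl, hC⟩
      obtain ⟨k, hk, rfl⟩ := List.mem_map.1 hl
      obtain ⟨r, hr, rfl⟩ := List.mem_map.1 hC
      exact ⟨⟨k, List.mem_range.1 hk⟩, r, hr, rfl⟩
    · rintro ⟨k, r, hr, rfl⟩
      exact ⟨_, List.mem_map.2 ⟨k, List.mem_range.2 k.2, rfl⟩, List.mem_map.2 ⟨r, hr, rfl⟩⟩
  have kernel : ∀ (k : Fin m) (c : Fin n → ℤ), c ∈ AddSubgroup.closure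
      {v | ∃ r ∈ kernelRows F.ring.ix F.ring.ix (gm F.tris k), v = tv n r} ↔
        ∑ i, c i • ((s k i : R) - 1) ∈ J (k + 1) := by
    intro k c
    obtain ⟨K, xs, hT, hK, hx⟩ := hF.tris k
    rw [hT, hix, mem_closure_kernelRows hF.models.pos, hK, lin_sum_smul]
    have hx' : ∀ t : Fin n, lin e (tv n (gv xs t)) = (s k t : R) - 1 := hx
    simp only [hx']
  have rel : ∀ (k : Fin m), ∀ r ∈ kernelRows F.ring.ix F.ring.ix (gm F.tris k),
      expProd s (toE m n (relMat F k r)) = 1 ∧ toE m n (relMat F k r) k = tv n r ∧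
        ∀ l < k, toE m n (relMat F k r) l = 0 := by
    intro k r hr
    have hnonneg : ∀ i, 0 ≤ gz r i ∧ gz r i ≤ F.ring.N := by
      obtain ⟨K, xs, hT, -, -⟩ := hF.tris k
      rw [hT, hix] at hr
      exact kernelRows_nonneg hF.models.pos K xs hr
    have h1 : ∏ i, s k i ^ tv n r i ∈ onePlus (J (k + 1)) := by
      rw [hF.succ, prod_zpow_mem_iff (hF.mem k), ← hF.succ]
      exact (kernel k _).1 (AddSubgroup.subset_closure ⟨r, hr, rfl⟩)
    have h2 := hF.models.ev_mulProd F.one (gm F.gen k) r (s k) (hF.gen k) hnonneg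
    rw [hF.one, one_mul] at h2
    obtain ⟨h3, h4⟩ := hF.dlog_spec (k + 1) k.2 h2.symm h1
    have e1 : toE m n (relMat F k r) = Pi.single k (tv n r) +
        toE m n (dlog F (k + 1) (mulProd F.ring F.one (gm F.gen k) r)) := by
      ext l i
      rw [Pi.add_apply]
      by_cases hlk : l = k
      · subst hlk
        rw [h4 l (Nat.lt_succ_self _), add_zero, Pi.single_eq_same, toE, relMat, hF.ixm,
          gv_map_range l.2]
        simp
      · rw [Pi.single_eq_of_ne hlk, zero_add, toE, relMat, hF.ixm, gv_map_range l.2,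
          beq_false_of_ne (fun h => hlk (Fin.ext h))]
        rfl
    refine ⟨?_, ?_, fun l hl => ?_⟩
    · rw [e1, expProd_add, expProd_single, h3]
    · rw [e1, Pi.add_apply, h4 k (Nat.lt_succ_self _), add_zero, Pi.single_eq_same]
    · rw [e1, Pi.add_apply, h4 l (by have : (l : ℕ) < k := hl; omega), add_zero,
        Pi.single_eq_of_ne hl.ne]
  refine expProd_eq_one_iff hF.succ hF.mem
    (fun k => {v | ∃ r ∈ kernelRows F.ring.ix F.ring.ix (gm F.tris k), v = tv n r})
    (fun k c hc => (kernel k c).2 hc) _ ?_ ?_ b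
  · rintro _ ⟨C, hC, rfl⟩
    obtain ⟨k, r, hr, rfl⟩ := (mem_relMats C).1 hC
    exact (rel k r hr).1
  · rintro k _ ⟨r, hr, rfl⟩
    exact ⟨_, ⟨_, (mem_relMats _).2 ⟨k, r, hr, rfl⟩, rfl⟩, (rel k r hr).2⟩

theorem IsFiltr.closure_range : Subgroup.closure (Set.range fun p : Fin m × Fin n => s p.1 p.2) =
    onePlus (J 0) := by
  refine le_antisymm ((Subgroup.closure_le _).2 ?_) fun w hw => ?_
  · rintro _ ⟨p, rfl⟩
    exact onePlus_mono (hF.antitone (Nat.zero_le _)) (hF.mem p.1 p.2)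
  · obtain ⟨v, hv⟩ := hF.models.surjective w
    have h0 : ev e (List.ofFn v) = w := by
      rw [← hv, ev]
      congr 1
      ext i
      simp [tv, gz]
    have h1 := (hF.dlog_spec 0 (Nat.zero_le _) h0.symm hw).1
    rw [eq_inv_of_mul_eq_one_left h1, ← expProd_neg]
    exact Subgroup.prod_mem _ fun k _ => Subgroup.prod_mem _ fun i _ =>
      Subgroup.zpow_mem _ (Subgroup.subset_closure (Set.mem_range_self (k, i))) _

/-- Taking the `N`-th power leads from every layer to the next one. -/
theorem IsFiltr.pow_eq_one {w : Rˣ} (hw : w ∈ onePlus (J 0)) : w ^ F.ring.N ^ m = 1 := by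
  have key : ∀ k, w ^ F.ring.N ^ k ∈ onePlus (J k) := by
    intro k
    induction k with
    | zero => simpa using hw
    | succ k ih =>
      rw [pow_succ, pow_mul, hF.succ]
      have := (prod_zpow_mem_iff (ι := Unit) (s := fun _ => w ^ F.ring.N ^ k) (fun _ => ih)
        fun _ => (F.ring.N : ℤ)).2 (by simp [hF.models.smul_eq_zero])
      simpa using this
  have h := key m
  rw [hF.last, mem_onePlus_iff, Ideal.mem_bot, sub_eq_zero] at h
  exact Units.ext h

end Group

/-! ### From matrices of exponents to vectors -/

section Flatten

variable {m n : ℕ}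

theorem tv_ofFn (v : Fin n → ℤ) : tv n (List.ofFn v) = v := by
  ext i
  simp [tv, gz]

theorem map_range_eq_ofFn {α : Type*} (n : ℕ) (f : ℕ → α) :
    (List.range n).map f = List.ofFn fun i : Fin n => f i := by
  refine List.ext_getElem (by simp) fun i _ _ => by simp

theorem flatten_map_range {α : Type*} (m n : ℕ) (f : ℕ → ℕ → α) :
    ((List.range m).map fun l => (List.range n).map fun i => f l i).flatten =
      List.ofFn fun j : Fin (m * n) => f j.divNat j.modNat := by
  rw [List.ofFn_mul, map_range_eq_ofFn]
  congr 1
  refine congrArg List.ofFn (funext fun l => ?_)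
  rw [map_range_eq_ofFn]
  refine congrArg List.ofFn (funext fun i => ?_)
  have h : (⟨l * n + i, by
      calc (l : ℕ) * n + i < (l + 1) * n := by
            rw [add_mul, one_mul]; exact Nat.add_lt_add_left i.2 _
        _ ≤ m * n := Nat.mul_le_mul_right _ l.2⟩ : Fin (m * n)) = finProdFinEquiv (l, i) :=
    Fin.ext (by simp [finProdFinEquiv, mul_comm, add_comm])
  have h1 := finProdFinEquiv.symm_apply_apply (l, i)
  rw [← h] at h1
  have h2 : (Fin.divNat _, Fin.modNat _) = (l, i) := h1
  rw [Prod.mk.injEq] at h2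
  rw [h2.1, h2.2]

/-- The entries of a matrix, row by row. -/
def join (m n : ℕ) : (Fin m → Fin n → ℤ) ≃+ (Fin (m * n) → ℤ) where
  toFun b j := b j.divNat j.modNat
  invFun c k i := c (finProdFinEquiv (k, i))
  left_inv b := by
    ext k i
    have : (Fin.divNat _, Fin.modNat _) = (k, i) := finProdFinEquiv.symm_apply_apply (k, i)
    rw [Prod.mk.injEq] at this
    dsimp only
    rw [this.1, this.2]
  right_inv c := by
    ext j
    exact congrArg c (finProdFinEquiv.apply_symm_apply j)
  map_add' _ _ := rfl

theorem flat_eq (C : List (List ℤ)) :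
    flat (List.range m) (List.range n) C = List.ofFn (join m n (toE m n C)) :=
  flatten_map_range m n fun l i => gz (gv C l) i

theorem prod_zpow_join {G : Type*} [CommGroup G] (s : Fin m → Fin n → G)
    (b : Fin m → Fin n → ℤ) :
    ∏ j : Fin (m * n), s j.divNat j.modNat ^ join m n b j = ∏ k, ∏ i, s k i ^ b k i := by
  rw [← Fintype.prod_prod_type' fun k i => s k i ^ b k i]
  exact Equiv.prod_comp finProdFinEquiv.symm fun p : Fin m × Fin n => s p.1 p.2 ^ b p.1 p.2

/-- The homomorphism `b ↦ ∏ i, s i ^ b i`, with values in the additive version of the group. -/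
def powHom {G : Type*} [CommGroup G] {k : ℕ} (s : Fin k → G) : (Fin k → ℤ) →+ Additive G where
  toFun b := Additive.ofMul (∏ i, s i ^ b i)
  map_zero' := by simp
  map_add' b c := by simp [zpow_add, Finset.prod_mul_distrib]

theorem powLen_eq (N : ℕ) (l : List ℕ) : powLen N l = N ^ l.length := by
  have : ∀ a, l.foldl (fun s _ => s * N) a = a * N ^ l.length := by
    induction l with
    | nil => simp
    | cons x l ih => intro a; rw [List.foldl_cons, ih, List.length_cons, pow_succ]; ring
  rw [powLen, this, one_mul]

end Flatten

/-! ### Correctness of the algorithms -/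

section Correct

theorem Models.memOnePlus_iff {R : Type u} [CommRing R] {n : ℕ} {e : Fin n → R} {d : RingData}
    (h : Models d e) {gens : List (List ℤ)} {I : Ideal R}
    (hI : I = Ideal.span {x | ∃ g ∈ gens, x = ev e g}) (z : List ℤ) :
    memOnePlus d gens z = true ↔ ev e z - 1 ∈ I := by
  have hB := h.isBasis_idealBasis hI
  have hT : IsTri d.N n (idealBasis d gens) := by
    rw [idealBasis, h.ix]; exact (tri_spec h.pos _).1
  obtain ⟨h1, h2, h3⟩ := redTri_spec h.pos le_rfl hT (fun j => (hB.mem_rowLat _).2 (by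
    rw [lin_single, h.smul_eq_zero]; exact I.zero_mem)) (subv d z (oneVec d))
  have h4 : ev e z - 1 = lin e (tv n (subv d z (oneVec d))) := by
    rw [← ev, h.ev_subv, h.ev_oneVec]
  rw [memOnePlus, h.ix, h4, ← hB.mem_rowLat]
  constructor
  · intro h5
    have h6 : tv n (redTri d.N (List.range n) (List.range n) (idealBasis d gens)
        (subv d z (oneVec d))).2 = 0 := funext fun j => h2 h5 j j.2
    rwa [h6, sub_zero] at h1
  · exact fun h5 => h3 ⟨0, by rwa [sub_zero], fun _ _ => rfl⟩

variable {R : Type u} [CommRing R] {m n : ℕ} {e : Fin n → R} {F : Filtr} {J : ℕ → Ideal R}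
  {s : Fin m → Fin n → Rˣ} (hF : IsFiltr F e J s)

include hF

theorem IsFiltr.relVecs_eq :
    relVecs F = ((relMats F).map fun C => join m n (toE m n C)).map List.ofFn := by
  rw [relVecs, hF.ixm, hF.models.ix, List.map_map]
  exact List.map_congr_left fun C _ => flat_eq C

theorem IsFiltr.genVecs_eq : genVecs F =
    (List.ofFn fun j : Fin (m * n) => tv n (gv (gm F.gen j.divNat) j.modNat)).map List.ofFn := by
  rw [genVecs, hF.ixm, hF.models.ix, List.map_ofFn]
  simp only [map_range_eq_ofFn n fun j => gz _ j]
  exact flatten_map_range m n fun k i => List.ofFn fun j : Fin n => gz (gv (gm F.gen k) i) j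

theorem IsFiltr.isDefiningRelations : IsDefiningRelations
    (fun j : Fin (m * n) => s j.divNat j.modNat)
    ((relMats F).map fun C => join m n (toE m n C)) := by
  intro b
  obtain ⟨b, rfl⟩ := (join m n).surjective b
  rw [prod_zpow_join]
  refine (hF.relMats_spec b).trans ?_
  have h1 : {r | r ∈ (relMats F).map fun C => join m n (toE m n C)} =
      (join m n).toAddMonoidHom '' {r | ∃ C ∈ relMats F, r = toE m n C} := by
    ext r
    simp only [Set.mem_ofPred_eq, List.mem_map, Set.mem_image]
    constructor
    · rintro ⟨C, hC, rfl⟩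
      exact ⟨_, ⟨C, hC, rfl⟩, rfl⟩
    · rintro ⟨_, ⟨C, hC, rfl⟩, rfl⟩
      exact ⟨C, hC, rfl⟩
  rw [h1, ← AddMonoidHom.map_closure]
  exact (AddSubgroup.mem_map_iff_mem (join m n).injective).symm

theorem IsFiltr.closure_range_flat :
    Subgroup.closure (Set.range fun j : Fin (m * n) => s j.divNat j.modNat) = onePlus (J 0) := by
  rw [← hF.closure_range]
  congr 1
  exact finProdFinEquiv.symm.surjective.range_comp fun p : Fin m × Fin n => s p.1 p.2

/-- The lattice generated by the defining relations contains the multiples of `N ^ m`, so adding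
them changes nothing. -/
theorem IsFiltr.mem_modLat_relVecs (b : Fin (m * n) → ℤ) :
    b ∈ modLat (F.ring.N ^ m) (m * n) (relVecs F) ↔
      ∏ j : Fin (m * n), s j.divNat j.modNat ^ b j = 1 := by
  rw [hF.isDefiningRelations b]
  have hset : {v | ∃ w ∈ relVecs F, v = tv (m * n) w} =
      {r | r ∈ (relMats F).map fun C => join m n (toE m n C)} := by
    ext v
    rw [hF.relVecs_eq]
    constructor
    · rintro ⟨w, hw, rfl⟩
      obtain ⟨r, hr, rfl⟩ := List.mem_map.1 hw
      rwa [tv_ofFn]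
    · intro hv
      exact ⟨_, List.mem_map.2 ⟨v, hv, rfl⟩, (tv_ofFn v).symm⟩
  have hle : modLat (F.ring.N ^ m) (m * n) (relVecs F) = AddSubgroup.closure
      {r | r ∈ (relMats F).map fun C => join m n (toE m n C)} := by
    refine le_antisymm (modLat_le.2 ⟨fun w hw => ?_, fun j => ?_⟩) ?_
    · rw [← hset]
      exact AddSubgroup.subset_closure ⟨w, hw, rfl⟩
    · rw [← hF.isDefiningRelations, Finset.prod_eq_single j (fun i _ hi => by simp [hi]) (by simp),
        Pi.single_eq_same, zpow_natCast]
      exact hF.pow_eq_one (onePlus_mono (hF.antitone (Nat.zero_le _)) (hF.mem _ _))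
    · rw [← hset]
      exact AddSubgroup.closure_mono Set.subset_union_left
  rw [hle]

theorem IsFiltr.dlogVec_spec {y : List ℤ} {w : Rˣ} (hw : (w : R) = ev e y)
    (hmem : w ∈ onePlus (J 0)) :
    w * ∏ j : Fin (m * n), s j.divNat j.modNat ^ tv (m * n) (dlogVec F y) j = 1 := by
  rw [dlogVec, hF.ixm, hF.models.ix, flat_eq, tv_ofFn, prod_zpow_join]
  exact (hF.dlog_spec 0 (Nat.zero_le _) hw hmem).1

/-- Membership in `⟨T⟩` is a linear equation for exponent vectors modulo the lattice of relations.
The vectors belong to inverses, which makes no difference as long as they all do. -/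
theorem IsFiltr.dlogVec_sub_mem_iff {k : ℕ} {T : List (List ℤ)} (hT : T.length = k)
    {t : Fin k → Rˣ} (ht : ∀ i : Fin k, (t i : R) = ev e (gv T i))
    (htmem : ∀ i, t i ∈ onePlus (J 0))
    {z : List ℤ} {w : Rˣ} (hw : (w : R) = ev e z) (hmem : w ∈ onePlus (J 0)) (b : Fin k → ℤ) :
    tv (m * n) (dlogVec F z) - ∑ i, b i • tv (m * n) (gv (T.map fun t => dlogVec F t) i) ∈
      modLat (F.ring.N ^ m) (m * n) (relVecs F) ↔ w = ∏ i, t i ^ b i := by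
  have hgv : ∀ i : Fin k, gv (T.map fun t => dlogVec F t) i = dlogVec F (gv T i) := fun i => by
    simp [gv, List.getD, hT]
  set φ := powHom fun j : Fin (m * n) => s j.divNat j.modNat with hφ
  have h1 : φ (tv (m * n) (dlogVec F z)) = Additive.ofMul w⁻¹ :=
    congrArg Additive.ofMul (eq_inv_of_mul_eq_one_right (hF.dlogVec_spec hw hmem))
  have h2 : ∀ i : Fin k, φ (tv (m * n) (dlogVec F (gv T i))) = Additive.ofMul (t i)⁻¹ := fun i =>
    congrArg Additive.ofMul (eq_inv_of_mul_eq_one_right (hF.dlogVec_spec (ht i) (htmem i)))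
  rw [hF.mem_modLat_relVecs]
  change φ _ = 0 ↔ _
  simp only [hgv]
  rw [map_sub, map_sum, sub_eq_zero, h1]
  simp only [map_zsmul, h2, ← ofMul_zpow, ← ofMul_prod]
  rw [Additive.ofMul.injective.eq_iff]
  simp only [inv_zpow', zpow_neg, Finset.prod_inv_distrib, inv_inj]

theorem IsFiltr.logCoef_eq {k : ℕ} {T : List (List ℤ)} (hT : T.length = k) (z : List ℤ) :
    logCoef F T z = coef (F.ring.N ^ m) (List.range (m * n)) (List.range k)
      (relLat (F.ring.N ^ m) (List.range (m * n)) (List.range k) (relVecs F)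
        (T.map fun t => dlogVec F t)) (dlogVec F z) := by
  have h1 : indices (genVecs F) = List.range (m * n) := by
    rw [indices, hF.genVecs_eq]; simp
  rw [logCoef, h1, indices, hT, powLen_eq, hF.ixm, List.length_range]

end Correct

theorem Models.discreteLog_spec {R : Type u} [CommRing R] [Finite R] {n : ℕ} {e : Fin n → R}
    {d : RingData}
    (h : Models d e) {gens : List (List ℤ)}
    {I : Ideal R} (hI : I = Ideal.span {x | ∃ g ∈ gens, x = ev e g}) (hnil : IsNilpotent I)
    {k : ℕ} {T : List (List ℤ)} (hT : T.length = k)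
    {t : Fin k → Rˣ} (ht : ∀ i : Fin k, (t i : R) = ev e (gv T i)) (htmem : ∀ i, t i ∈ onePlus I)
    (z : List ℤ) :
    (discreteLog d gens T z = none ∨ ∃ b : Fin k → ℤ, discreteLog d gens T z = some (List.ofFn b) ∧
      ev e z = ((∏ i, t i ^ b i : Rˣ) : R)) ∧
    ((∃ w ∈ Subgroup.closure (Set.range t), (w : R) = ev e z) → discreteLog d gens T z ≠ none) := by
  obtain ⟨s, hF⟩ := h.exists_isFiltr hI hnil
  have hJ0 : I ^ 2 ^ 0 = I := by simp
  set F := filtr d gens with hFdef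
  have hpos : 0 < F.ring.N ^ (n * d.N.size) := pow_pos hF.models.pos _
  have hcoef := hF.logCoef_eq hT z
  have hone := h.memOnePlus_iff hI z
  constructor
  · by_cases hb : (memOnePlus d gens z && (logCoef F T z).1) = true
    · right
      rw [Bool.and_eq_true, hone] at hb
      obtain ⟨w, hwmem, hw⟩ := exists_mem_onePlus hnil hb.1
      rw [add_sub_cancel] at hw
      refine ⟨tv k (logCoef F T z).2, ?_, ?_⟩
      · rw [discreteLog, hone.2 hb.1, hb.2, Bool.and_self, cond_true, hcoef]
        simp only [coef, map_range_eq_ofFn, tv_ofFn]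
      · rw [hcoef] at hb ⊢
        have h1 := coef_sound hpos (relVecs F) _ hb.2
        rw [← hw]
        congr 1
        exact (hF.dlogVec_sub_mem_iff hT ht (by simpa using htmem) hw (by simpa using hwmem) _).1 h1
    · left
      rw [Bool.not_eq_true] at hb
      rw [discreteLog, hb, cond_false]
  · rintro ⟨w, hwcl, hw⟩
    have hwmem : w ∈ onePlus I := (Subgroup.closure_le _).2 (by
      rintro _ ⟨i, rfl⟩; exact htmem i) hwcl
    obtain ⟨b, hb⟩ := Subgroup.mem_closure_range_iff_of_fintype.1 hwcl
    have h1 := coef_complete hpos (relVecs F) (T.map fun t => dlogVec F t) b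
      ((hF.dlogVec_sub_mem_iff hT ht (by simpa using htmem) hw (by simpa using hwmem) b).2 hb)
    rw [← hcoef] at h1
    rw [discreteLog, hone.2 (by rw [← hw]; exact mem_onePlus_iff.1 hwmem), h1]
    simp

/-! ### Encodings of the input and the output -/

section Encode

open Encoding

theorem encVec_eq {n : ℕ} (v : Fin n → ℤ) : encVec v = enc (List.ofFn v) := by
  change _ = encList ((List.ofFn v).map enc)
  rw [List.map_ofFn]
  rfl

theorem encVecs_eq {n : ℕ} (l : List (Fin n → ℤ)) : encVecs l = enc (l.map List.ofFn) := by
  change _ = encList ((l.map List.ofFn).map enc)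
  rw [List.map_map, encVecs]
  congr 1
  exact List.map_congr_left fun v _ => encVec_eq v

/-- The relations as lists. -/
def specRels (P : RingSpec) : List (List ℤ) := P.rels.map List.ofFn

/-- The table of structure constants as a list. -/
def specTab (P : RingSpec) : List (List (List ℤ)) :=
  List.ofFn fun i => List.ofFn fun j => List.ofFn (P.mul i j)

theorem specEnc_eq (P : RingSpec) : P.enc = enc (specRels P, specTab P) := by
  change Data.pair _ _ = Data.pair (enc (specRels P)) (encList ((specTab P).map enc))
  rw [encVecs_eq, specTab, List.map_ofFn]
  congr 2
  refine congrArg List.ofFn (funext fun i => ?_)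
  rw [encVecs_eq, List.map_ofFn]
  rfl

theorem RingSpec.Specifies.models {R : Type u} [CommRing R] [Finite R] {P : RingSpec}
    {e : Fin P.n → R} (h : P.Specifies e) : Models (ringData (specRels P) (specTab P)) e := by
  have hix : indices (specTab P) = List.range P.n := by simp [indices, specTab]
  have hrels : {w | ∃ r ∈ specRels P, w = tv P.n r} = {r | r ∈ P.rels} := by
    ext v
    constructor
    · rintro ⟨w, hw, rfl⟩
      obtain ⟨r, hr, rfl⟩ := List.mem_map.1 hw
      rwa [tv_ofFn]
    · intro hv
      exact ⟨_, List.mem_map.2 ⟨v, hv, rfl⟩, (tv_ofFn v).symm⟩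
  have hdet := gram_det (rels := P.rels) (N := Nat.card R) Nat.card_pos fun v => by
    rw [← h.relations]
    change linHom e _ = 0
    rw [map_zsmul, natCast_zsmul, card_nsmul_eq_zero']
  refine ⟨Nat.pos_of_ne_zero ?_, hix, fun x => ?_, h.surjective, fun v => ?_, fun i j => ?_⟩
  · simp only [ringData, hix]
    exact hdet.1
  · obtain ⟨v, rfl⟩ := h.surjective x
    have := (h.relations _).2 (hdet.2 v)
    simp only [ringData, hix]
    exact (map_zsmul (linHom e) _ v).symm.trans this
  · simp only [ringData]
    rw [hrels, h.relations]
  · rw [h.mul_eq, ev]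
    congr 1
    simp [ringData, specTab, gm, gv, tv_ofFn]

theorem span_eq {R : Type u} [CommRing R] {n : ℕ} (e : Fin n → R) (gens : List (Fin n → ℤ)) :
    Ideal.span (lin e '' {g | g ∈ gens}) =
      Ideal.span {x | ∃ g ∈ gens.map List.ofFn, x = ev e g} := by
  congr 1
  ext x
  constructor
  · rintro ⟨g, hg, rfl⟩
    exact ⟨_, List.mem_map.2 ⟨g, hg, rfl⟩, by rw [ev, tv_ofFn]⟩
  · rintro ⟨_, hg, rfl⟩
    obtain ⟨g, hg', rfl⟩ := List.mem_map.1 hg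
    exact ⟨g, hg', by rw [ev, tv_ofFn]⟩

end Encode

end NilUnits

theorem theorem1p4 :
    -- generators and defining relations for `1 + I`
    (∃ (p : Prog) (B : Polynomial ℕ),
      ∀ (P : RingSpec) (gens : List (Fin P.n → ℤ))
        (R : Type u) [CommRing R] [Finite R] (e : Fin P.n → R) (I : Ideal R),
        P.Specifies e → I = Ideal.span (lin e '' {g | g ∈ gens}) → IsNilpotent I →
        ∃ (m : ℕ) (S : Fin m → Fin P.n → ℤ) (rels : List (Fin m → ℤ)),
          RunsInTime p B (.pair P.enc (encVecs gens))
            (.pair (encVecs (List.ofFn S)) (encVecs rels)) ∧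
          ∃ s : Fin m → Rˣ, (∀ i, (s i : R) = lin e (S i)) ∧
            Subgroup.closure (Set.range s) = onePlus I ∧ IsDefiningRelations s rels) ∧
    -- discrete logarithms in subgroups of `1 + I`
    (∃ (p : Prog) (B : Polynomial ℕ),
      ∀ (P : RingSpec) (gens : List (Fin P.n → ℤ))
        (R : Type u) [CommRing R] [Finite R] (e : Fin P.n → R) (I : Ideal R),
        P.Specifies e → I = Ideal.span (lin e '' {g | g ∈ gens}) → IsNilpotent I →
        ∀ (k : ℕ) (T : Fin k → Fin P.n → ℤ) (t : Fin k → Rˣ) (z : Fin P.n → ℤ),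
          (∀ i, (t i : R) = lin e (T i)) → (∀ i, t i ∈ onePlus I) →
          ∃ out : Option (Fin k → ℤ),
            RunsInTime p B
              (.pair (.pair P.enc (encVecs gens)) (.pair (encVecs (List.ofFn T)) (encVec z)))
              (encOption out) ∧
            (out.isSome ↔ ∃ w ∈ Subgroup.closure (Set.range t), (w : R) = lin e z) ∧
            ∀ b : Fin k → ℤ, out = some b → lin e z = ((∏ i, t i ^ b i : Rˣ) : R)) := by
  refine ⟨?_, ?_⟩
  · obtain ⟨p, B, hp⟩ := polyTime_presentation
    refine ⟨p, B, fun P gens R _ _ e I hP hI hnil => ?_⟩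
    have hM := hP.models
    rw [span_eq] at hI
    obtain ⟨s, hF⟩ := hM.exists_isFiltr hI hnil
    refine ⟨_, _, _, ?_, fun j => s j.divNat j.modNat, fun j => hF.gen _ _, ?_,
      hF.isDefiningRelations⟩
    · have h1 := hp ((specRels P, specTab P), gens.map List.ofFn)
      rw [presentation, hF.genVecs_eq, hF.relVecs_eq] at h1
      rw [specEnc_eq, encVecs_eq, encVecs_eq, encVecs_eq]
      exact h1
    · rw [hF.closure_range_flat]
      simp
  · obtain ⟨p, B, hp⟩ := polyTime_discreteLog
    refine ⟨p, B, fun P gens R _ _ e I hP hI hnil k T t z ht htmem => ?_⟩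
    rw [span_eq] at hI
    obtain ⟨h1, h2⟩ := hP.models.discreteLog_spec hI hnil (T := (List.ofFn T).map List.ofFn)
      (by simp) (fun i => by rw [ht, ev]; simp [gv, tv_ofFn]) htmem (List.ofFn z)
    have h3 := hp (((specRels P, specTab P), gens.map List.ofFn),
      (List.ofFn T).map List.ofFn, List.ofFn z)
    rw [specEnc_eq, encVecs_eq, encVecs_eq, encVec_eq]
    rw [ev, tv_ofFn] at h1 h2
    rcases h1 with h1 | ⟨b, h1, hb⟩
    · simp only [h1] at h3
      exact ⟨none, h3, ⟨by simp, fun h => absurd h1 (h2 h)⟩, by simp⟩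
    · simp only [h1] at h3
      refine ⟨some b, ?_, ⟨fun _ => ⟨_, ?_, hb.symm⟩, by simp⟩, ?_⟩
      · rw [encOption, encVec_eq]
        exact h3
      · exact Subgroup.mem_closure_range_iff_of_fintype.2 ⟨b, rfl⟩
      · rintro _ ⟨⟩
        exact hb
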